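/- **Setting.** Let $E$ be a Euclidean space of dimension $2n$ with a compatible complex structure $J$, and let $\xi_1,\dots,\xi_n,\eta_1,\dots,\eta_n$ be an orthonormal basis of $E$ with $J\xi_j=-\eta_j$, $J\eta_j=\xi_j$; let $x_1,\dots,x_n,y_1,\dots,y_n$ be the dual basis of $E^*$. Let $G$ be a finite reflection group acting on $E$ with set of reflections $\mathcal S$, let $c:\mathcal S\to\mathbb R$ be invariant under conjugation, and for $s\in\mathcal S$ let $\alpha_s\in E$ and $a_s\in E^*$ be $-1$-eigenvectors of $s$. The rational Cherednik algebra $H_c=H_c(G,E)$ is the quotient of $T(E_{\mathbb C}\oplus E_{\mathbb C}^*)\rtimes\mathbb C[G]$ by $[\xi,\eta]=0$, $[x,y]=0$ and $$[\xi,x]=\langle x,\xi\rangle-2\sum_{s\in\mathcal S}\frac{\langle x,\alpha_s\rangle\langle a_s,\xi\rangle}{\langle a_s,\alpha_s\rangle}\,c(s)\,s\qquad(\xi,\eta\in E,\ x,y\in E^*).$$ For an irreducible complex representation $\tau$ of $G$ on $V$, let $M_c(\tau)\cong\mathbb C[E]\otimes V$ be the standard module, i.e. the $H_c$-module induced from $V$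 on which $G$ acts by $\tau$ and $E$ acts by $0$; $M_c(\tau)_k$ is its part of polynomial degree $k$, and $N_c(\tau)$ is the scalar by which $\sum_{s}c(s)s$ acts on $V$. Let $\beta$ be a contravariant Hermitian form on $M_c(\tau)$ which restricts to a $G$-invariant inner product on $V$ (contravariant with respect to the conjugate-linear anti-involution $*$ of $H_c$ that exchanges dual orthonormal bases of $E$ and $E^*$ and fixes the reflections). Put $z_j=x_j+iy_j$, $\bar z_j=x_j-iy_j$, $\zeta_j=\frac12(\xi_j-i\eta_j)$, $\bar\zeta_j=\frac12(\xi_j+i\eta_j)$. Let $\mathcal C$ be the complex Clifford algebra with generators $e_1,\dots,e_{2n}$, $\{e_j,e_k\}=2\delta_{jk}$, let $f_j=\frac12(e_j-ie_{n+j})$, $f_j^\dagger=\frac12(e_j+ie_{n+j})$, and let $\mathbb S=\bigwedge\langle f_1^\dagger,\dots,f_n^\dagger\rangle$ be the spinor module ($f_j^\dagger$ acts by exterior multiplication and $f_j$ by contraction), $\mathbb S^l$ its degree-$l$ part, with the Hermitian form for which the $f_j^\dagger$ are orthonormal, extended to $\mathbb S$ by Gram determinants. In $H_c\otimes\mathcal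 C$ let $$F_+=\sum_j\bar z_jf_j^\dagger,\quad \bar F_+=\sum_j z_jf_j,\quad F_-=2\sum_j\zeta_jf_j^\dagger,\quad \bar F_-=2\sum_j\bar\zeta_jf_j,$$ $$E_-=-2\sum_j\zeta_j\bar\zeta_j,\quad H=\sum_j(z_j\zeta_j+\bar z_j\bar\zeta_j)+n-\sum_s c(s)s,\quad Z_0=\sum_j(\bar z_j\bar\zeta_j-z_j\zeta_j),$$ $$Z_1=Z_0-\sum_s c(s)\,s\otimes\tau_s,\quad Z_2=\tfrac12\sum_j[f_j^\dagger,f_j],\quad Z=2Z_2-Z_1,$$ where $\tau_s=1-\frac{2}{\langle a_s,\alpha_s\rangle}\pi^-(\alpha_s)\,\pi^+(a_s^\top)$, $\pi^-(v)=\sum_j\langle\bar z_j,v\rangle f_j^\dagger$, $\pi^+(v)=\sum_j\langle z_j,v\rangle f_j$, and $a_s^\top\in E$ corresponds to $a_s$ under the Euclidean structure. These elements act on $K_c(\tau)=M_c(\tau)\otimes\mathbb S$, which carries the product Hermitian form $(\cdot|\cdot)$. For integers $k,l$ let $\mathcal H_k^l=(M_c(\tau)_k\cap\ker E_-)\otimes\mathbb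 S^l$, let $\mathcal H_{k,\nu}^l$ be the $\nu$-eigenspace of $Z_1$ in $\mathcal H_k^l$, and let $\mathcal M_{k,\nu}^l=\mathcal H_{k,\nu}^l\cap\ker F_-\cap\ker\bar F_-$ (these spaces are zero if $k<0$ or $l<0$). **Proposition.** Assume that $K_c(\tau)$ is unitarisable, i.e. that $(\cdot|\cdot)$ is positive definite. Then for all integers $k,l\ge 0$ and all $\nu\in\mathbb C$, $$\mathcal H_{k,\nu}^l=\mathcal M_{k,\nu}^l\ \oplus\ F_+\mathcal M_{k-1,\nu-1}^{l-1}\ \oplus\ \bar F_+\mathcal M_{k-1,\nu+1}^{l+1}\ \oplus\ (\lambda_1F_+\bar F_+-\lambda_2\bar F_+F_+)\mathcal M_{k-2,\nu}^l,$$ an orthogonal direct sum, where $\lambda_1=k-2+2n-N_c(\tau)+\nu-2l$ is the eigenvalue of $H-Z-2$ on $\mathcal H_{k,\nu}^l$ and $\lambda_2=k-2-N_c(\tau)-\nu+2l$ is the eigenvalue of $H+Z-2$ on $\mathcal H_{k,\nu}^l$. Moreover, for $k=0$ the second, third and fourth summands are zero; for $k=1$ the fourth summand is zero; for $l=0$ the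 second summand is zero; and for $l=n$ the third summand is zero. -/

import Mathlib

open scoped TensorProduct ComplexConjugate

noncomputable section

namespace CherednikSpinor

variable {E : Type*} [NormedAddCommGroup E] [InnerProductSpace ℝ E]

/-! ### Finite reflection groups -/

/-- `g` is the orthogonal reflection in the hyperplane orthogonal to some non-zero vector. -/
def IsReflection (g : E ≃ₗᵢ[ℝ] E) : Prop :=
  ∃ α : E, α ≠ 0 ∧ g = (ℝ ∙ α)ᗮ.reflection

/-- The group `G` of isometries is generated by the reflections that it contains. -/
def IsReflectionGroup (G : Subgroup (E ≃ₗᵢ[ℝ] E)) : Prop :=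
  Subgroup.closure {g : E ≃ₗᵢ[ℝ] E | g ∈ G ∧ IsReflection g} = G

open Classical in
/-- The set `𝒮` of reflections of a finite group `G`. -/
def reflections (G : Subgroup (E ≃ₗᵢ[ℝ] E)) [Fintype G] : Finset G :=
  Finset.univ.filter fun s => IsReflection (s : E ≃ₗᵢ[ℝ] E)

/-- A choice, for every reflection `s` of `G`, of a `-1`-eigenvector `α_s` of `s` in `E` and of a
`-1`-eigenvector `a_s` of `s` in the dual of `E` (contragredient action `x ↦ x ∘ s⁻¹`). The values
at elements of `G` that are not reflections are never used. -/
structure RootChoice (G : Subgroup (E ≃ₗᵢ[ℝ] E)) where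
  /-- The root `α_s`. -/
  root : G → E
  /-- The coroot `a_s`. -/
  coroot : G → Module.Dual ℝ E
  root_ne_zero : ∀ s : G, IsReflection (s : E ≃ₗᵢ[ℝ] E) → root s ≠ 0
  apply_root : ∀ s : G, IsReflection (s : E ≃ₗᵢ[ℝ] E) →
    (s : E ≃ₗᵢ[ℝ] E) (root s) = -root s
  coroot_ne_zero : ∀ s : G, IsReflection (s : E ≃ₗᵢ[ℝ] E) → coroot s ≠ 0
  coroot_apply : ∀ s : G, IsReflection (s : E ≃ₗᵢ[ℝ] E) →
    ∀ v : E, coroot s ((s⁻¹ : E ≃ₗᵢ[ℝ] E) v) = -coroot s v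

/-- `c` is invariant under conjugation on the set of reflections of `G`. -/
def IsConjInvariant (G : Subgroup (E ≃ₗᵢ[ℝ] E)) (c : G → ℝ) : Prop :=
  ∀ s : G, IsReflection (s : E ≃ₗᵢ[ℝ] E) → ∀ g : G, c (g * s * g⁻¹) = c s

/-! ### The rational Cherednik algebra `H_c(G, E)` -/

/-- Generators of the rational Cherednik algebra: vectors, covectors and group elements. -/
inductive Gen (G : Subgroup (E ≃ₗᵢ[ℝ] E)) : Type _
  | vec (ξ : E) : Gen G
  | covec (x : Module.Dual ℝ E) : Gen G
  | grp (g : G) : Gen G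

section Cherednik

variable (G : Subgroup (E ≃ₗᵢ[ℝ] E)) [Fintype G] (R : RootChoice G) (c : G → ℝ)

/-- Free generator attached to a vector. -/
abbrev fvec (ξ : E) : FreeAlgebra ℂ (Gen G) := FreeAlgebra.ι ℂ (Gen.vec ξ)
/-- Free generator attached to a covector. -/
abbrev fcovec (x : Module.Dual ℝ E) : FreeAlgebra ℂ (Gen G) := FreeAlgebra.ι ℂ (Gen.covec x)
/-- Free generator attached to a group element. -/
abbrev fgrp (g : G) : FreeAlgebra ℂ (Gen G) := FreeAlgebra.ι ℂ (Gen.grp g)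

/-- The defining relations of the rational Cherednik algebra. The first six lines of constructors
present the smash product of the complex tensor algebra of (the complexification of) `E ⊕ E*` with
the group algebra of `G`; the last three are the relations
`[ξ, η] = 0`, `[x, y] = 0` and
`[ξ, x] = ⟨x, ξ⟩ - 2 ∑ₛ (⟨x, αₛ⟩ ⟨aₛ, ξ⟩ / ⟨aₛ, αₛ⟩) c(s) s`. -/
inductive Rel : FreeAlgebra ℂ (Gen G) → FreeAlgebra ℂ (Gen G) → Prop
  | vec_add (ξ η : E) : Rel (fvec G (ξ + η)) (fvec G ξ + fvec G η)
  | vec_smul (r : ℝ) (ξ : E) : Rel (fvec G (r • ξ)) ((r : ℂ) • fvec G ξ)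
  | covec_add (x y : Module.Dual ℝ E) : Rel (fcovec G (x + y)) (fcovec G x + fcovec G y)
  | covec_smul (r : ℝ) (x : Module.Dual ℝ E) : Rel (fcovec G (r • x)) ((r : ℂ) • fcovec G x)
  | grp_one : Rel (fgrp G 1) 1
  | grp_mul (g h : G) : Rel (fgrp G (g * h)) (fgrp G g * fgrp G h)
  | grp_vec (g : G) (ξ : E) :
      Rel (fgrp G g * fvec G ξ) (fvec G ((g : E ≃ₗᵢ[ℝ] E) ξ) * fgrp G g)
  | grp_covec (g : G) (x : Module.Dual ℝ E) :
      Rel (fgrp G g * fcovec G x)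
        (fcovec G (x ∘ₗ ((g⁻¹ : E ≃ₗᵢ[ℝ] E).toLinearEquiv : E →ₗ[ℝ] E)) * fgrp G g)
  | vec_comm (ξ η : E) : Rel (fvec G ξ * fvec G η) (fvec G η * fvec G ξ)
  | covec_comm (x y : Module.Dual ℝ E) : Rel (fcovec G x * fcovec G y) (fcovec G y * fcovec G x)
  | vec_covec (ξ : E) (x : Module.Dual ℝ E) :
      Rel (fvec G ξ * fcovec G x - fcovec G x * fvec G ξ)
        (algebraMap ℂ _ ((x ξ : ℝ) : ℂ) -
          (2 : ℂ) • ∑ s ∈ reflections G,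
            (((x (R.root s) * R.coroot s ξ / R.coroot s (R.root s)) * c s : ℝ) : ℂ) • fgrp G s)

/-- The rational Cherednik algebra `H_c(G, E)` (with `t = 1`). -/
def RCA : Type _ := RingQuot (Rel G R c)

instance : Ring (RCA G R c) := inferInstanceAs (Ring (RingQuot (Rel G R c)))

instance : Algebra ℂ (RCA G R c) := inferInstanceAs (Algebra ℂ (RingQuot (Rel G R c)))

/-- The quotient map from the free algebra to `H_c(G, E)`. -/
def mk : FreeAlgebra ℂ (Gen G) →ₐ[ℂ] RCA G R c := RingQuot.mkAlgHom ℂ (Rel G R c)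

/-- The element of `H_c(G, E)` given by `ξ ∈ E`. -/
def vec (ξ : E) : RCA G R c := mk G R c (fvec G ξ)

/-- The element of `H_c(G, E)` given by `x ∈ E*`. -/
def covec (x : Module.Dual ℝ E) : RCA G R c := mk G R c (fcovec G x)

/-- The element of `H_c(G, E)` given by `g ∈ G`. -/
def grp (g : G) : RCA G R c := mk G R c (fgrp G g)

/-! ### Standard modules -/

section Standard

variable {V : Type*} [AddCommGroup V] [Module ℂ V] (τ : Representation ℂ G V)

/-- The relations `g ⊗ v = 1 ⊗ τ(g) v` and `ξ ⊗ v = 0` (for `ξ ∈ E`), as an `H_c`-submodule of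
`H_c ⊗ V`. -/
def standardRelations : Submodule (RCA G R c) (RCA G R c ⊗[ℂ] V) :=
  Submodule.span (RCA G R c)
    ({m | ∃ (g : G) (v : V), m = grp G R c g ⊗ₜ[ℂ] v - (1 : RCA G R c) ⊗ₜ[ℂ] (τ g v)} ∪
      {m | ∃ (ξ : E) (v : V), m = vec G R c ξ ⊗ₜ[ℂ] v})

/-- The standard module `M_c(τ)`: the `H_c`-module induced from `V`, on which `G` acts by `τ` and
`E` acts by zero. -/
abbrev StandardModule : Type _ := (RCA G R c ⊗[ℂ] V) ⧸ standardRelations G R c τ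

/-- The map `v ↦ 1 ⊗ v` from `V` to `M_c(τ)`. -/
def lowest (v : V) : StandardModule G R c τ :=
  Submodule.Quotient.mk ((1 : RCA G R c) ⊗ₜ[ℂ] v)

/-- The degree-`k` part `M_c(τ)_k`: the span of all `x₁ ⋯ x_k ⊗ v` with `xᵢ ∈ E*` and `v ∈ V`. It is
zero for `k < 0`. -/
def degreePart (k : ℤ) : Submodule ℂ (StandardModule G R c τ) :=
  Submodule.span ℂ {m | ∃ (xs : List (Module.Dual ℝ E)) (v : V),
    (xs.length : ℤ) = k ∧ m = (xs.map (covec G R c)).prod • lowest G R c τ v}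

/-- The scalar `N_c(τ)` by which the central element `∑ₛ c(s) s` of the group algebra acts on the
irreducible representation `τ`, written as its trace divided by the dimension. -/
def centralScalar : ℂ :=
  LinearMap.trace ℂ V (∑ s ∈ reflections G, (c s : ℂ) • τ s) / (Module.finrank ℂ V : ℂ)

/-- `β` is a contravariant Hermitian form on `M_c(τ)` which restricts to a (`G`-invariant) inner
product on the degree-zero part `V`. It is conjugate-linear in the first variable. Contravariance
`β(h p, q) = β(p, h* q)` refers to the conjugate-linear anti-involution `*` of `H_c` with `g* = g⁻¹`
for `g ∈ G`, which exchanges `ξ ∈ E` and the covector `⟪ξ, ·⟫`; it suffices to require it for these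
generators. -/
structure IsContravariantForm
    (β : StandardModule G R c τ →ₗ⋆[ℂ] StandardModule G R c τ →ₗ[ℂ] ℂ) : Prop where
  hermitian : ∀ p q, β q p = conj (β p q)
  vec_adjoint : ∀ (ξ : E) p q, β (vec G R c ξ • p) q = β p (covec G R c (innerₗ E ξ) • q)
  covec_adjoint : ∀ (ξ : E) p q, β (covec G R c (innerₗ E ξ) • p) q = β p (vec G R c ξ • q)
  grp_adjoint : ∀ (g : G) p q, β (grp G R c g • p) q = β p (grp G R c g⁻¹ • q)
  lowest_pos : ∀ v : V, v ≠ 0 → 0 < (β (lowest G R c τ v) (lowest G R c τ v)).re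

end Standard

end Cherednik

/-! ### The Clifford algebra and the spinor space -/

section Clifford

variable (n : ℕ)

/-- The quadratic form `v ↦ ∑ vⱼ²` in `2n` complex variables. -/
abbrev cliffordForm : QuadraticForm ℂ (Fin n ⊕ Fin n → ℂ) :=
  QuadraticMap.weightedSumSquares ℂ fun _ : Fin n ⊕ Fin n => (1 : ℂ)

/-- The complex Clifford algebra `𝒞` on generators `e₁, …, e₂ₙ` with `{eⱼ, eₖ} = 2 δⱼₖ`; the index
`Sum.inl j` stands for `j` and `Sum.inr j` for `n + j`. -/
abbrev Cliff : Type := CliffordAlgebra (cliffordForm n)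

/-- The generator `eⱼ`. -/
def e (j : Fin n ⊕ Fin n) : Cliff n := CliffordAlgebra.ι (cliffordForm n) (Pi.single j 1)

/-- `fⱼ = (eⱼ - i eₙ₊ⱼ) / 2`. -/
def f (j : Fin n) : Cliff n := (1 / 2 : ℂ) • (e n (Sum.inl j) - Complex.I • e n (Sum.inr j))

/-- `fⱼ† = (eⱼ + i eₙ₊ⱼ) / 2`. -/
def fd (j : Fin n) : Cliff n := (1 / 2 : ℂ) • (e n (Sum.inl j) + Complex.I • e n (Sum.inr j))

/-- The spinor space `𝕊`: the Grassmann algebra on `n` generators `f₁†, …, fₙ†` (the standard basis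
vectors of `ℂⁿ`). -/
abbrev Spinor : Type := ExteriorAlgebra ℂ (Fin n → ℂ)

/-- The action on spinors of the vector `∑ vⱼ eⱼ = ∑ⱼ (vⱼ - i vₙ₊ⱼ) fⱼ† + (vⱼ + i vₙ₊ⱼ) fⱼ`:
each `fⱼ†` acts by exterior multiplication and each `fⱼ` by contraction. -/
def spinVec : (Fin n ⊕ Fin n → ℂ) →ₗ[ℂ] Module.End ℂ (Spinor n) where
  toFun v :=
    LinearMap.mulLeft ℂ
      (ExteriorAlgebra.ι ℂ fun j : Fin n => v (Sum.inl j) - Complex.I * v (Sum.inr j)) +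
    CliffordAlgebra.contractLeft
      (∑ j : Fin n, (v (Sum.inl j) + Complex.I * v (Sum.inr j)) •
        (LinearMap.proj j : (Fin n → ℂ) →ₗ[ℂ] ℂ))
  map_add' v w := by
    have h1 : (fun j : Fin n => (v + w) (Sum.inl j) - Complex.I * (v + w) (Sum.inr j)) =
        (fun j => v (Sum.inl j) - Complex.I * v (Sum.inr j)) +
          fun j => w (Sum.inl j) - Complex.I * w (Sum.inr j) := by
      ext j; simp only [Pi.add_apply]; ring
    have h2 : ∑ j : Fin n, ((v + w) (Sum.inl j) + Complex.I * (v + w) (Sum.inr j)) •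
          (LinearMap.proj j : (Fin n → ℂ) →ₗ[ℂ] ℂ) =
        (∑ j : Fin n, (v (Sum.inl j) + Complex.I * v (Sum.inr j)) •
          (LinearMap.proj j : (Fin n → ℂ) →ₗ[ℂ] ℂ)) +
        ∑ j : Fin n, (w (Sum.inl j) + Complex.I * w (Sum.inr j)) •
          (LinearMap.proj j : (Fin n → ℂ) →ₗ[ℂ] ℂ) := by
      rw [← Finset.sum_add_distrib]
      refine Finset.sum_congr rfl fun j _ => ?_
      rw [← add_smul]; congr 1; simp only [Pi.add_apply]; ring
    rw [h1, h2, map_add, map_add]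
    refine LinearMap.ext fun x => ?_
    simp only [LinearMap.add_apply, LinearMap.mulLeft_apply, add_mul]
    abel
  map_smul' r v := by
    have h1 : (fun j : Fin n => (r • v) (Sum.inl j) - Complex.I * (r • v) (Sum.inr j)) =
        r • fun j => v (Sum.inl j) - Complex.I * v (Sum.inr j) := by
      ext j; simp only [Pi.smul_apply, smul_eq_mul]; ring
    have h2 : ∑ j : Fin n, ((r • v) (Sum.inl j) + Complex.I * (r • v) (Sum.inr j)) •
          (LinearMap.proj j : (Fin n → ℂ) →ₗ[ℂ] ℂ) =
        r • ∑ j : Fin n, (v (Sum.inl j) + Complex.I * v (Sum.inr j)) •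
          (LinearMap.proj j : (Fin n → ℂ) →ₗ[ℂ] ℂ) := by
      rw [Finset.smul_sum]
      refine Finset.sum_congr rfl fun j _ => ?_
      rw [smul_smul]; congr 1; simp only [Pi.smul_apply, smul_eq_mul]; ring
    rw [h1, h2, map_smul, map_smul]
    refine LinearMap.ext fun x => ?_
    simp only [LinearMap.add_apply, LinearMap.mulLeft_apply, LinearMap.smul_apply,
      smul_mul_assoc, smul_add, RingHom.id_apply]

theorem spinVec_mul_self (v : Fin n ⊕ Fin n → ℂ) :
    spinVec n v * spinVec n v = algebraMap ℂ _ (cliffordForm n v) := by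
  refine LinearMap.ext fun x => ?_
  have hI : Complex.I * Complex.I = -1 := Complex.I_mul_I
  have hsum : (∑ j : Fin n, (v (Sum.inl j) + Complex.I * v (Sum.inr j)) •
        (LinearMap.proj j : (Fin n → ℂ) →ₗ[ℂ] ℂ))
        (fun j : Fin n => v (Sum.inl j) - Complex.I * v (Sum.inr j)) = cliffordForm n v := by
    simp only [cliffordForm, QuadraticMap.weightedSumSquares_apply, LinearMap.sum_apply,
      LinearMap.smul_apply, LinearMap.proj_apply, smul_eq_mul, Fintype.sum_sum_type, one_mul,
      ← Finset.sum_add_distrib]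
    refine Finset.sum_congr rfl fun j _ => ?_
    linear_combination (-(v (Sum.inr j) * v (Sum.inr j))) * hI
  have hι := ExteriorAlgebra.ι_sq_zero (R := ℂ)
    (fun j : Fin n => v (Sum.inl j) - Complex.I * v (Sum.inr j))
  simp only [spinVec, LinearMap.coe_mk, AddHom.coe_mk, Module.End.mul_apply, LinearMap.add_apply,
    LinearMap.mulLeft_apply, mul_add, ← mul_assoc, hι, zero_mul, zero_add,
    Module.algebraMap_end_apply, CliffordAlgebra.contractLeft_contractLeft, add_zero]
  rw [← hsum]
  have hc := CliffordAlgebra.contractLeft_ι_mul (Q := (0 : QuadraticForm ℂ (Fin n → ℂ)))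
    (∑ j : Fin n, (v (Sum.inl j) + Complex.I * v (Sum.inr j)) •
      (LinearMap.proj j : (Fin n → ℂ) →ₗ[ℂ] ℂ))
    (fun j : Fin n => v (Sum.inl j) - Complex.I * v (Sum.inr j)) x
  refine (congrArg (fun y => y + _) hc).trans ?_
  exact sub_add_cancel _ _

/-- The action of the Clifford algebra on the spinor space. -/
def spinAction : Cliff n →ₐ[ℂ] Module.End ℂ (Spinor n) :=
  CliffordAlgebra.lift (cliffordForm n) ⟨spinVec n, spinVec_mul_self n⟩

/-- The spinors `𝕊^l` of degree `l`: the `l`-th exterior power (zero for `l < 0`). -/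
def spinorDegree : ℤ → Submodule ℂ (Spinor n)
  | Int.ofNat l => ⋀[ℂ]^l (Fin n → ℂ)
  | Int.negSucc _ => ⊥

/-- The Hermitian form on spinors for which the monomials `f_{j₁}† ∧ ⋯ ∧ f_{jₚ}†`
(`j₁ < ⋯ < jₚ`) are orthonormal, i.e. the Gram determinant form on each exterior power. It is
conjugate-linear in the first variable. -/
def spinorForm : Spinor n →ₗ⋆[ℂ] Spinor n →ₗ[ℂ] ℂ :=
  LinearMap.mk₂'ₛₗ (starRingEnd ℂ) (RingHom.id ℂ)
    (fun u w => ∑ A : Finset (Fin n),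
      conj ((Pi.basisFun ℂ (Fin n)).ExteriorAlgebra.repr u A) *
        (Pi.basisFun ℂ (Fin n)).ExteriorAlgebra.repr w A)
    (fun _ _ _ => by simp [add_mul, Finset.sum_add_distrib])
    (fun _ _ _ => by simp [mul_assoc, Finset.mul_sum])
    (fun _ _ _ => by simp [mul_add, Finset.sum_add_distrib])
    (fun _ _ _ => by simp [mul_left_comm, Finset.mul_sum])

end Clifford

/-! ### The realisation of `𝔲(2|1)` in `H_c(G, E) ⊗ 𝒞`

The compatible complex structure `J` on `E` enters through an adapted orthonormal basis
`b = (ξ₁, …, ξₙ, η₁, …, ηₙ)`, with `J ξⱼ = -ηⱼ` and `J ηⱼ = ξⱼ`. -/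

section Realisation

variable (G : Subgroup (E ≃ₗᵢ[ℝ] E)) [Fintype G] (R : RootChoice G) (c : G → ℝ)
  {n : ℕ} (b : OrthonormalBasis (Fin n ⊕ Fin n) ℝ E)

/-- `zⱼ = xⱼ + i yⱼ`, where `(x, y)` is the basis dual to `(ξ, η)`. -/
def z (j : Fin n) : RCA G R c :=
  covec G R c (b.toBasis.coord (Sum.inl j)) +
    Complex.I • covec G R c (b.toBasis.coord (Sum.inr j))

/-- `z̄ⱼ = xⱼ - i yⱼ`. -/
def zbar (j : Fin n) : RCA G R c :=
  covec G R c (b.toBasis.coord (Sum.inl j)) -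
    Complex.I • covec G R c (b.toBasis.coord (Sum.inr j))

/-- `ζⱼ = (ξⱼ - i ηⱼ) / 2`. -/
def zeta (j : Fin n) : RCA G R c :=
  (1 / 2 : ℂ) • (vec G R c (b (Sum.inl j)) - Complex.I • vec G R c (b (Sum.inr j)))

/-- `ζ̄ⱼ = (ξⱼ + i ηⱼ) / 2`. -/
def zetabar (j : Fin n) : RCA G R c :=
  (1 / 2 : ℂ) • (vec G R c (b (Sum.inl j)) + Complex.I • vec G R c (b (Sum.inr j)))

/-- `E₋ = -2 ∑ⱼ ζⱼ ζ̄ⱼ`. -/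
def Eminus : RCA G R c := (-2 : ℂ) • ∑ j : Fin n, zeta G R c b j * zetabar G R c b j

/-- `H = ∑ⱼ (zⱼ ζⱼ + z̄ⱼ ζ̄ⱼ) + n - ∑ₛ c(s) s`. -/
def Hop : RCA G R c :=
  ∑ j : Fin n, (z G R c b j * zeta G R c b j + zbar G R c b j * zetabar G R c b j) +
    algebraMap ℂ (RCA G R c) (n : ℂ) - ∑ s ∈ reflections G, (c s : ℂ) • grp G R c s

/-- `Z₀ = ∑ⱼ (z̄ⱼ ζ̄ⱼ - zⱼ ζⱼ)`. -/
def Zzero : RCA G R c :=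
  ∑ j : Fin n, (zbar G R c b j * zetabar G R c b j - z G R c b j * zeta G R c b j)

/-- The projection `π⁻(v) = ∑ⱼ ⟨z̄ⱼ, v⟩ fⱼ†` of a vector `v ∈ E`, in the Clifford algebra. -/
def piMinus (v : E) : Cliff n :=
  ∑ j : Fin n, ((b.toBasis.coord (Sum.inl j) v : ℂ) -
    Complex.I * (b.toBasis.coord (Sum.inr j) v : ℂ)) • fd n j

/-- The projection `π⁺(v) = ∑ⱼ ⟨zⱼ, v⟩ fⱼ` of a vector `v ∈ E`, in the Clifford algebra. -/
def piPlus (v : E) : Cliff n :=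
  ∑ j : Fin n, ((b.toBasis.coord (Sum.inl j) v : ℂ) +
    Complex.I * (b.toBasis.coord (Sum.inr j) v : ℂ)) • f n j

/-- The vector `x^⊤` of `E` that corresponds to the covector `x` under the Euclidean structure. -/
def sharp (x : Module.Dual ℝ E) : E := ∑ j : Fin n ⊕ Fin n, x (b j) • b j

/-- `τₛ = 1 - (2 / ⟨aₛ, αₛ⟩) π⁻(αₛ) π⁺(aₛ^⊤)`. -/
def tauElt (s : G) : Cliff n :=
  1 - ((2 / R.coroot s (R.root s) : ℝ) : ℂ) •
    (piMinus b (R.root s) * piPlus b (sharp b (R.coroot s)))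

/-- `Ω_c = ∑ₛ c(s) s ⊗ τₛ`. -/
def Omega : RCA G R c ⊗[ℂ] Cliff n :=
  ∑ s ∈ reflections G, (c s : ℂ) • (grp G R c s ⊗ₜ[ℂ] tauElt G R b s)

/-- `F₊ = ∑ⱼ z̄ⱼ ⊗ fⱼ†`. -/
def Fplus : RCA G R c ⊗[ℂ] Cliff n := ∑ j : Fin n, zbar G R c b j ⊗ₜ[ℂ] fd n j

/-- `F̄₊ = ∑ⱼ zⱼ ⊗ fⱼ`. -/
def Fbarplus : RCA G R c ⊗[ℂ] Cliff n := ∑ j : Fin n, z G R c b j ⊗ₜ[ℂ] f n j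

/-- `F₋ = 2 ∑ⱼ ζⱼ ⊗ fⱼ†`. -/
def Fminus : RCA G R c ⊗[ℂ] Cliff n := (2 : ℂ) • ∑ j : Fin n, zeta G R c b j ⊗ₜ[ℂ] fd n j

/-- `F̄₋ = 2 ∑ⱼ ζ̄ⱼ ⊗ fⱼ`. -/
def Fbarminus : RCA G R c ⊗[ℂ] Cliff n := (2 : ℂ) • ∑ j : Fin n, zetabar G R c b j ⊗ₜ[ℂ] f n j

/-- `H ⊗ 1`. -/
def HH : RCA G R c ⊗[ℂ] Cliff n := Hop G R c b ⊗ₜ[ℂ] (1 : Cliff n)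

/-- `Z₁ = Z₀ ⊗ 1 - Ω_c`. -/
def Z₁ : RCA G R c ⊗[ℂ] Cliff n := Zzero G R c b ⊗ₜ[ℂ] (1 : Cliff n) - Omega G R c b

/-- `Z₂ = 1 ⊗ ∑ⱼ (fⱼ† fⱼ - fⱼ fⱼ†) / 2`. -/
def Z₂ (n : ℕ) : RCA G R c ⊗[ℂ] Cliff n :=
  (1 : RCA G R c) ⊗ₜ[ℂ] ((1 / 2 : ℂ) • ∑ j : Fin n, (fd n j * f n j - f n j * fd n j))

/-- `Z = 2 Z₂ - Z₁`. -/
def ZZ : RCA G R c ⊗[ℂ] Cliff n := (2 : ℂ) • Z₂ G R c n - Z₁ G R c b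

/-! ### Polynomial spinors -/

variable {V : Type*} [AddCommGroup V] [Module ℂ V] (τ : Representation ℂ G V)

/-- The space `K_c(τ) = M_c(τ) ⊗ 𝕊`. -/
abbrev PolySpinor (n : ℕ) : Type _ := StandardModule G R c τ ⊗[ℂ] Spinor n

/-- The action of `H_c(G, E) ⊗ 𝒞` on `K_c(τ)`, factor by factor. -/
def act (n : ℕ) : (RCA G R c ⊗[ℂ] Cliff n) →ₐ[ℂ] Module.End ℂ (PolySpinor G R c τ n) :=
  (Module.endTensorEndAlgHom (R := ℂ) (S := ℂ) (A := ℂ)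
      (M := StandardModule G R c τ) (N := Spinor n)).comp
    (Algebra.TensorProduct.map (Algebra.lsmul ℂ ℂ (StandardModule G R c τ)) (spinAction n))

/-- The product form `(p ⊗ u | q ⊗ w) = β(p, q) (u, w)` on `K_c(τ)`. -/
def spinorProductForm (n : ℕ)
    (β : StandardModule G R c τ →ₗ⋆[ℂ] StandardModule G R c τ →ₗ[ℂ] ℂ) :
    PolySpinor G R c τ n →ₗ⋆[ℂ] PolySpinor G R c τ n →ₗ[ℂ] ℂ :=
  (TensorProduct.map₂ β (spinorForm n)).compr₂ₛₗ (LinearMap.mul' ℂ ℂ)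

/-- The harmonics `ℋ_c(τ)_k`: the kernel of `E₋` in the degree-`k` part of `M_c(τ)`. -/
def harmonics (k : ℤ) : Submodule ℂ (StandardModule G R c τ) :=
  degreePart G R c τ k ⊓ LinearMap.ker (Algebra.lsmul ℂ ℂ (StandardModule G R c τ) (Eminus G R c b))

/-- `ℋ_k^l = ℋ_k ⊗ 𝕊^l`, as a subspace of `K_c(τ)`. -/
def harmonicSpinors (k l : ℤ) : Submodule ℂ (PolySpinor G R c τ n) :=
  LinearMap.range (TensorProduct.mapIncl (harmonics G R c b τ k) (spinorDegree n l))

/-- `ℋ_{k,ν}^l`: the `ν`-eigenspace of `Z₁` in `ℋ_k^l`. -/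
def harmonicEigenspace (k l : ℤ) (ν : ℂ) : Submodule ℂ (PolySpinor G R c τ n) :=
  harmonicSpinors G R c b τ k l ⊓ Module.End.eigenspace (act G R c τ n (Z₁ G R c b)) ν

/-- `ℳ_{k,ν}^l`: the intersection of `ℋ_{k,ν}^l` with the kernels of `F₋` and `F̄₋`. -/
def monogenics (k l : ℤ) (ν : ℂ) : Submodule ℂ (PolySpinor G R c τ n) :=
  harmonicEigenspace G R c b τ k l ν ⊓ LinearMap.ker (act G R c τ n (Fminus G R c b)) ⊓
    LinearMap.ker (act G R c τ n (Fbarminus G R c b))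

/-- `λ₁ = k - 2 + 2n - N_c(τ) + ν - 2l`. -/
def lam₁ (n : ℕ) (k l : ℤ) (ν : ℂ) : ℂ :=
  (k : ℂ) - 2 + 2 * (n : ℂ) - centralScalar G c τ + ν - 2 * (l : ℂ)

/-- `λ₂ = k - 2 - N_c(τ) - ν + 2l`. -/
def lam₂ (k l : ℤ) (ν : ℂ) : ℂ :=
  (k : ℂ) - 2 - centralScalar G c τ - ν + 2 * (l : ℂ)

/-- The four summands in the decomposition of `ℋ_{k,ν}^l`. -/
def summand (k l : ℤ) (ν : ℂ) : Fin 4 → Submodule ℂ (PolySpinor G R c τ n) :=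
  ![monogenics G R c b τ k l ν,
    (monogenics G R c b τ (k - 1) (l - 1) (ν - 1)).map (act G R c τ n (Fplus G R c b)),
    (monogenics G R c b τ (k - 1) (l + 1) (ν + 1)).map (act G R c τ n (Fbarplus G R c b)),
    (monogenics G R c b τ (k - 2) l ν).map (act G R c τ n
      (lam₁ G c τ n k l ν • (Fplus G R c b * Fbarplus G R c b) -
        lam₂ G c τ k l ν • (Fbarplus G R c b * Fplus G R c b)))]

end Realisation

end CherednikSpinor

end

/-! Put `P = F₊`, `Q = F̄₊`, `M = F₋`, `N = F̄₋`. Contravariance of the form makes `N` adjoint to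
`P` and `M` adjoint to `Q`. In `H_c ⊗ 𝒞` one has `M² = N² = 0`, `{M, P} = {N, Q} = 0`, `{N, P} = H -
Z`, `{M, Q} = H + Z` and `{M, N} = -2 E₋`; the last one says that harmonic means killed by `MN +
NM`. On vectors of degrees `k`, `l` and `Z₁`-eigenvalue `ν`, both `H - Z` and `H + Z` are scalars.
The decomposition is then linear algebra, isolated in `IsOddQuadruple`.

Let `u` be harmonic and `w = MNu = -NMu ≠ 0`. Then `w` is monogenic, `NPw = xw` and `MQw = yw`.
Adjointness gives `‖Pw‖² = x‖w‖²` and `‖Qw‖² = y‖w‖²`, so positivity forces `x, y ≥ 0`. If `x = 0`,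
then `Pw = 0`, and `w`, lying in the range of `N = P*`, is orthogonal to itself; likewise for `y`.
Hence `xy(x + y + 2) ≠ 0`. Since `MN` multiplies `(xPQ - yQP)w` back to `xy(x + y + 2)w`, a multiple
of this vector can be subtracted from `u` to make `MNu` vanish (`exists_double`). Now `Nu` and `Mu`
are monogenic, and the same alternative (invertible scalar, or zero vector) removes them with
vectors from the images of `P` and `Q` (`exists_P`, `exists_Q`). What is left is monogenic.
Orthogonality is adjointness, and independence follows from it by definiteness.

The algebra rests on `oddUp_mul_oddDown_add`, which turns the anticommutators into brackets in
`H_c`, and on `comm_Hop_covec` and `comm_Hop_vec`, which make `H` the grading element. The brackets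
with `Z` are formal consequences (`comm_anticomm_self`), so `Ω_c` is never commuted with anything
directly. The analytic input is `spinorForm_wedge` and the contravariance of `β`. Schur's lemma
(`reflection_sum_apply`) gives the scalar `N_c(τ)`, and flatness (`range_mapIncl_inf_ker`)
identifies `ℋ_k ⊗ 𝕊^l` with a kernel. -/

noncomputable section

namespace CherednikSpinor

/-! ### Linear algebra of two adjoint pairs of odd operators. -/

section Core

/-- Two pairs of adjoint odd operators on a space with a positive definite Hermitian form, shifting
a triply indexed family of subspaces `T k l ν`, on which the mixed anticommutators act by scalars
that are affine in the indices. -/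
structure IsOddQuadruple {K : Type*} [AddCommGroup K] [Module ℂ K] (B : K →ₗ⋆[ℂ] K →ₗ[ℂ] ℂ)
    (P Q M N : Module.End ℂ K) (T : ℤ → ℤ → ℂ → Submodule ℂ K) (s t : ℂ) : Prop where
  hermitian : ∀ u w, B w u = conj (B u w)
  pos : ∀ u, u ≠ 0 → 0 < (B u u).re
  adjoint_P : ∀ u w, B (P u) w = B u (N w)
  adjoint_Q : ∀ u w, B (Q u) w = B u (M w)
  M_P : ∀ u, M (P u) = -P (M u)
  N_Q : ∀ u, N (Q u) = -Q (N u)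
  M_M : ∀ u, M (M u) = 0
  N_N : ∀ u, N (N u) = 0
  P_mem : ∀ {k l ν u}, u ∈ T k l ν → P u ∈ T (k + 1) (l + 1) (ν + 1)
  Q_mem : ∀ {k l ν u}, u ∈ T k l ν → Q u ∈ T (k + 1) (l - 1) (ν - 1)
  M_mem : ∀ {k l ν u}, u ∈ T k l ν → M u ∈ T (k - 1) (l + 1) (ν + 1)
  N_mem : ∀ {k l ν u}, u ∈ T k l ν → N u ∈ T (k - 1) (l - 1) (ν - 1)
  N_P : ∀ {k l ν u}, u ∈ T k l ν → N (P u) = ((k : ℂ) + ν - 2 * l + s) • u - P (N u)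
  M_Q : ∀ {k l ν u}, u ∈ T k l ν → M (Q u) = ((k : ℂ) - ν + 2 * l + t) • u - Q (M u)

namespace IsOddQuadruple

variable {K : Type*} [AddCommGroup K] [Module ℂ K] {B : K →ₗ⋆[ℂ] K →ₗ[ℂ] ℂ}
    {P Q M N : Module.End ℂ K} {T : ℤ → ℤ → ℂ → Submodule ℂ K} {s t : ℂ}

/-- The part of `T k l ν` killed by the anticommutator of `M` and `N`. -/
def harmonic (M N : Module.End ℂ K) (T : ℤ → ℤ → ℂ → Submodule ℂ K) (k l : ℤ) (ν : ℂ) :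
    Submodule ℂ K := T k l ν ⊓ LinearMap.ker (M * N + N * M)

/-- The part of `T k l ν` killed by `M` and `N`. -/
def monogenic (M N : Module.End ℂ K) (T : ℤ → ℤ → ℂ → Submodule ℂ K) (k l : ℤ) (ν : ℂ) :
    Submodule ℂ K := harmonic M N T k l ν ⊓ LinearMap.ker M ⊓ LinearMap.ker N

/-- The four pieces generated by monogenic vectors. -/
def pieces (P Q M N : Module.End ℂ K) (T : ℤ → ℤ → ℂ → Submodule ℂ K) (s t : ℂ) (k l : ℤ)
    (ν : ℂ) : Fin 4 → Submodule ℂ K :=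
  ![monogenic M N T k l ν,
    (monogenic M N T (k - 1) (l - 1) (ν - 1)).map P,
    (monogenic M N T (k - 1) (l + 1) (ν + 1)).map Q,
    (monogenic M N T (k - 2) l ν).map
      (((k : ℂ) - 2 + ν - 2 * l + s) • (P * Q) - ((k : ℂ) - 2 - ν + 2 * l + t) • (Q * P))]

theorem mem_harmonic {k l : ℤ} {ν : ℂ} {u : K} :
    u ∈ harmonic M N T k l ν ↔ u ∈ T k l ν ∧ M (N u) + N (M u) = 0 := by
  simp [harmonic]

/-- The harmonic condition is automatic once `M` and `N` kill the vector. -/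
theorem mem_monogenic {k l : ℤ} {ν : ℂ} {u : K} :
    u ∈ monogenic M N T k l ν ↔ u ∈ T k l ν ∧ M u = 0 ∧ N u = 0 := by
  constructor
  · rintro ⟨⟨h1, h2⟩, h3⟩
    exact ⟨(mem_harmonic.1 h1).1, h2, h3⟩
  · rintro ⟨h1, h2, h3⟩
    exact ⟨⟨mem_harmonic.2 ⟨h1, by simp [h2, h3]⟩, h2⟩, h3⟩

variable (h : IsOddQuadruple B P Q M N T s t)

include h

theorem eq_zero {u : K} (hu : B u u = 0) : u = 0 := by
  by_contra h0
  have := h.pos u h0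
  simp [hu] at this

theorem adjoint_N (u w : K) : B (N u) w = B u (P w) := by
  rw [h.hermitian, ← h.adjoint_P, ← h.hermitian]

theorem adjoint_M (u w : K) : B (M u) w = B u (Q w) := by
  rw [h.hermitian, ← h.adjoint_Q, ← h.hermitian]

theorem self_re_nonneg (u : K) : 0 ≤ (B u u).re := by
  by_cases h0 : u = 0
  · simp [h0]
  · exact (h.pos u h0).le

theorem self_im (u : K) : (B u u).im = 0 := by
  have := congrArg Complex.im (h.hermitian u u)
  simp only [Complex.conj_im] at this
  linarith

/-- An eigenvalue of a positive operator is a non-negative real number. -/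
theorem eigenvalue_nonneg {u w : K} {r : ℂ} (hu : u ≠ 0) (hw : B w w = r * B u u) :
    r = (r.re : ℂ) ∧ 0 ≤ r.re := by
  have h1 := h.pos u hu
  have h2 := h.self_im u
  have h3 := h.self_re_nonneg w
  have h4 := h.self_im w
  have e : B u u = ((B u u).re : ℂ) := Complex.ext (by simp) (by simp [h2])
  rw [hw, e] at h3 h4
  simp only [Complex.re_mul_ofReal, Complex.im_mul_ofReal] at h3 h4
  refine ⟨Complex.ext (by simp) ?_, ?_⟩
  · simpa [h1.ne'] using h4
  · exact nonneg_of_mul_nonneg_left h3 h1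

section Mono

variable {k l : ℤ} {ν : ℂ} {m : K} (hm : m ∈ monogenic M N T k l ν)

include hm

/-- The anticommutator of `N` and `P` is a scalar, and its term `P N` dies on monogenic vectors. By
adjointness this scalar is the ratio `‖Pm‖² / ‖m‖²` when `m ≠ 0`. -/
theorem N_P_mono : N (P m) = ((k : ℂ) + ν - 2 * l + s) • m := by
  obtain ⟨h1, -, h3⟩ := mem_monogenic.1 hm
  rw [h.N_P h1, h3, map_zero, sub_zero]

theorem M_Q_mono : M (Q m) = ((k : ℂ) - ν + 2 * l + t) • m := by
  obtain ⟨h1, h2, -⟩ := mem_monogenic.1 hm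
  rw [h.M_Q h1, h2, map_zero, sub_zero]

theorem M_P_mono : M (P m) = 0 := by
  rw [h.M_P, (mem_monogenic.1 hm).2.1, map_zero, neg_zero]

theorem N_Q_mono : N (Q m) = 0 := by
  rw [h.N_Q, (mem_monogenic.1 hm).2.2, map_zero, neg_zero]

/-- `Q` changes `(k, l, ν)` by `(1, -1, -1)`, hence `k + ν - 2l` by `1 - 1 + 2 = 2`. The same shift
occurs for `k - ν + 2l` under `P` in `M_QP_mono`. -/
theorem N_PQ_mono : N (P (Q m)) = ((k : ℂ) + ν - 2 * l + s + 2) • Q m := by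
  rw [h.N_P (h.Q_mem (mem_monogenic.1 hm).1), h.N_Q_mono hm, map_zero, sub_zero]
  congr 1; push_cast; ring

theorem M_QP_mono : M (Q (P m)) = ((k : ℂ) - ν + 2 * l + t + 2) • P m := by
  rw [h.M_Q (h.P_mem (mem_monogenic.1 hm).1), h.M_P_mono hm, map_zero, sub_zero]
  congr 1; push_cast; ring

theorem N_QP_mono : N (Q (P m)) = -(((k : ℂ) + ν - 2 * l + s) • Q m) := by
  rw [h.N_Q, h.N_P_mono hm, map_smul]

theorem M_PQ_mono : M (P (Q m)) = -(((k : ℂ) - ν + 2 * l + t) • P m) := by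
  rw [h.M_P, h.M_Q_mono hm, map_smul]

end Mono

section Double

variable {k l : ℤ} {ν : ℂ} {m : K} {x y : ℂ} (hm : m ∈ monogenic M N T (k - 2) l ν)
  (hx : x = (k : ℂ) - 2 + ν - 2 * l + s) (hy : y = (k : ℂ) - 2 - ν + 2 * l + t)

include hm hx hy

/-- The two terms contribute `x(x + 2)` and, since `N` anticommutes with `Q`, `yx`. -/
theorem N_double : N ((x • (P * Q) - y • (Q * P)) m) = (x * (x + y + 2)) • Q m := by
  simp only [LinearMap.sub_apply, LinearMap.smul_apply, Module.End.mul_apply, map_sub, map_smul,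
    h.N_PQ_mono hm, h.N_QP_mono hm, smul_neg, sub_neg_eq_add, smul_smul, ← add_smul]
  congr 1; subst hx hy; push_cast; ring

theorem M_double : M ((x • (P * Q) - y • (Q * P)) m) = -((y * (x + y + 2)) • P m) := by
  simp only [LinearMap.sub_apply, LinearMap.smul_apply, Module.End.mul_apply, map_sub, map_smul,
    h.M_PQ_mono hm, h.M_QP_mono hm, smul_smul, ← neg_smul, ← sub_smul]
  congr 1; subst hx hy; push_cast; ring

theorem M_N_double :
    M (N ((x • (P * Q) - y • (Q * P)) m)) = (x * y * (x + y + 2)) • m := by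
  rw [h.N_double hm hx hy, map_smul, h.M_Q_mono hm, smul_smul]
  congr 1; subst hx hy; push_cast; ring

theorem N_M_double :
    N (M ((x • (P * Q) - y • (Q * P)) m)) = -((x * y * (x + y + 2)) • m) := by
  rw [h.M_double hm hx hy, map_neg, map_smul, h.N_P_mono hm, smul_smul]
  congr 2; subst hx hy; push_cast; ring

/-- This explains the coefficients: `MN + NM` sends `(aPQ + bQP)m` to `2(ay + bx)m`, which vanishes
for `a = x`, `b = -y`. -/
theorem double_mem : (x • (P * Q) - y • (Q * P)) m ∈ harmonic M N T k l ν := by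
  refine mem_harmonic.2 ⟨?_, ?_⟩
  · have h1 := h.P_mem (h.Q_mem (mem_monogenic.1 hm).1)
    have h2 := h.Q_mem (h.P_mem (mem_monogenic.1 hm).1)
    have e1 : k - 2 + 1 + 1 = k := by ring
    have e2 : l - 1 + 1 = l := by ring
    have e3 : l + 1 - 1 = l := by ring
    have e4 : ν - 1 + 1 = ν := by ring
    have e5 : ν + 1 - 1 = ν := by ring
    rw [e1, e2, e4] at h1
    rw [e1, e3, e5] at h2
    exact Submodule.sub_mem _ (Submodule.smul_mem _ _ h1) (Submodule.smul_mem _ _ h2)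
  · rw [h.M_N_double hm hx hy, h.N_M_double hm hx hy, add_neg_cancel]

end Double

theorem P_mono_mem {k l : ℤ} {ν : ℂ} {m : K} (hm : m ∈ monogenic M N T (k - 1) (l - 1) (ν - 1)) :
    P m ∈ harmonic M N T k l ν := by
  refine mem_harmonic.2 ⟨?_, ?_⟩
  · simpa using h.P_mem (mem_monogenic.1 hm).1
  · rw [h.N_P_mono hm, h.M_P_mono hm, map_smul, (mem_monogenic.1 hm).2.1]; simp

theorem Q_mono_mem {k l : ℤ} {ν : ℂ} {m : K} (hm : m ∈ monogenic M N T (k - 1) (l + 1) (ν + 1)) :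
    Q m ∈ harmonic M N T k l ν := by
  refine mem_harmonic.2 ⟨?_, ?_⟩
  · simpa using h.Q_mem (mem_monogenic.1 hm).1
  · rw [h.N_Q_mono hm, h.M_Q_mono hm, map_smul, (mem_monogenic.1 hm).2.2]; simp

theorem pieces_le (k l : ℤ) (ν : ℂ) (i : Fin 4) :
    pieces P Q M N T s t k l ν i ≤ harmonic M N T k l ν := by
  fin_cases i
  · exact inf_le_left.trans inf_le_left
  · rintro _ ⟨m, hm, rfl⟩; exact h.P_mono_mem hm
  · rintro _ ⟨m, hm, rfl⟩; exact h.Q_mono_mem hm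
  · rintro _ ⟨m, hm, rfl⟩; exact h.double_mem hm rfl rfl

/-- For harmonic `u`, `MNu = 0` forces `NMu = 0`; the other half of monogenicity is `M² = 0`. -/
theorem M_harmonic {k l : ℤ} {ν : ℂ} {u : K} (hu : u ∈ harmonic M N T k l ν)
    (h0 : M (N u) = 0) : M u ∈ monogenic M N T (k - 1) (l + 1) (ν + 1) := by
  obtain ⟨h1, h2⟩ := mem_harmonic.1 hu
  refine mem_monogenic.2 ⟨h.M_mem h1, h.M_M u, ?_⟩
  rwa [h0, zero_add] at h2

theorem N_harmonic {k l : ℤ} {ν : ℂ} {u : K} (hu : u ∈ harmonic M N T k l ν)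
    (h0 : M (N u) = 0) : N u ∈ monogenic M N T (k - 1) (l - 1) (ν - 1) :=
  mem_monogenic.2 ⟨h.N_mem (mem_harmonic.1 hu).1, h0, h.N_N u⟩

/-- `MNu = -NMu` is in the range of both `M` and `N`, each of square zero. -/
theorem M_N_harmonic {k l : ℤ} {ν : ℂ} {u : K} (hu : u ∈ harmonic M N T k l ν) :
    M (N u) ∈ monogenic M N T (k - 2) l ν := by
  obtain ⟨h1, h2⟩ := mem_harmonic.1 hu
  refine mem_monogenic.2 ⟨?_, h.M_M _, ?_⟩
  · have := h.M_mem (h.N_mem h1)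
    have e : k - 1 - 1 = k - 2 := by ring
    simpa [e] using this
  · rw [eq_neg_of_add_eq_zero_left h2, map_neg, h.N_N, neg_zero]

/-- Removing the piece of second order. -/
theorem exists_double {k l : ℤ} {ν : ℂ} {u : K} (hu : u ∈ harmonic M N T k l ν) :
    ∃ d ∈ pieces P Q M N T s t k l ν 3, M (N (u - d)) = 0 := by
  by_cases hw : M (N u) = 0
  · exact ⟨0, Submodule.zero_mem _, by simpa using hw⟩
  set w := M (N u) with hwdef
  have hwm := h.M_N_harmonic hu
  rw [← hwdef] at hwm
  obtain ⟨x, hx⟩ : ∃ x, x = (k : ℂ) - 2 + ν - 2 * l + s := ⟨_, rfl⟩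
  obtain ⟨y, hy⟩ : ∃ y, y = (k : ℂ) - 2 - ν + 2 * l + t := ⟨_, rfl⟩
  have hNP : N (P w) = x • w := by rw [h.N_P_mono hwm, hx]; push_cast; rfl
  have hMQ : M (Q w) = y • w := by rw [h.M_Q_mono hwm, hy]; push_cast; rfl
  -- Squared norms of `Pw` and `Qw`: they force `x` and `y` to be non-negative reals.
  have hPP : B (P w) (P w) = x * B w w := by rw [h.adjoint_P, hNP, map_smul, smul_eq_mul]
  have hQQ : B (Q w) (Q w) = y * B w w := by rw [h.adjoint_Q, hMQ, map_smul, smul_eq_mul]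
  obtain ⟨xr, x0⟩ := h.eigenvalue_nonneg hw hPP
  obtain ⟨yr, y0⟩ := h.eigenvalue_nonneg hw hQQ
  -- If `x = 0` then `Pw = 0`; but `w = -N(Mu)` is in the range of the adjoint of `P`, so `B w w =
  -- 0`. For `y`, the form `w = M(Nu)` is used with `Q` instead.
  have hxne : x ≠ 0 := by
    intro hx0
    apply hw
    have hP : P w = 0 := h.eq_zero (by rw [hPP, hx0, zero_mul])
    apply h.eq_zero
    have e : w = -N (M u) := eq_neg_of_add_eq_zero_left (mem_harmonic.1 hu).2
    calc B w w = B w (-N (M u)) := by rw [← e]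
      _ = 0 := by rw [map_neg, ← h.adjoint_P, hP]; simp
  have hyne : y ≠ 0 := by
    intro hy0
    apply hw
    have hQ : Q w = 0 := h.eq_zero (by rw [hQQ, hy0, zero_mul])
    apply h.eq_zero
    calc B w w = B w (M (N u)) := rfl
      _ = 0 := by rw [← h.adjoint_Q, hQ]; simp
  have hsum : x + y + 2 ≠ 0 := by
    intro h0
    have := congrArg Complex.re h0
    simp only [Complex.add_re, Complex.re_ofNat, Complex.zero_re] at this
    linarith
  refine ⟨(x • (P * Q) - y • (Q * P)) ((x * y * (x + y + 2))⁻¹ • w), ?_, ?_⟩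
  · subst hx hy
    exact Submodule.mem_map_of_mem (Submodule.smul_mem _ _ hwm)
  · rw [map_smul, map_sub, map_sub, map_smul, map_smul, h.M_N_double hwm hx hy, smul_smul,
      inv_mul_cancel₀ (mul_ne_zero (mul_ne_zero hxne hyne) hsum), one_smul, sub_self]

/-- Removing the piece in the image of `P`. -/
theorem exists_P {k l : ℤ} {ν : ℂ} {u : K} (hu : u ∈ harmonic M N T k l ν) (h0 : M (N u) = 0) :
    ∃ d ∈ pieces P Q M N T s t k l ν 1, N (u - d) = 0 ∧ M d = 0 := by
  have hp := h.N_harmonic hu h0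
  set p := N u with hpdef
  have hNP := h.N_P_mono hp
  set r : ℂ := ((k - 1 : ℤ) : ℂ) + (ν - 1) - 2 * ((l - 1 : ℤ) : ℂ) + s
  -- A vanishing scalar means `Pp = 0`, and then `p = Nu` is orthogonal to itself, so nothing has to
  -- be removed.
  by_cases hr : r = 0
  · have hP : P p = 0 := h.eq_zero (by rw [h.adjoint_P, hNP, hr]; simp)
    have : p = 0 := h.eq_zero (by
      calc B p p = B p (N u) := rfl
        _ = 0 := by rw [← h.adjoint_P, hP]; simp)
    exact ⟨0, Submodule.zero_mem _, by rw [sub_zero, ← hpdef, this], map_zero _⟩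
  · refine ⟨P (r⁻¹ • p), Submodule.mem_map_of_mem (Submodule.smul_mem _ _ hp), ?_, ?_⟩
    · rw [map_sub, map_smul, map_smul, hNP, smul_smul, inv_mul_cancel₀ hr, one_smul, sub_self]
    · rw [map_smul, map_smul, h.M_P_mono hp, smul_zero]

/-- Removing the piece in the image of `Q`. -/
theorem exists_Q {k l : ℤ} {ν : ℂ} {u : K} (hu : u ∈ harmonic M N T k l ν) (h0 : M (N u) = 0) :
    ∃ d ∈ pieces P Q M N T s t k l ν 2, M (u - d) = 0 ∧ N d = 0 := by
  have hp := h.M_harmonic hu h0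
  set p := M u with hpdef
  have hMQ := h.M_Q_mono hp
  set r : ℂ := ((k - 1 : ℤ) : ℂ) - (ν + 1) + 2 * ((l + 1 : ℤ) : ℂ) + t
  by_cases hr : r = 0
  · have hQ : Q p = 0 := h.eq_zero (by rw [h.adjoint_Q, hMQ, hr]; simp)
    have : p = 0 := h.eq_zero (by
      calc B p p = B p (M u) := rfl
        _ = 0 := by rw [← h.adjoint_Q, hQ]; simp)
    exact ⟨0, Submodule.zero_mem _, by rw [sub_zero, ← hpdef, this], map_zero _⟩
  · refine ⟨Q (r⁻¹ • p), Submodule.mem_map_of_mem (Submodule.smul_mem _ _ hp), ?_, ?_⟩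
    · rw [map_sub, map_smul, map_smul, hMQ, smul_smul, inv_mul_cancel₀ hr, one_smul, sub_self]
    · rw [map_smul, map_smul, h.N_Q_mono hp, smul_zero]

theorem harmonic_eq_iSup (k l : ℤ) (ν : ℂ) :
    harmonic M N T k l ν = ⨆ i, pieces P Q M N T s t k l ν i := by
  refine le_antisymm (fun u hu => ?_) (iSup_le (h.pieces_le k l ν))
  obtain ⟨d₃, hd₃, e₃⟩ := h.exists_double hu
  have hu' := Submodule.sub_mem _ hu (h.pieces_le k l ν 3 hd₃)
  obtain ⟨d₁, hd₁, e₁, e₁'⟩ := h.exists_P hu' e₃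
  -- `d₁` and `d₂` may both be built from `u - d₃`: `d₁` is invisible to `M` and `d₂` is invisible
  -- to `N`, so the two corrections do not interfere.
  obtain ⟨d₂, hd₂, e₂, e₂'⟩ := h.exists_Q hu' e₃
  have hmono : u - d₃ - d₁ - d₂ ∈ pieces P Q M N T s t k l ν 0 := by
    refine mem_monogenic.2 ⟨?_, ?_, ?_⟩
    · exact (mem_harmonic.1 (Submodule.sub_mem _ (Submodule.sub_mem _ hu'
        (h.pieces_le k l ν 1 hd₁)) (h.pieces_le k l ν 2 hd₂))).1
    · rw [sub_right_comm, map_sub, e₂, e₁', sub_zero]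
    · rw [map_sub, e₁, e₂', sub_zero]
  have hle := le_iSup (pieces P Q M N T s t k l ν)
  have : u = (u - d₃ - d₁ - d₂) + d₃ + d₁ + d₂ := by abel
  rw [this]
  exact Submodule.add_mem _ (Submodule.add_mem _ (Submodule.add_mem _ (hle 0 hmono) (hle 3 hd₃))
    (hle 1 hd₁)) (hle 2 hd₂)

/-- Monogenic vectors are orthogonal to the ranges of `P` and `Q`, because `N` and `M` kill them.
The remaining pairs reduce to this or to `NQm' = 0` by moving the outer operator of the left vector
across. -/
theorem orthogonal_of_lt (k l : ℤ) (ν : ℂ) {i j : Fin 4} (hij : i < j) {u w : K}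
    (hu : u ∈ pieces P Q M N T s t k l ν i) (hw : w ∈ pieces P Q M N T s t k l ν j) :
    B u w = 0 := by
  have h01 : ∀ {k' l' : ℤ} {ν' : ℂ} {m : K}, m ∈ monogenic M N T k' l' ν' → ∀ v, B m (P v) = 0 :=
    fun hm v => by rw [← h.adjoint_N, (mem_monogenic.1 hm).2.2]; simp
  have h02 : ∀ {k' l' : ℤ} {ν' : ℂ} {m : K}, m ∈ monogenic M N T k' l' ν' → ∀ v, B m (Q v) = 0 :=
    fun hm v => by rw [← h.adjoint_M, (mem_monogenic.1 hm).2.1]; simp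
  fin_cases i <;> fin_cases j <;> first | exact absurd hij (by decide) | skip
  · obtain ⟨m, hm, rfl⟩ := hw
    exact h01 hu m
  · obtain ⟨m, hm, rfl⟩ := hw
    exact h02 hu m
  · obtain ⟨m, hm, rfl⟩ := hw
    simp only [LinearMap.sub_apply, LinearMap.smul_apply, Module.End.mul_apply, map_sub, map_smul,
      h01 hu, h02 hu, smul_zero, sub_zero]
  · obtain ⟨m, hm, rfl⟩ := hu
    obtain ⟨m', hm', rfl⟩ := hw
    rw [h.adjoint_P, h.N_Q_mono hm', map_zero]
  · obtain ⟨m, hm, rfl⟩ := hu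
    obtain ⟨m', hm', rfl⟩ := hw
    rw [h.adjoint_P, h.N_double hm' rfl rfl, map_smul, h02 hm, smul_zero]
  · obtain ⟨m, hm, rfl⟩ := hu
    obtain ⟨m', hm', rfl⟩ := hw
    rw [h.adjoint_Q, h.M_double hm' rfl rfl, map_neg, map_smul, h01 hm, smul_zero, neg_zero]

theorem orthogonal (k l : ℤ) (ν : ℂ) {i j : Fin 4} (hij : i ≠ j) {u w : K}
    (hu : u ∈ pieces P Q M N T s t k l ν i) (hw : w ∈ pieces P Q M N T s t k l ν j) :
    B u w = 0 := by
  rcases lt_or_gt_of_ne hij with hlt | hlt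
  · exact h.orthogonal_of_lt k l ν hlt hu hw
  · rw [h.hermitian, h.orthogonal_of_lt k l ν hlt hw hu, map_zero]

theorem iSupIndep_pieces (k l : ℤ) (ν : ℂ) : iSupIndep (pieces P Q M N T s t k l ν) := by
  intro i
  rw [Submodule.disjoint_def]
  intro u hu hu'
  have hle : (⨆ j, ⨆ (_ : j ≠ i), pieces P Q M N T s t k l ν j) ≤ LinearMap.ker (B u) :=
    iSup₂_le fun j hj w hw => h.orthogonal k l ν hj.symm hu hw
  exact h.eq_zero (hle hu')

end IsOddQuadruple

end Core

/-! ### Clifford relations and the action on spinors. -/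

section CliffordRelations

variable {n : ℕ}

theorem cliff_ι_mul_ι_add (v w : Fin n ⊕ Fin n → ℂ) :
    CliffordAlgebra.ι (cliffordForm n) v * CliffordAlgebra.ι (cliffordForm n) w +
      CliffordAlgebra.ι (cliffordForm n) w * CliffordAlgebra.ι (cliffordForm n) v =
      algebraMap ℂ _ (2 * ∑ i, v i * w i) := by
  rw [CliffordAlgebra.ι_mul_ι_add_swap]
  congr 1
  simp only [QuadraticMap.polar, cliffordForm, QuadraticMap.weightedSumSquares_apply, smul_eq_mul,
    one_mul, Pi.add_apply, ← Finset.sum_sub_distrib, Finset.mul_sum]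
  exact Finset.sum_congr rfl fun x _ => by ring

/-- The vector of `ℂ²ⁿ` with image `fⱼ` in the Clifford algebra. -/
def fVector (j : Fin n) : Fin n ⊕ Fin n → ℂ :=
  Sum.elim (Pi.single j (1 / 2)) (Pi.single j (-Complex.I / 2))

/-- The vector of `ℂ²ⁿ` with image `fⱼ†` in the Clifford algebra. -/
def fdVector (j : Fin n) : Fin n ⊕ Fin n → ℂ :=
  Sum.elim (Pi.single j (1 / 2)) (Pi.single j (Complex.I / 2))

theorem f_eq_ι (j : Fin n) : f n j = CliffordAlgebra.ι (cliffordForm n) (fVector j) := by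
  rw [f, e, e, ← map_smul, ← map_sub, ← map_smul]
  congr 1
  ext (i | i) <;> simp [fVector, Pi.single_apply] <;> (split_ifs <;> ring)

theorem fd_eq_ι (j : Fin n) : fd n j = CliffordAlgebra.ι (cliffordForm n) (fdVector j) := by
  rw [fd, e, e, ← map_smul, ← map_add, ← map_smul]
  congr 1
  ext (i | i) <;> simp [fdVector, Pi.single_apply] <;> (split_ifs <;> ring)

/-- The vectors behind the `fⱼ` span an isotropic subspace: for `j = k` the pairing is `1/4 +
(-i/2)² = 0`. -/
theorem f_mul_f_add (j k : Fin n) : f n j * f n k + f n k * f n j = 0 := by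
  have hI := Complex.I_mul_I
  rw [f_eq_ι, f_eq_ι, cliff_ι_mul_ι_add]
  simp only [fVector, Fintype.sum_sum_type, Sum.elim_inl, Sum.elim_inr, Pi.single_apply, ite_mul,
    zero_mul, Finset.sum_ite_eq', Finset.mem_univ, if_true]
  split_ifs with h
  · refine (congrArg _ ?_).trans (map_zero (algebraMap ℂ _)); linear_combination (1 / 2 : ℂ) * hI
  · simp

theorem fd_mul_fd_add (j k : Fin n) : fd n j * fd n k + fd n k * fd n j = 0 := by
  have hI := Complex.I_mul_I
  rw [fd_eq_ι, fd_eq_ι, cliff_ι_mul_ι_add]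
  simp only [fdVector, Fintype.sum_sum_type, Sum.elim_inl, Sum.elim_inr, Pi.single_apply, ite_mul,
    zero_mul, Finset.sum_ite_eq', Finset.mem_univ, if_true]
  split_ifs with h
  · refine (congrArg _ ?_).trans (map_zero (algebraMap ℂ _)); linear_combination (1 / 2 : ℂ) * hI
  · simp

theorem f_mul_fd_add (j k : Fin n) :
    f n j * fd n k + fd n k * f n j = if j = k then 1 else 0 := by
  have hI := Complex.I_mul_I
  rw [f_eq_ι, fd_eq_ι, cliff_ι_mul_ι_add]
  simp only [fVector, fdVector, Fintype.sum_sum_type, Sum.elim_inl, Sum.elim_inr, Pi.single_apply,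
    ite_mul, zero_mul, Finset.sum_ite_eq', Finset.mem_univ, if_true]
  split_ifs with h
  · refine (congrArg _ ?_).trans (map_one (algebraMap ℂ _)); linear_combination (-1 / 2 : ℂ) * hI
  · simp

/-- Exterior multiplication by the `j`-th basis vector. -/
abbrev wedge (j : Fin n) : Module.End ℂ (Spinor n) :=
  LinearMap.mulLeft ℂ (ExteriorAlgebra.ι ℂ (Pi.single j 1 : Fin n → ℂ))

/-- Contraction with the `j`-th coordinate. -/
abbrev contr (j : Fin n) : Module.End ℂ (Spinor n) :=
  CliffordAlgebra.contractLeft (LinearMap.proj j : (Fin n → ℂ) →ₗ[ℂ] ℂ)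

/-- For the vector of `fⱼ†`, the `j`-th wedge coefficient is `1/2 - i · i/2 = 1` and the contraction
coefficient is `1/2 + i · i/2 = 0`. For `fⱼ` the two roles are exchanged. -/
theorem spinAction_fd (j : Fin n) : spinAction n (fd n j) = wedge j := by
  have hI := Complex.I_mul_I
  rw [spinAction, fd_eq_ι, CliffordAlgebra.lift_ι_apply, spinVec]
  have h1 : (fun i : Fin n => (fdVector j : Fin n ⊕ Fin n → ℂ) (Sum.inl i) -
      Complex.I * (fdVector j : Fin n ⊕ Fin n → ℂ) (Sum.inr i)) = Pi.single j 1 := by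
    ext i; simp only [fdVector, Sum.elim_inl, Sum.elim_inr, Pi.single_apply]
    split_ifs
    · linear_combination (-1 / 2 : ℂ) * hI
    · simp
  have h2 : ∀ i : Fin n, (fdVector j : Fin n ⊕ Fin n → ℂ) (Sum.inl i) +
      Complex.I * (fdVector j : Fin n ⊕ Fin n → ℂ) (Sum.inr i) = 0 := by
    intro i; simp only [fdVector, Sum.elim_inl, Sum.elim_inr, Pi.single_apply]
    split_ifs
    · linear_combination (1 / 2 : ℂ) * hI
    · simp
  simp only [LinearMap.coe_mk, AddHom.coe_mk, h1, h2, zero_smul, Finset.sum_const_zero, map_zero,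
    add_zero]

theorem spinAction_f (j : Fin n) : spinAction n (f n j) = contr j := by
  have hI := Complex.I_mul_I
  rw [spinAction, f_eq_ι, CliffordAlgebra.lift_ι_apply, spinVec]
  have h1 : (fun i : Fin n => (fVector j : Fin n ⊕ Fin n → ℂ) (Sum.inl i) -
      Complex.I * (fVector j : Fin n ⊕ Fin n → ℂ) (Sum.inr i)) = 0 := by
    ext i; simp only [fVector, Sum.elim_inl, Sum.elim_inr, Pi.single_apply, Pi.zero_apply]
    split_ifs
    · linear_combination (1 / 2 : ℂ) * hI
    · simp
  have h2 : ∀ i : Fin n, (fVector j : Fin n ⊕ Fin n → ℂ) (Sum.inl i) +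
      Complex.I * (fVector j : Fin n ⊕ Fin n → ℂ) (Sum.inr i) = if i = j then 1 else 0 := by
    intro i; simp only [fVector, Sum.elim_inl, Sum.elim_inr, Pi.single_apply]
    split_ifs
    · linear_combination (-1 / 2 : ℂ) * hI
    · simp
  simp only [LinearMap.coe_mk, AddHom.coe_mk, h1, h2, ite_smul, one_smul, zero_smul,
    Finset.sum_ite_eq', Finset.mem_univ, if_true, map_zero, LinearMap.mulLeft_zero_eq_zero,
    zero_add]

theorem wedge_mul_self (j : Fin n) : wedge j * wedge j = 0 := by
  ext x; simp [← mul_assoc]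

theorem contr_mul_self (j : Fin n) : contr j * contr j = 0 :=
  LinearMap.ext fun x => CliffordAlgebra.contractLeft_contractLeft _ x

theorem wedge_mul_wedge (j k : Fin n) : wedge j * wedge k = -(wedge k * wedge j) := by
  rw [← spinAction_fd, ← spinAction_fd, ← map_mul, ← map_mul, ← map_neg,
    eq_neg_of_add_eq_zero_left (fd_mul_fd_add j k)]

theorem contr_mul_contr (j k : Fin n) : contr j * contr k = -(contr k * contr j) := by
  rw [← spinAction_f, ← spinAction_f, ← map_mul, ← map_mul, ← map_neg,
    eq_neg_of_add_eq_zero_left (f_mul_f_add j k)]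

theorem contr_wedge_self (j : Fin n) (x : Spinor n) :
    contr j (wedge j x) = x - wedge j (contr j x) := by
  have := congrArg (spinAction n) (f_mul_fd_add j j)
  simp only [map_add, map_mul, spinAction_f, spinAction_fd, if_true, map_one] at this
  rw [eq_sub_iff_add_eq]
  exact LinearMap.congr_fun this x

theorem contr_wedge_of_ne {j k : Fin n} (h : j ≠ k) (x : Spinor n) :
    contr j (wedge k x) = -wedge k (contr j x) := by
  have := congrArg (spinAction n) (f_mul_fd_add j k)
  simp only [map_add, map_mul, spinAction_f, spinAction_fd, if_neg h, map_zero] at this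
  exact eq_neg_of_add_eq_zero_left (LinearMap.congr_fun this x)

end CliffordRelations

/-! ### The grading of the spinor space and the number operator. -/

section SpinorGrading

variable {n : ℕ}

theorem wedge_mem (j : Fin n) {l : ℤ} {x : Spinor n} (hx : x ∈ spinorDegree n l) :
    wedge j x ∈ spinorDegree n (l + 1) := by
  cases l with
  | ofNat l =>
    change _ ∈ ⋀[ℂ]^(l + 1) (Fin n → ℂ)
    change _ ∈ ⋀[ℂ]^l (Fin n → ℂ) at hx
    rw [ExteriorAlgebra.exteriorPower, pow_succ']
    exact Submodule.mul_mem_mul (LinearMap.mem_range_self _ _) hx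
  | negSucc l =>
    rw [(Submodule.mem_bot ℂ).1 hx, map_zero]
    exact Submodule.zero_mem _

theorem contractLeft_mem (d : Module.Dual ℂ (Fin n → ℂ)) (l : ℕ) :
    ∀ x ∈ ⋀[ℂ]^(l + 1) (Fin n → ℂ),
      (CliffordAlgebra.contractLeft d x : Spinor n) ∈ ⋀[ℂ]^l (Fin n → ℂ) := by
  induction l with
  | zero =>
    intro x hx
    rw [zero_add, ExteriorAlgebra.exteriorPower, pow_one] at hx
    obtain ⟨v, rfl⟩ := hx
    rw [ExteriorAlgebra.exteriorPower, pow_zero, Submodule.mem_one]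
    exact ⟨d v, (CliffordAlgebra.contractLeft_ι _ d v).symm⟩
  | succ l ih =>
    intro x hx
    rw [ExteriorAlgebra.exteriorPower, pow_succ'] at hx
    induction hx using Submodule.mul_induction_on' with
    | mem_mul_mem a ha y hy =>
      obtain ⟨v, rfl⟩ := ha
      have := CliffordAlgebra.contractLeft_ι_mul (Q := (0 : QuadraticForm ℂ (Fin n → ℂ))) d v y
      refine Set.mem_of_eq_of_mem this ?_
      refine Submodule.sub_mem _ (Submodule.smul_mem _ _ hy) ?_
      rw [ExteriorAlgebra.exteriorPower, pow_succ']
      exact Submodule.mul_mem_mul (LinearMap.mem_range_self _ _) (ih y hy)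
    | add x _ y _ h1 h2 => rw [map_add]; exact Submodule.add_mem _ h1 h2

theorem contr_mem (j : Fin n) {l : ℤ} {x : Spinor n} (hx : x ∈ spinorDegree n l) :
    contr j x ∈ spinorDegree n (l - 1) := by
  cases l with
  | ofNat l =>
    cases l with
    | zero =>
      change _ ∈ ⋀[ℂ]^0 (Fin n → ℂ) at hx
      rw [ExteriorAlgebra.exteriorPower, pow_zero, Submodule.mem_one] at hx
      obtain ⟨r, rfl⟩ := hx
      refine Set.mem_of_eq_of_mem (CliffordAlgebra.contractLeft_algebraMap _ _ r) ?_
      exact Submodule.zero_mem _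
    | succ l =>
      have e : (Int.ofNat (l + 1)) - 1 = Int.ofNat l := by simp
      rw [e]
      exact contractLeft_mem _ l x hx
  | negSucc l =>
    rw [(Submodule.mem_bot ℂ).1 hx, map_zero]
    exact Submodule.zero_mem _

/-- Induction on the degree. Contraction of `v ∧ y` leaves `vⱼ y`, and `∑ⱼ vⱼ fⱼ† y` restores `v ∧
y` once; the other term carries the operator past `v`, with two signs that cancel. -/
theorem number_apply (l : ℕ) : ∀ x ∈ ⋀[ℂ]^l (Fin n → ℂ),
    ∑ j : Fin n, wedge j (contr j x) = (l : ℂ) • x := by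
  induction l with
  | zero =>
    intro x hx
    rw [ExteriorAlgebra.exteriorPower, pow_zero, Submodule.mem_one] at hx
    obtain ⟨r, rfl⟩ := hx
    have : ∀ j : Fin n, contr j (algebraMap ℂ (Spinor n) r) = 0 := fun j =>
      CliffordAlgebra.contractLeft_algebraMap _ _ r
    simp [this]
  | succ l ih =>
    intro x hx
    rw [ExteriorAlgebra.exteriorPower, pow_succ'] at hx
    induction hx using Submodule.mul_induction_on' with
    | mem_mul_mem a ha y hy =>
      obtain ⟨v, rfl⟩ := ha
      have h1 : ∀ j, contr j (ExteriorAlgebra.ι ℂ v * y) =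
          v j • y - ExteriorAlgebra.ι ℂ v * contr j y := fun j =>
        CliffordAlgebra.contractLeft_ι_mul (Q := (0 : QuadraticForm ℂ (Fin n → ℂ))) _ v y
      have h2 : ∀ j (z : Spinor n), wedge j (ExteriorAlgebra.ι ℂ v * z) =
          -(ExteriorAlgebra.ι ℂ v * wedge j z) := by
        intro j z
        have := ExteriorAlgebra.ι_add_mul_swap (R := ℂ) (Pi.single j 1 : Fin n → ℂ) v
        simp only [LinearMap.mulLeft_apply, ← mul_assoc]
        rw [eq_neg_of_add_eq_zero_left this, neg_mul]
      have h3 : ∑ j : Fin n, v j • wedge j y = ExteriorAlgebra.ι ℂ v * y := by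
        simp only [LinearMap.mulLeft_apply, ← smul_mul_assoc, ← map_smul, ← Finset.sum_mul,
          ← map_sum]
        congr 2
        ext i; simp [Finset.sum_apply, Pi.single_apply]
      simp only [h1, map_sub, h2, map_smul, sub_neg_eq_add, Finset.sum_add_distrib, h3,
        ← Finset.mul_sum]
      rw [ih y hy, mul_smul_comm, add_comm, Nat.cast_succ, add_smul, one_smul]
    | add x _ y _ hx hy => simp only [map_add, Finset.sum_add_distrib, hx, hy, smul_add]

theorem number_apply_int {l : ℤ} {x : Spinor n} (hx : x ∈ spinorDegree n l) :
    ∑ j : Fin n, wedge j (contr j x) = (l : ℂ) • x := by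
  cases l with
  | ofNat l => simpa using number_apply l x hx
  | negSucc l => simp [(Submodule.mem_bot ℂ).1 hx]

theorem spinorDegree_of_neg {l : ℤ} (hl : l < 0) : spinorDegree n l = ⊥ := by
  cases l with
  | ofNat l => simp at hl; omega
  | negSucc l => rfl

/-- The dimension is the binomial coefficient `n` over `n + 1`. -/
theorem spinorDegree_succ_top : spinorDegree n ((n : ℤ) + 1) = ⊥ := by
  change ⋀[ℂ]^(n + 1) (Fin n → ℂ) = ⊥
  apply Submodule.finrank_eq_zero.1
  rw [exteriorPower.finrank_eq]
  simp

end SpinorGrading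

/-! ### Wedge and contraction are adjoint for the Gram form. -/

section SpinorAdjoint

variable {n : ℕ}

/-- The exterior monomial `f_{j₁}† ∧ ⋯ ∧ f_{jₚ}†`. -/
def monomial : List (Fin n) → Spinor n
  | [] => 1
  | j :: L => wedge j (monomial L)

/-- Contraction with `j₁`, then `j₂`, and so on. -/
def contrList : List (Fin n) → Module.End ℂ (Spinor n)
  | [] => 1
  | j :: L => contrList L * contr j

/-- The scalar component of a spinor. -/
abbrev vacuum : Spinor n →ₗ[ℂ] ℂ := (ExteriorAlgebra.algebraMapInv (R := ℂ)).toLinearMap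

theorem vacuum_wedge (j : Fin n) (x : Spinor n) : vacuum (wedge j x) = 0 := by
  simp [ExteriorAlgebra.algebraMapInv]

theorem vacuum_one : vacuum (1 : Spinor n) = 1 := by simp

/-- Both kinds of operators anticommute, so one sign serves monomials and contractions alike. It is
kept real so that conjugation in the first slot of the form leaves it alone. -/
theorem exists_sign_of_perm {L L' : List (Fin n)} (h : L.Perm L') :
    ∃ ε : ℝ, (monomial L : Spinor n) = (ε : ℂ) • monomial L' ∧
      (contrList L : Module.End ℂ (Spinor n)) = (ε : ℂ) • contrList L' := by
  induction h with
  | nil => exact ⟨1, by simp, by simp⟩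
  | cons j _ ih =>
    obtain ⟨ε, h1, h2⟩ := ih
    exact ⟨ε, by rw [monomial, monomial, h1, map_smul],
      by rw [contrList, contrList, h2, smul_mul_assoc]⟩
  | swap j k L =>
    refine ⟨-1, ?_, ?_⟩
    · simp only [monomial, Complex.ofReal_neg, Complex.ofReal_one, neg_smul, one_smul]
      exact LinearMap.congr_fun (wedge_mul_wedge k j) (monomial L)
    · refine LinearMap.ext fun x => ?_
      have h : contr j (contr k x) = -contr k (contr j x) :=
        LinearMap.congr_fun (contr_mul_contr j k) x
      simp only [contrList, Module.End.mul_apply, LinearMap.smul_apply, h, map_neg,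
        Complex.ofReal_neg, Complex.ofReal_one, neg_smul, one_smul]
  | trans _ _ ih1 ih2 =>
    obtain ⟨ε, h1, h2⟩ := ih1
    obtain ⟨ε', h1', h2'⟩ := ih2
    exact ⟨ε * ε', by rw [h1, h1', smul_smul]; push_cast; rfl,
      by rw [h2, h2', smul_smul]; push_cast; rfl⟩

theorem contr_monomial_of_notMem (j : Fin n) (L : List (Fin n)) (h : j ∉ L) :
    contr j (monomial L) = 0 := by
  induction L with
  | nil => exact CliffordAlgebra.contractLeft_one _ _
  | cons k L ih =>
    simp only [List.mem_cons, not_or] at h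
    rw [monomial, contr_wedge_of_ne h.1, ih h.2, map_zero, neg_zero]

theorem contrList_monomial_self (L : List (Fin n)) (h : L.Nodup) :
    contrList L (monomial L) = 1 := by
  induction L with
  | nil => rfl
  | cons k L ih =>
    rw [List.nodup_cons] at h
    rw [contrList, monomial, Module.End.mul_apply, contr_wedge_self,
      contr_monomial_of_notMem k L h.1, map_zero, sub_zero, ih h.2]

theorem contrList_monomial_of_mem_of_notMem (L L' : List (Fin n)) (j : Fin n) (hj : j ∈ L)
    (hj' : j ∉ L') : contrList L (monomial L') = 0 := by
  obtain ⟨ε, -, h⟩ := exists_sign_of_perm (List.perm_cons_erase hj)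
  rw [h, contrList, LinearMap.smul_apply, Module.End.mul_apply,
    contr_monomial_of_notMem j L' hj', map_zero, smul_zero]

theorem vacuum_contrList_wedge_of_notMem (L : List (Fin n)) (j : Fin n) (hj : j ∉ L)
    (x : Spinor n) : vacuum (contrList L (wedge j x)) = 0 := by
  induction L generalizing x with
  | nil => exact vacuum_wedge j x
  | cons k L ih =>
    simp only [List.mem_cons, not_or] at hj
    rw [contrList, Module.End.mul_apply, contr_wedge_of_ne (Ne.symm hj.1), map_neg, map_neg,
      ih hj.2, neg_zero]

theorem vacuum_contrList_monomial_of_notMem_of_mem (L L' : List (Fin n)) (j : Fin n) (hj : j ∉ L)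
    (hj' : j ∈ L') : vacuum (contrList L (monomial L')) = 0 := by
  obtain ⟨ε, h, -⟩ := exists_sign_of_perm (List.perm_cons_erase hj')
  rw [h, monomial, map_smul, map_smul, vacuum_contrList_wedge_of_notMem L j hj, smul_zero]

/-- Passage from basis vectors indexed by sets to monomials indexed by lists, where a factor can be
put in front at the cost of a sign. -/
theorem exists_list (A : Finset (Fin n)) : ∃ L : List (Fin n), L.Nodup ∧ L.toFinset = A ∧
    (Pi.basisFun ℂ (Fin n)).ExteriorAlgebra A = monomial L := by
  have hprod : ∀ L : List (Fin n), (L.map fun j =>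
      ExteriorAlgebra.ι ℂ (Pi.basisFun ℂ (Fin n) j)).prod = monomial L := by
    intro L
    induction L with
    | nil => rfl
    | cons j L ih => rw [List.map_cons, List.prod_cons, ih, monomial]; simp
  rw [ExteriorAlgebra.basis_apply_ofCard _ (rfl : A.card = A.card)]
  set g := Set.powersetCard.ofFinEmbEquiv.symm (Set.powersetCard.ofCard (rfl : A.card = A.card))
  refine ⟨List.ofFn g, List.nodup_ofFn.2 g.injective, ?_, ?_⟩
  · ext i
    rw [List.mem_toFinset, List.mem_ofFn]
    exact Set.powersetCard.mem_range_ofFinEmbEquiv_symm_iff_mem _ i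
  · rw [← hprod, List.map_ofFn]
    rfl

theorem spinorForm_basis_left (A : Finset (Fin n)) (w : Spinor n) :
    spinorForm n ((Pi.basisFun ℂ (Fin n)).ExteriorAlgebra A) w =
      (Pi.basisFun ℂ (Fin n)).ExteriorAlgebra.repr w A := by
  simp only [spinorForm, LinearMap.mk₂'ₛₗ_apply, Module.Basis.repr_self, Finsupp.single_apply]
  simp

/-- Both functionals read off a coordinate, as one checks on basis monomials. On the same index set
the contractions give `1`. An index of the contraction list missing from the monomial gives `0`, and
an extra index in the monomial leaves a wedge factor, invisible to the scalar component. -/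
theorem spinorForm_monomial {L : List (Fin n)} (hL : L.Nodup) (w : Spinor n) :
    spinorForm n (monomial L) w = vacuum (contrList L w) := by
  obtain ⟨L₁, h1, h2, h3⟩ := exists_list L.toFinset
  have hperm : L.Perm L₁ := List.perm_of_nodup_nodup_toFinset_eq hL h1 h2.symm
  obtain ⟨ε, e1, e2⟩ := exists_sign_of_perm hperm
  rw [e1, e2, LinearMap.map_smulₛₗ, ← h3, Complex.conj_ofReal, LinearMap.smul_apply,
    LinearMap.smul_apply, map_smul, spinorForm_basis_left]
  congr 1
  suffices h : (Pi.basisFun ℂ (Fin n)).ExteriorAlgebra.coord L.toFinset =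
      vacuum ∘ₗ contrList L₁ from LinearMap.congr_fun h w
  refine (Pi.basisFun ℂ (Fin n)).ExteriorAlgebra.ext fun C => ?_
  obtain ⟨L₂, h1', h2', h3'⟩ := exists_list C
  rw [Module.Basis.coord_apply, Module.Basis.repr_self, h3', LinearMap.comp_apply]
  by_cases hC : C = L.toFinset
  · obtain ⟨ε, e1, -⟩ := exists_sign_of_perm
      (List.perm_of_nodup_nodup_toFinset_eq h1' h1 (by rw [h2', h2, hC]))
    subst hC
    rw [← h3', h3, contrList_monomial_self L₁ h1, vacuum_one, Finsupp.single_eq_same]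
  · rw [Finsupp.single_eq_of_ne (Ne.symm hC)]
    symm
    by_cases hsub : L₁.toFinset ⊆ L₂.toFinset
    · have : ¬ L₂.toFinset ⊆ L₁.toFinset := fun h => hC (by
        rw [← h2', ← h2]; exact h.antisymm hsub)
      obtain ⟨j, hj, hj'⟩ := Finset.not_subset.1 this
      exact vacuum_contrList_monomial_of_notMem_of_mem L₁ L₂ j (by simpa using hj')
        (by simpa using hj)
    · obtain ⟨j, hj, hj'⟩ := Finset.not_subset.1 hsub
      rw [contrList_monomial_of_mem_of_notMem L₁ L₂ j (by simpa using hj) (by simpa using hj'),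
        map_zero]

/-- For `j ∉ L` this is the recursive definition of `contrList`, read through `spinorForm_monomial`.
For `j ∈ L` both sides vanish, since wedge and contraction square to zero. -/
theorem spinorForm_wedge_monomial {L : List (Fin n)} (hL : L.Nodup) (j : Fin n) (w : Spinor n) :
    spinorForm n (wedge j (monomial L)) w = spinorForm n (monomial L) (contr j w) := by
  by_cases hj : j ∈ L
  · obtain ⟨ε, e1, e2⟩ := exists_sign_of_perm (List.perm_cons_erase hj)
    rw [spinorForm_monomial hL, e1, e2, monomial, contrList, map_smul, LinearMap.smul_apply,
      Module.End.mul_apply, ← Module.End.mul_apply (wedge j), wedge_mul_self,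
      ← Module.End.mul_apply (contr j), contr_mul_self]
    simp
  · rw [spinorForm_monomial hL, ← monomial, spinorForm_monomial (List.nodup_cons.2 ⟨hj, hL⟩)]
    rfl

theorem spinorForm_wedge (j : Fin n) (u w : Spinor n) :
    spinorForm n (wedge j u) w = spinorForm n u (contr j w) := by
  suffices h : (spinorForm n).comp (wedge j) = ((spinorForm n).compl₂ (contr j)) from
    LinearMap.congr_fun (LinearMap.congr_fun h u) w
  refine (Pi.basisFun ℂ (Fin n)).ExteriorAlgebra.ext fun A => LinearMap.ext fun w => ?_
  obtain ⟨L, h1, -, h3⟩ := exists_list A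
  rw [h3]
  exact spinorForm_wedge_monomial h1 j w

theorem spinorForm_conj (u w : Spinor n) : spinorForm n w u = conj (spinorForm n u w) := by
  simp [spinorForm, mul_comm]

theorem spinorForm_contr (j : Fin n) (u w : Spinor n) :
    spinorForm n (contr j u) w = spinorForm n u (wedge j w) := by
  rw [spinorForm_conj, ← spinorForm_wedge, ← spinorForm_conj]

end SpinorAdjoint

/-! ### Formal rules for commutators. -/

section Commutator

variable {A : Type*} [Ring A] [Algebra ℂ A]

/-- The commutator of two elements of a ring. -/
def comm (x y : A) : A := x * y - y * x

omit [Algebra ℂ A] in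
theorem comm_add_left (x y z : A) : comm (x + y) z = comm x z + comm y z := by
  simp only [comm, add_mul, mul_add]; abel

omit [Algebra ℂ A] in
theorem comm_add_right (x y z : A) : comm x (y + z) = comm x y + comm x z := by
  simp only [comm, add_mul, mul_add]; abel

omit [Algebra ℂ A] in
theorem comm_sub_left (x y z : A) : comm (x - y) z = comm x z - comm y z := by
  simp only [comm, sub_mul, mul_sub]; abel

theorem comm_smul_left (r : ℂ) (x y : A) : comm (r • x) y = r • comm x y := by
  simp only [comm, smul_mul_assoc, mul_smul_comm, smul_sub]

theorem comm_smul_right (r : ℂ) (x y : A) : comm x (r • y) = r • comm x y := by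
  simp only [comm, smul_mul_assoc, mul_smul_comm, smul_sub]

omit [Algebra ℂ A] in
theorem comm_sum_left {ι : Type*} (S : Finset ι) (x : ι → A) (y : A) :
    comm (∑ i ∈ S, x i) y = ∑ i ∈ S, comm (x i) y := by
  simp only [comm, Finset.sum_mul, Finset.mul_sum, Finset.sum_sub_distrib]

omit [Algebra ℂ A] in
theorem comm_mul_left (x y z : A) : comm (x * y) z = x * comm y z + comm x z * y := by
  simp only [comm, mul_sub, sub_mul, mul_assoc]; abel

omit [Algebra ℂ A] in
theorem comm_swap (x y : A) : comm x y = -comm y x := (neg_sub _ _).symm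

theorem comm_algebraMap_left (r : ℂ) (x : A) : comm (algebraMap ℂ A r) x = 0 :=
  sub_eq_zero.2 (Algebra.commutes r x)

end Commutator

/-! ### Roots and coroots in terms of the inner product. -/

section Roots

variable {E : Type*} [NormedAddCommGroup E] [InnerProductSpace ℝ E]
  {G : Subgroup (E ≃ₗᵢ[ℝ] E)} (R : RootChoice G)

open scoped InnerProductSpace

theorem inv_coe_of_reflection {s : G} (hs : IsReflection (s : E ≃ₗᵢ[ℝ] E)) :
    ((s⁻¹ : E ≃ₗᵢ[ℝ] E)) = s := by
  obtain ⟨α, -, hsα⟩ := hs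
  rw [hsα, Submodule.reflection_inv]

theorem reflection_apply_eq {s : E ≃ₗᵢ[ℝ] E} {α : E} (hsα : s = (ℝ ∙ α)ᗮ.reflection) (v : E) :
    s v = v - (2 * (⟪α, v⟫_ℝ / ‖α‖ ^ 2)) • α := by
  rw [hsα, Submodule.reflection_orthogonal_apply, Submodule.reflection_singleton_apply]
  simp [two_smul, two_mul, add_smul]

theorem RootChoice.exists_root_eq {s : G} {α : E} (hs : IsReflection (s : E ≃ₗᵢ[ℝ] E))
    (hsα : (s : E ≃ₗᵢ[ℝ] E) = (ℝ ∙ α)ᗮ.reflection) : ∃ r : ℝ, r ≠ 0 ∧ R.root s = r • α := by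
  have h := R.apply_root s hs
  rw [reflection_apply_eq hsα] at h
  obtain ⟨r, hr⟩ : ∃ r : ℝ, R.root s = r • α := by
    refine ⟨⟪α, R.root s⟫_ℝ / ‖α‖ ^ 2, ?_⟩
    have h2 : (2 : ℝ) • R.root s = (2 : ℝ) • ((⟪α, R.root s⟫_ℝ / ‖α‖ ^ 2) • α) := by
      rw [smul_smul, two_smul]
      nth_rewrite 1 [← sub_add_cancel (R.root s) ((2 * (⟪α, R.root s⟫_ℝ / (‖α‖ ^ 2))) • α)]
      rw [h]; abel
    exact smul_right_injective E (two_ne_zero (α := ℝ)) h2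
  refine ⟨r, ?_, hr⟩
  rintro rfl
  exact R.root_ne_zero s hs (by rw [hr, zero_smul])

/-- The `-1`-eigenspace of a reflection on the dual is the line of functionals `⟪α, ·⟫`, and `α` is
proportional to the chosen root. -/
theorem RootChoice.exists_coroot_eq {s : G} (hs : IsReflection (s : E ≃ₗᵢ[ℝ] E)) :
    ∃ t : ℝ, t ≠ 0 ∧ ∀ v, R.coroot s v = t * ⟪R.root s, v⟫_ℝ := by
  obtain ⟨α, hα, hsα⟩ := id hs
  have hα2 : (‖α‖ ^ 2) ≠ 0 := by positivity
  have hco : ∀ v, R.coroot s v = ⟪α, v⟫_ℝ / ‖α‖ ^ 2 * R.coroot s α := by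
    intro v
    have h := R.coroot_apply s hs v
    rw [inv_coe_of_reflection hs, reflection_apply_eq hsα, map_sub, map_smul, smul_eq_mul] at h
    linarith
  obtain ⟨r, hr0, hr⟩ := R.exists_root_eq hs hsα
  have ha0 : R.coroot s α ≠ 0 := by
    intro h0
    exact R.coroot_ne_zero s hs (LinearMap.ext fun v => by rw [hco, h0, mul_zero]; rfl)
  refine ⟨R.coroot s α / (‖α‖ ^ 2 * r), div_ne_zero ha0 (mul_ne_zero hα2 hr0), fun v => ?_⟩
  rw [hco v, hr, inner_smul_left]
  simp only [conj_trivial]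
  field_simp

/-- The scale of the coroot cancels, so the Cherednik relation can be written with the root alone.
-/
theorem RootChoice.coroot_div {s : G} (hs : IsReflection (s : E ≃ₗᵢ[ℝ] E)) (v : E) :
    R.coroot s v / R.coroot s (R.root s) = ⟪R.root s, v⟫_ℝ / ‖R.root s‖ ^ 2 := by
  obtain ⟨t, ht, h⟩ := R.exists_coroot_eq hs
  rw [h, h, real_inner_self_eq_norm_sq]
  exact mul_div_mul_left _ _ ht

theorem RootChoice.apply_eq {s : G} (hs : IsReflection (s : E ≃ₗᵢ[ℝ] E)) (v : E) :
    (s : E ≃ₗᵢ[ℝ] E) v = v - (2 * (⟪R.root s, v⟫_ℝ / ‖R.root s‖ ^ 2)) • R.root s := by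
  obtain ⟨α, hα, hsα⟩ := id hs
  obtain ⟨r, hr0, hr⟩ := R.exists_root_eq hs hsα
  rw [reflection_apply_eq hsα, hr, smul_smul, inner_smul_left, norm_smul]
  congr 2
  have : ‖α‖ ≠ 0 := norm_ne_zero_iff.2 hα
  simp only [conj_trivial, Real.norm_eq_abs, mul_pow, sq_abs]
  field_simp

end Roots

/-! ### Commutation relations in the rational Cherednik algebra. -/

section Relations

variable {E : Type*} [NormedAddCommGroup E] [InnerProductSpace ℝ E]
  (G : Subgroup (E ≃ₗᵢ[ℝ] E)) [Fintype G] (R : RootChoice G) (c : G → ℝ)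

theorem mk_eq_of_rel {x y : FreeAlgebra ℂ (Gen G)} (h : Rel G R c x y) :
    mk G R c x = mk G R c y := RingQuot.mkAlgHom_rel ℂ h

theorem vec_add (ξ η : E) : vec G R c (ξ + η) = vec G R c ξ + vec G R c η := by
  simpa [vec, covec, grp] using mk_eq_of_rel G R c (Rel.vec_add ξ η)

theorem vec_smul (r : ℝ) (ξ : E) : vec G R c (r • ξ) = (r : ℂ) • vec G R c ξ :=
    (mk_eq_of_rel G R c (Rel.vec_smul r ξ)).trans (map_smul _ _ _)

theorem covec_add (x y : Module.Dual ℝ E) :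
    covec G R c (x + y) = covec G R c x + covec G R c y := by
  simpa [vec, covec, grp] using mk_eq_of_rel G R c (Rel.covec_add x y)

theorem covec_smul (r : ℝ) (x : Module.Dual ℝ E) :
    covec G R c (r • x) = (r : ℂ) • covec G R c x :=
    (mk_eq_of_rel G R c (Rel.covec_smul r x)).trans (map_smul _ _ _)

theorem grp_mul_vec (g : G) (ξ : E) :
    grp G R c g * vec G R c ξ = vec G R c ((g : E ≃ₗᵢ[ℝ] E) ξ) * grp G R c g := by
  simpa [vec, covec, grp] using mk_eq_of_rel G R c (Rel.grp_vec g ξ)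

theorem grp_mul_covec (g : G) (x : Module.Dual ℝ E) :
    grp G R c g * covec G R c x =
      covec G R c (x ∘ₗ ((g⁻¹ : E ≃ₗᵢ[ℝ] E).toLinearEquiv : E →ₗ[ℝ] E)) * grp G R c g := by
  simpa [vec, covec, grp] using mk_eq_of_rel G R c (Rel.grp_covec g x)

theorem comm_vec_vec (ξ η : E) : comm (vec G R c ξ) (vec G R c η) = 0 := by
  rw [comm, sub_eq_zero]
  simpa [vec, covec, grp] using mk_eq_of_rel G R c (Rel.vec_comm ξ η)

theorem comm_covec_covec (x y : Module.Dual ℝ E) : comm (covec G R c x) (covec G R c y) = 0 := by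
  rw [comm, sub_eq_zero]
  simpa [vec, covec, grp] using mk_eq_of_rel G R c (Rel.covec_comm x y)

open scoped InnerProductSpace

/-- The weight `2 c(s) / ‖αₛ‖²`. -/
def weight (s : G) : ℝ := 2 * c s / ‖R.root s‖ ^ 2

theorem comm_vec_covec (ξ : E) (x : Module.Dual ℝ E) :
    comm (vec G R c ξ) (covec G R c x) = algebraMap ℂ _ ((x ξ : ℝ) : ℂ) -
      ∑ s ∈ reflections G,
        ((weight G R c s * x (R.root s) * ⟪R.root s, ξ⟫_ℝ : ℝ) : ℂ) • grp G R c s := by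
  rw [comm]
  have h := mk_eq_of_rel G R c (Rel.vec_covec ξ x)
  simp only [map_sub, map_mul, map_smul, map_sum, AlgHom.commutes] at h
  refine h.trans ?_
  rw [Finset.smul_sum]
  congr 1
  refine Finset.sum_congr rfl fun s hs => ?_
  have hs' : IsReflection (s : E ≃ₗᵢ[ℝ] E) := by simpa [reflections] using hs
  rw [smul_smul, mul_div_assoc, R.coroot_div hs', weight, grp]
  congr 1
  push_cast
  ring

theorem vec_sum {ι : Type*} (S : Finset ι) (r : ι → ℝ) (v : ι → E) :
    vec G R c (∑ i ∈ S, r i • v i) = ∑ i ∈ S, (r i : ℂ) • vec G R c (v i) := by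
  classical
  induction S using Finset.induction_on with
  -- The zero vector maps to zero by homogeneity at the scalar `0`.
  | empty => simpa using vec_smul G R c 0 0
  | insert i S hi ih => rw [Finset.sum_insert hi, Finset.sum_insert hi, vec_add, vec_smul, ih]

theorem covec_sum {ι : Type*} (S : Finset ι) (r : ι → ℝ) (v : ι → Module.Dual ℝ E) :
    covec G R c (∑ i ∈ S, r i • v i) = ∑ i ∈ S, (r i : ℂ) • covec G R c (v i) := by
  classical
  induction S using Finset.induction_on with
  | empty => simpa using covec_smul G R c 0 0
  | insert i S hi ih =>
    rw [Finset.sum_insert hi, Finset.sum_insert hi, covec_add, covec_smul, ih]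

/-- `sξ - ξ` is a multiple of the root. The coefficient is arranged to be the `weight` that occurs
in `comm_vec_covec`, so that the two can cancel in the brackets with `H`. -/
theorem comm_grp_vec {s : G} (hs : s ∈ reflections G) (ξ : E) :
    comm ((c s : ℂ) • grp G R c s) (vec G R c ξ) =
      -(((weight G R c s * ⟪R.root s, ξ⟫_ℝ : ℝ) : ℂ) • (vec G R c (R.root s) * grp G R c s)) := by
  have hs' : IsReflection (s : E ≃ₗᵢ[ℝ] E) := by simpa [reflections] using hs
  have e : vec G R c ((s : E ≃ₗᵢ[ℝ] E) ξ) = vec G R c ξ +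
      ((-(2 * (⟪R.root s, ξ⟫_ℝ / ‖R.root s‖ ^ 2)) : ℝ) : ℂ) • vec G R c (R.root s) := by
    rw [R.apply_eq hs', sub_eq_add_neg, ← neg_smul, vec_add, vec_smul]
  rw [comm_smul_left, comm, grp_mul_vec, e, add_mul, add_sub_cancel_left, smul_mul_assoc,
    smul_smul, ← neg_smul, weight]
  congr 1
  push_cast
  ring

theorem comm_grp_covec {s : G} (hs : s ∈ reflections G) (x : Module.Dual ℝ E) :
    comm ((c s : ℂ) • grp G R c s) (covec G R c x) =
      -(((weight G R c s * x (R.root s) : ℝ) : ℂ) •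
        (covec G R c (innerₗ E (R.root s)) * grp G R c s)) := by
  have hs' : IsReflection (s : E ≃ₗᵢ[ℝ] E) := by simpa [reflections] using hs
  have e0 : x ∘ₗ ((s⁻¹ : E ≃ₗᵢ[ℝ] E).toLinearEquiv : E →ₗ[ℝ] E) =
      x + (-(2 * x (R.root s) / ‖R.root s‖ ^ 2)) • innerₗ E (R.root s) := by
    refine LinearMap.ext fun v => ?_
    have : (s⁻¹ : E ≃ₗᵢ[ℝ] E) v = v - (2 * (⟪R.root s, v⟫_ℝ / ‖R.root s‖ ^ 2)) • R.root s := by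
      rw [inv_coe_of_reflection hs', R.apply_eq hs']
    change x ((s⁻¹ : E ≃ₗᵢ[ℝ] E) v) = x v + (-(2 * x (R.root s) / ‖R.root s‖ ^ 2)) •
      ⟪R.root s, v⟫_ℝ
    rw [this, map_sub, map_smul, smul_eq_mul, smul_eq_mul]
    ring
  have e : covec G R c (x ∘ₗ ((s⁻¹ : E ≃ₗᵢ[ℝ] E).toLinearEquiv : E →ₗ[ℝ] E)) = covec G R c x +
      ((-(2 * x (R.root s) / ‖R.root s‖ ^ 2) : ℝ) : ℂ) • covec G R c (innerₗ E (R.root s)) := by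
    rw [e0, covec_add, covec_smul]
  rw [comm_smul_left, comm, grp_mul_covec, e, add_mul, add_sub_cancel_left, smul_mul_assoc,
    smul_smul, ← neg_smul, weight]
  congr 1
  push_cast
  ring

end Relations

/-! ### Anticommutators of odd elements of `A ⊗ 𝒞`. -/

section OddFamilies

variable {A : Type*} [Ring A] [Algebra ℂ A] {n : ℕ}

/-- `∑ⱼ aⱼ ⊗ fⱼ†`. -/
def oddUp (a : Fin n → A) : A ⊗[ℂ] Cliff n := ∑ j, a j ⊗ₜ[ℂ] fd n j

/-- `∑ⱼ aⱼ ⊗ fⱼ`. -/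
def oddDown (a : Fin n → A) : A ⊗[ℂ] Cliff n := ∑ j, a j ⊗ₜ[ℂ] f n j

theorem eq_zero_of_antisymm (X : Fin n → Fin n → A ⊗[ℂ] Cliff n)
    (hX : ∀ j k, X j k = -X k j) : ∑ j, ∑ k, X j k = 0 := by
  have h : ∑ j, ∑ k, X j k = -∑ j, ∑ k, X j k := by
    conv_lhs => rw [Finset.sum_comm]
    simp only [← Finset.sum_neg_distrib]
    exact Finset.sum_congr rfl fun j _ => Finset.sum_congr rfl fun k _ => hX k j
  have h2 : (2 : ℂ) • ∑ j, ∑ k, X j k = 0 := by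
    rw [two_smul]; nth_rewrite 2 [h]; exact add_neg_cancel _
  exact (smul_eq_zero.1 h2).resolve_left two_ne_zero

/-- The anticommutator equals `∑ [aⱼ, bₖ] ⊗ fⱼ† fₖ†`: a symmetric factor against an antisymmetric
one. -/
theorem oddUp_mul_oddUp_add (a b : Fin n → A) (hab : ∀ j k, comm (a j) (b k) = comm (a k) (b j)) :
    oddUp a * oddUp b + oddUp b * oddUp a = 0 := by
  have h : oddUp a * oddUp b + oddUp b * oddUp a =
      ∑ j, ∑ k, comm (a j) (b k) ⊗ₜ[ℂ] (fd n j * fd n k) := by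
    rw [oddUp, oddUp, Finset.sum_mul_sum, Finset.sum_mul_sum]
    conv_lhs => arg 2; rw [Finset.sum_comm]
    rw [← Finset.sum_add_distrib]
    refine Finset.sum_congr rfl fun j _ => ?_
    rw [← Finset.sum_add_distrib]
    refine Finset.sum_congr rfl fun k _ => ?_
    rw [Algebra.TensorProduct.tmul_mul_tmul, Algebra.TensorProduct.tmul_mul_tmul,
      eq_neg_of_add_eq_zero_right (fd_mul_fd_add j k), TensorProduct.tmul_neg, comm,
      TensorProduct.sub_tmul, sub_eq_add_neg]
  rw [h]
  refine eq_zero_of_antisymm _ fun j k => ?_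
  rw [hab, eq_neg_of_add_eq_zero_left (fd_mul_fd_add j k), TensorProduct.tmul_neg]

theorem oddDown_mul_oddDown_add (a b : Fin n → A)
    (hab : ∀ j k, comm (a j) (b k) = comm (a k) (b j)) :
    oddDown a * oddDown b + oddDown b * oddDown a = 0 := by
  have h : oddDown a * oddDown b + oddDown b * oddDown a =
      ∑ j, ∑ k, comm (a j) (b k) ⊗ₜ[ℂ] (f n j * f n k) := by
    rw [oddDown, oddDown, Finset.sum_mul_sum, Finset.sum_mul_sum]
    conv_lhs => arg 2; rw [Finset.sum_comm]
    rw [← Finset.sum_add_distrib]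
    refine Finset.sum_congr rfl fun j _ => ?_
    rw [← Finset.sum_add_distrib]
    refine Finset.sum_congr rfl fun k _ => ?_
    rw [Algebra.TensorProduct.tmul_mul_tmul, Algebra.TensorProduct.tmul_mul_tmul,
      eq_neg_of_add_eq_zero_right (f_mul_f_add j k), TensorProduct.tmul_neg, comm,
      TensorProduct.sub_tmul, sub_eq_add_neg]
  rw [h]
  refine eq_zero_of_antisymm _ fun j k => ?_
  rw [hab, eq_neg_of_add_eq_zero_left (f_mul_f_add j k), TensorProduct.tmul_neg]

/-- Each term is `[aⱼ, bₖ] ⊗ fⱼ† fₖ + bₖ aⱼ ⊗ {fⱼ†, fₖ}`, and the last anticommutator is `δⱼₖ`. This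
is the source of all the even operators. -/
theorem oddUp_mul_oddDown_add (a b : Fin n → A) :
    oddUp a * oddDown b + oddDown b * oddUp a =
      (∑ j, b j * a j) ⊗ₜ[ℂ] (1 : Cliff n) +
        ∑ j, ∑ k, comm (a j) (b k) ⊗ₜ[ℂ] (fd n j * f n k) := by
  have h : ∀ j, (b j * a j) ⊗ₜ[ℂ] (1 : Cliff n) = ∑ k, (b k * a j) ⊗ₜ[ℂ]
      (if k = j then (1 : Cliff n) else 0) := by
    intro j
    rw [Finset.sum_eq_single j (fun k _ hk => by rw [if_neg hk, TensorProduct.tmul_zero])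
      (by simp), if_pos rfl]
  rw [oddUp, oddDown, Finset.sum_mul_sum, Finset.sum_mul_sum, TensorProduct.sum_tmul]
  conv_lhs => arg 2; rw [Finset.sum_comm]
  rw [← Finset.sum_add_distrib, ← Finset.sum_add_distrib]
  refine Finset.sum_congr rfl fun j _ => ?_
  rw [h, ← Finset.sum_add_distrib, ← Finset.sum_add_distrib]
  refine Finset.sum_congr rfl fun k _ => ?_
  rw [Algebra.TensorProduct.tmul_mul_tmul, Algebra.TensorProduct.tmul_mul_tmul,
    ← f_mul_fd_add k j, comm, TensorProduct.sub_tmul, TensorProduct.tmul_add]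
  abel

theorem oddUp_smul (r : ℂ) (a : Fin n → A) : oddUp (fun j => r • a j) = r • oddUp a := by
  simp only [oddUp, Finset.smul_sum, TensorProduct.smul_tmul']

theorem oddDown_smul (r : ℂ) (a : Fin n → A) : oddDown (fun j => r • a j) = r • oddDown a := by
  simp only [oddDown, Finset.smul_sum, TensorProduct.smul_tmul']

theorem comm_number_fd (k : Fin n) :
    comm (∑ j : Fin n, fd n j * f n j) (fd n k) = fd n k := by
  have h : ∀ j : Fin n, comm (fd n j * f n j) (fd n k) = if j = k then fd n j else 0 := by
    intro j
    -- The identity `[XY, W] = X{Y, W} - {X, W}Y` brings in the Clifford relations.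
    have e : comm (fd n j * f n j) (fd n k) =
        fd n j * (f n j * fd n k + fd n k * f n j) -
          (fd n j * fd n k + fd n k * fd n j) * f n j := by
      rw [comm]; noncomm_ring
    rw [e, f_mul_fd_add, fd_mul_fd_add, zero_mul, sub_zero, mul_ite, mul_one, mul_zero]
  rw [comm_sum_left]
  simp [h]

theorem comm_number_f (k : Fin n) :
    comm (∑ j : Fin n, fd n j * f n j) (f n k) = -f n k := by
  have h : ∀ j : Fin n, comm (fd n j * f n j) (f n k) = if j = k then -f n j else 0 := by
    intro j
    have e : comm (fd n j * f n j) (f n k) =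
        fd n j * (f n j * f n k + f n k * f n j) -
          (f n k * fd n j + fd n j * f n k) * f n j := by
      rw [comm]; noncomm_ring
    rw [e, f_mul_fd_add, f_mul_f_add, mul_zero, zero_sub]
    split_ifs with h1 h2 h2
    · rw [one_mul]
    · exact absurd h1.symm h2
    · exact absurd h2.symm h1
    · simp
  rw [comm_sum_left]
  simp [h]

end OddFamilies

/-! ### Brackets of the complex coordinates, and the Euler element. -/

section Brackets

variable {E : Type*} [NormedAddCommGroup E] [InnerProductSpace ℝ E]
  (G : Subgroup (E ≃ₗᵢ[ℝ] E)) [Fintype G] (R : RootChoice G) (c : G → ℝ)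
  {n : ℕ} (b : OrthonormalBasis (Fin n ⊕ Fin n) ℝ E)

open scoped InnerProductSpace

/-- The pairing `⟨zⱼ, v⟩`. -/
def zCoord (v : E) (j : Fin n) : ℂ :=
  (b.toBasis.coord (Sum.inl j) v : ℂ) + Complex.I * (b.toBasis.coord (Sum.inr j) v : ℂ)

/-- The pairing `⟨z̄ⱼ, v⟩`. -/
def zbarCoord (v : E) (j : Fin n) : ℂ :=
  (b.toBasis.coord (Sum.inl j) v : ℂ) - Complex.I * (b.toBasis.coord (Sum.inr j) v : ℂ)

theorem coord_eq_inner (i : Fin n ⊕ Fin n) (v : E) : b.toBasis.coord i v = ⟪v, b i⟫_ℝ := by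
  rw [Module.Basis.coord_apply, OrthonormalBasis.coe_toBasis_repr_apply,
    OrthonormalBasis.repr_apply_apply, real_inner_comm]

theorem coord_eq_innerₗ (i : Fin n ⊕ Fin n) : b.toBasis.coord i = innerₗ E (b i) := by
  refine LinearMap.ext fun v => ?_
  rw [coord_eq_inner, real_inner_comm]; rfl

theorem sum_zbarCoord_mul_zCoord (v : E) :
    ∑ j, zbarCoord b v j * zCoord b v j = ((‖v‖ ^ 2 : ℝ) : ℂ) := by
  have h : ‖v‖ ^ 2 = ∑ i, b.toBasis.coord i v * b.toBasis.coord i v := by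
    rw [← real_inner_self_eq_norm_sq, ← b.sum_inner_mul_inner v v]
    refine Finset.sum_congr rfl fun i _ => ?_
    rw [coord_eq_inner, real_inner_comm v (b i)]
  have hI := Complex.I_mul_I
  rw [h, Fintype.sum_sum_type, Complex.ofReal_add, Complex.ofReal_sum, Complex.ofReal_sum,
    ← Finset.sum_add_distrib]
  refine Finset.sum_congr rfl fun j _ => ?_
  simp only [zbarCoord, zCoord]
  push_cast
  linear_combination (-(b.toBasis.coord (Sum.inr j) v * b.toBasis.coord (Sum.inr j) v : ℂ)) * hI

theorem comm_basis (i j : Fin n ⊕ Fin n) :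
    comm (vec G R c (b i)) (covec G R c (b.toBasis.coord j)) =
      (if i = j then 1 else 0) - ∑ s ∈ reflections G,
        ((weight G R c s : ℂ) * (b.toBasis.coord i (R.root s) * b.toBasis.coord j (R.root s))) •
          grp G R c s := by
  rw [comm_vec_covec]
  congr 1
  · rw [← OrthonormalBasis.coe_toBasis, Module.Basis.coord_apply, Module.Basis.repr_self,
      Finsupp.single_apply]
    split_ifs <;> simp
  · refine Finset.sum_congr rfl fun s _ => ?_
    rw [← coord_eq_inner]
    congr 1
    push_cast
    ring

/-- The four mixed brackets below are the cases `r, t = ±i`; the constant `1 + rt` is `2` for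
opposite signs and `0` for equal ones. -/
theorem comm_combination (k j : Fin n) (r t : ℂ) :
    comm (vec G R c (b (Sum.inl k)) + r • vec G R c (b (Sum.inr k)))
      (covec G R c (b.toBasis.coord (Sum.inl j)) + t • covec G R c (b.toBasis.coord (Sum.inr j))) =
      (if k = j then 1 + r * t else 0 : ℂ) • (1 : RCA G R c) - ∑ s ∈ reflections G,
        ((weight G R c s : ℂ) *
          ((b.toBasis.coord (Sum.inl k) (R.root s) + r * b.toBasis.coord (Sum.inr k) (R.root s)) *
          (b.toBasis.coord (Sum.inl j) (R.root s) + t * b.toBasis.coord (Sum.inr j) (R.root s)))) •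
          grp G R c s := by
  simp only [comm_smul_left, comm_smul_right, comm_add_left, comm_add_right,
    comm_basis, Sum.inl.injEq, Sum.inr.injEq, reduceCtorEq, if_false, zero_sub, smul_sub,
    Finset.smul_sum, smul_neg, smul_add]
  have hs : ∀ X Y Z W : G → RCA G R c, ∀ d d' : RCA G R c,
      d - ∑ s ∈ reflections G, X s + -∑ s ∈ reflections G, Y s +
        (-∑ s ∈ reflections G, Z s + (d' - ∑ s ∈ reflections G, W s)) =
      d + d' - ∑ s ∈ reflections G, (X s + Y s + Z s + W s) := by
    intro X Y Z W d d'
    simp only [Finset.sum_add_distrib]; abel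
  rw [hs]
  congr 1
  · split_ifs
    · rw [smul_smul, add_smul, one_smul, mul_comm]
    · simp
  · refine Finset.sum_congr rfl fun s _ => ?_
    simp only [smul_smul, ← add_smul]
    congr 1
    ring

theorem zeta_eq (j : Fin n) : zeta G R c b j = (1 / 2 : ℂ) •
    (vec G R c (b (Sum.inl j)) + (-Complex.I) • vec G R c (b (Sum.inr j))) := by
  rw [zeta, neg_smul, sub_eq_add_neg]

theorem zbar_eq (j : Fin n) : zbar G R c b j = covec G R c (b.toBasis.coord (Sum.inl j)) +
    (-Complex.I) • covec G R c (b.toBasis.coord (Sum.inr j)) := by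
  rw [zbar, neg_smul, sub_eq_add_neg]

theorem comm_zeta_z (k j : Fin n) :
    comm (zeta G R c b k) (z G R c b j) = (if k = j then 1 else 0 : ℂ) • (1 : RCA G R c) -
      ∑ s ∈ reflections G, ((weight G R c s / 2 : ℂ) *
        (zbarCoord b (R.root s) k * zCoord b (R.root s) j)) • grp G R c s := by
  have hI := Complex.I_mul_I
  rw [zeta_eq, z, comm_smul_left, comm_combination, smul_sub, smul_smul, Finset.smul_sum]
  congr 2
  · split_ifs
    · linear_combination (-1 / 2 : ℂ) * hI
    · simp
  · refine funext fun s => ?_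
    rw [smul_smul, zbarCoord, zCoord]
    congr 1
    ring

theorem comm_zetabar_zbar (k j : Fin n) :
    comm (zetabar G R c b k) (zbar G R c b j) = (if k = j then 1 else 0 : ℂ) • (1 : RCA G R c) -
      ∑ s ∈ reflections G, ((weight G R c s / 2 : ℂ) *
        (zbarCoord b (R.root s) j * zCoord b (R.root s) k)) • grp G R c s := by
  have hI := Complex.I_mul_I
  rw [zetabar, zbar_eq, comm_smul_left, comm_combination, smul_sub, smul_smul, Finset.smul_sum]
  congr 2
  · split_ifs
    · linear_combination (-1 / 2 : ℂ) * hI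
    · simp
  · refine funext fun s => ?_
    rw [smul_smul, zbarCoord, zCoord]
    congr 1
    ring

/-- No constant survives and the answer is symmetric in `k` and `j`, which is the hypothesis of
`oddUp_mul_oddUp_add`. -/
theorem comm_zeta_zbar (k j : Fin n) :
    comm (zeta G R c b k) (zbar G R c b j) =
      -∑ s ∈ reflections G, ((weight G R c s / 2 : ℂ) *
        (zbarCoord b (R.root s) k * zbarCoord b (R.root s) j)) • grp G R c s := by
  have hI := Complex.I_mul_I
  have h0 : (if k = j then 1 + -Complex.I * -Complex.I else 0 : ℂ) = 0 := by
    split_ifs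
    · linear_combination hI
    · rfl
  rw [zeta_eq, zbar_eq, comm_smul_left, comm_combination, smul_sub, smul_smul, Finset.smul_sum, h0,
    mul_zero, zero_smul, zero_sub]
  congr 1
  refine Finset.sum_congr rfl fun s _ => ?_
  rw [smul_smul, zbarCoord, zbarCoord]
  congr 1
  ring

theorem comm_zetabar_z (k j : Fin n) :
    comm (zetabar G R c b k) (z G R c b j) =
      -∑ s ∈ reflections G, ((weight G R c s / 2 : ℂ) *
        (zCoord b (R.root s) k * zCoord b (R.root s) j)) • grp G R c s := by
  have hI := Complex.I_mul_I
  have h0 : (if k = j then 1 + Complex.I * Complex.I else 0 : ℂ) = 0 := by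
    split_ifs
    · linear_combination hI
    · rfl
  rw [zetabar, z, comm_smul_left, comm_combination, smul_sub, smul_smul, Finset.smul_sum, h0,
    mul_zero, zero_smul, zero_sub]
  congr 1
  refine Finset.sum_congr rfl fun s _ => ?_
  rw [smul_smul, zCoord, zCoord]
  congr 1
  ring

theorem comm_vec_combination (ξ η ξ' η' : E) (r r' : ℂ) :
    comm (vec G R c ξ + r • vec G R c η) (vec G R c ξ' + r' • vec G R c η') = 0 := by
  simp [comm_add_left, comm_add_right, comm_smul_left, comm_smul_right, comm_vec_vec]

theorem comm_covec_combination (x y x' y' : Module.Dual ℝ E) (r r' : ℂ) :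
    comm (covec G R c x + r • covec G R c y) (covec G R c x' + r' • covec G R c y') = 0 := by
  simp [comm_add_left, comm_add_right, comm_smul_left, comm_smul_right, comm_covec_covec]

theorem comm_zeta_zeta (j k : Fin n) : comm (zeta G R c b j) (zeta G R c b k) = 0 := by
  rw [zeta_eq, zeta_eq, comm_smul_left, comm_smul_right, comm_vec_combination, smul_zero,
    smul_zero]

theorem comm_zeta_zetabar (j k : Fin n) : comm (zeta G R c b j) (zetabar G R c b k) = 0 := by
  rw [zeta_eq, zetabar, comm_smul_left, comm_smul_right, comm_vec_combination, smul_zero,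
    smul_zero]

theorem comm_zetabar_zetabar (j k : Fin n) :
    comm (zetabar G R c b j) (zetabar G R c b k) = 0 := by
  rw [zetabar, zetabar, comm_smul_left, comm_smul_right, comm_vec_combination, smul_zero,
    smul_zero]

theorem comm_z_z (j k : Fin n) : comm (z G R c b j) (z G R c b k) = 0 := by
  rw [z, z, comm_covec_combination]

theorem comm_zbar_zbar (j k : Fin n) : comm (zbar G R c b j) (zbar G R c b k) = 0 := by
  rw [zbar_eq, zbar_eq, comm_covec_combination]

/-! ### The Euler element -/

theorem z_mul_zeta_add (j : Fin n) :
    z G R c b j * zeta G R c b j + zbar G R c b j * zetabar G R c b j =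
      covec G R c (b.toBasis.coord (Sum.inl j)) * vec G R c (b (Sum.inl j)) +
        covec G R c (b.toBasis.coord (Sum.inr j)) * vec G R c (b (Sum.inr j)) := by
  have hI := Complex.I_mul_I
  rw [z, zbar_eq, zeta_eq, zetabar]
  simp only [mul_add, add_mul, smul_mul_assoc, mul_smul_comm, smul_add, smul_smul]
  match_scalars <;> first | linear_combination (0 : ℂ) * hI | linear_combination (-1 : ℂ) * hI

theorem Hop_eq : Hop G R c b =
    ∑ i, covec G R c (b.toBasis.coord i) * vec G R c (b i) +
      algebraMap ℂ (RCA G R c) (n : ℂ) - ∑ s ∈ reflections G, (c s : ℂ) • grp G R c s := by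
  rw [Hop, Fintype.sum_sum_type, ← Finset.sum_add_distrib]
  simp only [z_mul_zeta_add]

theorem covec_eq_sum (x : Module.Dual ℝ E) :
    covec G R c x = ∑ i, ((x (b i) : ℝ) : ℂ) • covec G R c (b.toBasis.coord i) := by
  rw [← covec_sum]
  congr 1
  refine b.toBasis.ext fun i => ?_
  simp [LinearMap.sum_apply, -Fintype.sum_sum_type]

theorem vec_eq_sum (ξ : E) :
    vec G R c ξ = ∑ i, ((b.toBasis.coord i ξ : ℝ) : ℂ) • vec G R c (b i) := by
  rw [← vec_sum]
  congr 1
  simpa using (b.toBasis.sum_repr ξ).symm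

/-- The Euler part gives `x` plus a reflection term with the covector `∑ᵢ ⟪αₛ, bᵢ⟫ xᵢ = ⟪αₛ, ·⟫`.
Subtracting `∑ c(s) s` in `H` cancels exactly that term. -/
theorem comm_Hop_covec (x : Module.Dual ℝ E) : comm (Hop G R c b) (covec G R c x) =
    covec G R c x := by
  rw [Hop_eq, comm_sub_left, comm_add_left, comm_algebraMap_left, add_zero, comm_sum_left,
    comm_sum_left]
  simp only [comm_mul_left, comm_covec_covec, zero_mul, add_zero, comm_vec_covec, mul_sub,
    Finset.sum_sub_distrib, Finset.mul_sum]
  have h1 : ∑ i, covec G R c (b.toBasis.coord i) * algebraMap ℂ _ ((x (b i) : ℝ) : ℂ) =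
      covec G R c x := by
    rw [covec_eq_sum G R c b x]
    refine Finset.sum_congr rfl fun i _ => ?_
    rw [← Algebra.commutes, Algebra.smul_def]
  rw [h1, sub_sub, sub_eq_self, Finset.sum_comm, ← Finset.sum_add_distrib]
  refine Finset.sum_eq_zero fun s hs => ?_
  rw [comm_grp_covec G R c hs, covec_eq_sum G R c b (innerₗ E (R.root s)), Finset.sum_mul,
    Finset.smul_sum, add_neg_eq_zero]
  refine Finset.sum_congr rfl fun i _ => ?_
  rw [mul_smul_comm, smul_mul_assoc, smul_smul, innerₗ_apply_apply]
  congr 1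
  push_cast
  ring

theorem comm_Hop_vec (ξ : E) : comm (Hop G R c b) (vec G R c ξ) = -vec G R c ξ := by
  rw [Hop_eq, comm_sub_left, comm_add_left, comm_algebraMap_left, add_zero, comm_sum_left,
    comm_sum_left]
  simp only [comm_mul_left, comm_vec_vec, mul_zero, zero_add,
    comm_swap (covec G R c _) (vec G R c ξ), comm_vec_covec, neg_sub, sub_mul,
    Finset.sum_sub_distrib, Finset.sum_mul]
  have h1 : ∑ i, algebraMap ℂ _ ((b.toBasis.coord i ξ : ℝ) : ℂ) * vec G R c (b i) =
      vec G R c ξ := by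
    rw [vec_eq_sum G R c b ξ]
    refine Finset.sum_congr rfl fun i _ => ?_
    rw [Algebra.smul_def]
  rw [h1, sub_sub, add_comm (vec G R c ξ), ← sub_sub, sub_eq_neg_self, Finset.sum_comm,
    ← Finset.sum_sub_distrib]
  refine Finset.sum_eq_zero fun s hs => ?_
  have hs' : IsReflection (s : E ≃ₗᵢ[ℝ] E) := by simpa [reflections] using hs
  -- The two reflection sums have `s` on opposite sides of the root; as `s αₛ = -αₛ`, moving it
  -- across supplies the sign needed for the cancellation.
  have hswap : vec G R c (R.root s) * grp G R c s = -(grp G R c s * vec G R c (R.root s)) := by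
    rw [grp_mul_vec, R.apply_root s hs', ← neg_one_smul ℝ (R.root s), vec_smul]
    simp
  rw [comm_grp_vec G R c hs, hswap, vec_eq_sum G R c b (R.root s), Finset.mul_sum, smul_neg,
    neg_neg, Finset.smul_sum, sub_eq_zero]
  refine Finset.sum_congr rfl fun i _ => ?_
  rw [mul_smul_comm, smul_mul_assoc, smul_smul]
  congr 1
  push_cast
  ring

end Brackets

/-! ### The superalgebra relations between odd and even operators. -/

section Superalgebra

variable {E : Type*} [NormedAddCommGroup E] [InnerProductSpace ℝ E]
  (G : Subgroup (E ≃ₗᵢ[ℝ] E)) [Fintype G] (R : RootChoice G) (c : G → ℝ)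
  {n : ℕ} (b : OrthonormalBasis (Fin n ⊕ Fin n) ℝ E)

open scoped InnerProductSpace

theorem Fplus_eq : Fplus G R c b = oddUp (zbar G R c b) := rfl

theorem Fbarplus_eq : Fbarplus G R c b = oddDown (z G R c b) := rfl

theorem Fminus_eq : Fminus G R c b = (2 : ℂ) • oddUp (zeta G R c b) := rfl

theorem Fbarminus_eq : Fbarminus G R c b = (2 : ℂ) • oddDown (zetabar G R c b) := rfl

theorem mul_self_eq_zero_of_add {A : Type*} [Ring A] [Algebra ℂ A] {x : A}
    (h : x * x + x * x = 0) : x * x = 0 := by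
  rw [← two_smul ℂ] at h
  exact (smul_eq_zero.1 h).resolve_left two_ne_zero

theorem Fplus_mul_self : Fplus G R c b * Fplus G R c b = 0 :=
  mul_self_eq_zero_of_add (oddUp_mul_oddUp_add _ _ fun j k => by
    rw [comm_zbar_zbar, comm_zbar_zbar])

theorem Fbarplus_mul_self : Fbarplus G R c b * Fbarplus G R c b = 0 :=
  mul_self_eq_zero_of_add (oddDown_mul_oddDown_add _ _ fun j k => by
    rw [comm_z_z, comm_z_z])

theorem Fminus_mul_self : Fminus G R c b * Fminus G R c b = 0 := by
  have h := mul_self_eq_zero_of_add (oddUp_mul_oddUp_add (zeta G R c b) (zeta G R c b)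
    fun j k => by rw [comm_zeta_zeta, comm_zeta_zeta])
  rw [Fminus_eq, smul_mul_assoc, mul_smul_comm, h, smul_zero, smul_zero]

theorem Fbarminus_mul_self : Fbarminus G R c b * Fbarminus G R c b = 0 := by
  have h := mul_self_eq_zero_of_add (oddDown_mul_oddDown_add (zetabar G R c b) (zetabar G R c b)
    fun j k => by rw [comm_zetabar_zetabar, comm_zetabar_zetabar])
  rw [Fbarminus_eq, smul_mul_assoc, mul_smul_comm, h, smul_zero, smul_zero]

theorem Fminus_mul_Fplus_add :
    Fminus G R c b * Fplus G R c b + Fplus G R c b * Fminus G R c b = 0 := by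
  have h := oddUp_mul_oddUp_add (zeta G R c b) (zbar G R c b) fun j k => by
    rw [comm_zeta_zbar, comm_zeta_zbar]
    simp only [mul_comm (zbarCoord b _ j)]
  rw [Fminus_eq, Fplus_eq, smul_mul_assoc, mul_smul_comm, ← smul_add, h, smul_zero]

theorem Fbarminus_mul_Fbarplus_add :
    Fbarminus G R c b * Fbarplus G R c b + Fbarplus G R c b * Fbarminus G R c b = 0 := by
  have h := oddDown_mul_oddDown_add (zetabar G R c b) (z G R c b) fun j k => by
    rw [comm_zetabar_z, comm_zetabar_z]
    simp only [mul_comm (zCoord b _ j)]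
  rw [Fbarminus_eq, Fbarplus_eq, smul_mul_assoc, mul_smul_comm, ← smul_add, h, smul_zero]

/-- All `ζ`, `ζ̄` commute, so only the diagonal term of the anticommutator remains. This expresses
harmonicity by the odd operators. -/
theorem Fminus_mul_Fbarminus_add :
    Fminus G R c b * Fbarminus G R c b + Fbarminus G R c b * Fminus G R c b =
      (-2 : ℂ) • (Eminus G R c b ⊗ₜ[ℂ] (1 : Cliff n)) := by
  have h := oddUp_mul_oddDown_add (zeta G R c b) (zetabar G R c b)
  simp only [comm_zeta_zetabar, TensorProduct.zero_tmul, Finset.sum_const_zero, add_zero] at h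
  have h2 : ∑ j, zetabar G R c b j * zeta G R c b j = ∑ j, zeta G R c b j * zetabar G R c b j :=
    Finset.sum_congr rfl fun j _ => (sub_eq_zero.1 (comm_zeta_zetabar G R c b j j)).symm
  rw [Fminus_eq, Fbarminus_eq, smul_mul_assoc, smul_mul_assoc, mul_smul_comm, mul_smul_comm,
    ← smul_add, ← smul_add, h, h2, Eminus, ← TensorProduct.smul_tmul', smul_smul, smul_smul]
  norm_num

omit [Fintype G] in
theorem sharp_coroot {s : G} (hs : IsReflection (s : E ≃ₗᵢ[ℝ] E)) :
    ∃ t : ℝ, t ≠ 0 ∧ sharp b (R.coroot s) = t • R.root s ∧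
      R.coroot s (R.root s) = t * ‖R.root s‖ ^ 2 := by
  obtain ⟨t, ht, h⟩ := R.exists_coroot_eq hs
  refine ⟨t, ht, ?_, by rw [h, real_inner_self_eq_norm_sq]⟩
  rw [sharp]
  simp only [h, mul_smul, ← Finset.smul_sum]
  congr 1
  conv_rhs => rw [← b.sum_repr' (R.root s)]
  simp only [real_inner_comm]

/-- The scale of the coroot occurs once in the denominator and once in `π⁺(aₛ^⊤)`, hence cancels.
The second term matches the reflection part of the brackets `[ζ, z]`. -/
theorem smul_tauElt {s : G} (hs : s ∈ reflections G) : (c s : ℂ) • tauElt G R b s =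
    (c s : ℂ) • 1 - (weight G R c s : ℂ) • (piMinus b (R.root s) * piPlus b (R.root s)) := by
  have hs' : IsReflection (s : E ≃ₗᵢ[ℝ] E) := by simpa [reflections] using hs
  obtain ⟨t, ht, h1, h2⟩ := sharp_coroot G R b hs'
  have hpi : piPlus b (t • R.root s) = (t : ℂ) • piPlus b (R.root s) := by
    rw [piPlus, piPlus, Finset.smul_sum]
    refine Finset.sum_congr rfl fun j _ => ?_
    rw [smul_smul, map_smul, map_smul, smul_eq_mul, smul_eq_mul]
    congr 1; push_cast; ring
  have h0 : ‖R.root s‖ ≠ 0 := norm_ne_zero_iff.2 (R.root_ne_zero s hs')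
  rw [tauElt, h1, h2, hpi, mul_smul_comm, smul_sub, smul_smul, smul_smul, weight]
  congr 2
  have ht' : (t : ℂ) ≠ 0 := by exact_mod_cast ht
  have h0' : ((‖R.root s‖ : ℝ) : ℂ) ≠ 0 := by exact_mod_cast h0
  push_cast
  field_simp

theorem piMinus_mul_piPlus (v : E) : piMinus b v * piPlus b v =
    ∑ j, ∑ k, (zbarCoord b v j * zCoord b v k) • (fd n j * f n k) := by
  rw [piMinus, piPlus, Finset.sum_mul_sum]
  refine Finset.sum_congr rfl fun j _ => Finset.sum_congr rfl fun k _ => ?_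
  rw [smul_mul_smul_comm, zbarCoord, zCoord]

theorem Omega_eq : Omega G R c b =
    (∑ s ∈ reflections G, (c s : ℂ) • grp G R c s) ⊗ₜ[ℂ] (1 : Cliff n) -
      ∑ s ∈ reflections G, (weight G R c s : ℂ) •
        (grp G R c s ⊗ₜ[ℂ] (piMinus b (R.root s) * piPlus b (R.root s))) := by
  rw [Omega, TensorProduct.sum_tmul, ← Finset.sum_sub_distrib]
  refine Finset.sum_congr rfl fun s hs => ?_
  rw [← TensorProduct.tmul_smul, smul_tauElt G R c b hs, TensorProduct.tmul_sub,
    TensorProduct.tmul_smul, TensorProduct.tmul_smul, ← TensorProduct.smul_tmul']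

theorem sum_smul_grp_tmul (w : G → ℂ) :
    ∑ j, ∑ k, (∑ s ∈ reflections G, (w s * (zbarCoord b (R.root s) j * zCoord b (R.root s) k)) •
        grp G R c s) ⊗ₜ[ℂ] (fd n j * f n k) =
      ∑ s ∈ reflections G, w s •
        (grp G R c s ⊗ₜ[ℂ] (piMinus b (R.root s) * piPlus b (R.root s))) := by
  simp only [piMinus_mul_piPlus, TensorProduct.tmul_sum, TensorProduct.sum_tmul, Finset.smul_sum,
    TensorProduct.tmul_smul, ← TensorProduct.smul_tmul', smul_smul]
  conv_rhs => rw [Finset.sum_comm]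
  refine Finset.sum_congr rfl fun j _ => ?_
  rw [Finset.sum_comm]

theorem two_smul_Z₂ : (2 : ℂ) • Z₂ G R c n =
    (2 : ℂ) • ((1 : RCA G R c) ⊗ₜ[ℂ] ∑ j : Fin n, fd n j * f n j) -
      (n : ℂ) • (1 : RCA G R c ⊗[ℂ] Cliff n) := by
  have h : ∑ j : Fin n, (fd n j * f n j - f n j * fd n j) =
      (2 : ℂ) • ∑ j : Fin n, fd n j * f n j - (n : ℂ) • 1 := by
    have : ∀ j : Fin n, fd n j * f n j - f n j * fd n j = (2 : ℂ) • (fd n j * f n j) - 1 := by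
      intro j
      have := f_mul_fd_add j j
      rw [if_pos rfl] at this
      rw [← this, two_smul]; abel
    simp only [this, Finset.sum_sub_distrib, Finset.smul_sum]
    simp [Algebra.smul_def]
  rw [Z₂, h, ← TensorProduct.tmul_smul, smul_smul, TensorProduct.tmul_smul, TensorProduct.tmul_sub,
    TensorProduct.tmul_smul, TensorProduct.tmul_smul, Algebra.TensorProduct.one_def]
  norm_num

theorem HH_eq : HH G R c b =
    (∑ j, z G R c b j * zeta G R c b j) ⊗ₜ[ℂ] (1 : Cliff n) +
      (∑ j, zbar G R c b j * zetabar G R c b j) ⊗ₜ[ℂ] (1 : Cliff n) +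
      (n : ℂ) • (1 : RCA G R c ⊗[ℂ] Cliff n) -
      (∑ s ∈ reflections G, (c s : ℂ) • grp G R c s) ⊗ₜ[ℂ] (1 : Cliff n) := by
  rw [HH, Hop, TensorProduct.sub_tmul, TensorProduct.add_tmul, Finset.sum_add_distrib,
    TensorProduct.add_tmul, Algebra.algebraMap_eq_smul_one, ← TensorProduct.smul_tmul',
    ← Algebra.TensorProduct.one_def]

theorem ZZ_eq : ZZ G R c b =
    (2 : ℂ) • ((1 : RCA G R c) ⊗ₜ[ℂ] ∑ j : Fin n, fd n j * f n j) -
      (n : ℂ) • (1 : RCA G R c ⊗[ℂ] Cliff n) -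
      ((∑ j, zbar G R c b j * zetabar G R c b j) ⊗ₜ[ℂ] (1 : Cliff n) -
        (∑ j, z G R c b j * zeta G R c b j) ⊗ₜ[ℂ] (1 : Cliff n) -
        ((∑ s ∈ reflections G, (c s : ℂ) • grp G R c s) ⊗ₜ[ℂ] (1 : Cliff n) -
          ∑ s ∈ reflections G, (weight G R c s : ℂ) •
            (grp G R c s ⊗ₜ[ℂ] (piMinus b (R.root s) * piPlus b (R.root s))))) := by
  rw [ZZ, two_smul_Z₂, Z₁, Omega_eq, Zzero, Finset.sum_sub_distrib, TensorProduct.sub_tmul]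

theorem sum_ite_smul_one_tmul :
    ∑ j, ∑ k, ((if j = k then 1 else 0 : ℂ) • (1 : RCA G R c)) ⊗ₜ[ℂ] (fd n j * f n k) =
      (1 : RCA G R c) ⊗ₜ[ℂ] ∑ j : Fin n, fd n j * f n j := by
  rw [TensorProduct.tmul_sum]
  refine Finset.sum_congr rfl fun j _ => ?_
  rw [Finset.sum_eq_single j (fun k _ hk => by
    rw [if_neg (Ne.symm hk), zero_smul, TensorProduct.zero_tmul]) (by simp), if_pos rfl, one_smul]

theorem sum_half_weight : ∑ s ∈ reflections G, (weight G R c s / 2 : ℂ) •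
      (grp G R c s ⊗ₜ[ℂ] (piMinus b (R.root s) * piPlus b (R.root s))) =
    (1 / 2 : ℂ) • ∑ s ∈ reflections G, (weight G R c s : ℂ) •
      (grp G R c s ⊗ₜ[ℂ] (piMinus b (R.root s) * piPlus b (R.root s))) := by
  rw [Finset.smul_sum]
  refine Finset.sum_congr rfl fun s _ => ?_
  rw [smul_smul]
  congr 1
  ring

/-- Both sides are `2 ∑ zⱼζⱼ + 2 ∑ fⱼ†fⱼ` minus the root part of `Ω_c`: in `H + Z` the constants
`n`, the terms `z̄ⱼζ̄ⱼ` and the two copies of `∑ c(s) s` cancel. -/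
theorem Fminus_mul_Fbarplus_add :
    Fminus G R c b * Fbarplus G R c b + Fbarplus G R c b * Fminus G R c b =
      HH G R c b + ZZ G R c b := by
  have h := oddUp_mul_oddDown_add (zeta G R c b) (z G R c b)
  simp only [comm_zeta_z, TensorProduct.sub_tmul, Finset.sum_sub_distrib, sum_smul_grp_tmul,
    sum_ite_smul_one_tmul, sum_half_weight] at h
  rw [Fminus_eq, Fbarplus_eq, smul_mul_assoc, mul_smul_comm, ← smul_add, h, HH_eq, ZZ_eq]
  module

/-- The trace of the bracket collapses because `∑ⱼ ⟨z̄ⱼ, αₛ⟩⟨zⱼ, αₛ⟩ = ‖αₛ‖²`, and half the weight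
times this is `c(s)`. -/
theorem sum_zetabar_mul_zbar : ∑ j, zetabar G R c b j * zbar G R c b j =
    ∑ j, zbar G R c b j * zetabar G R c b j + (n : ℂ) • (1 : RCA G R c) -
      ∑ s ∈ reflections G, (c s : ℂ) • grp G R c s := by
  have h : ∀ j, zetabar G R c b j * zbar G R c b j = zbar G R c b j * zetabar G R c b j +
      comm (zetabar G R c b j) (zbar G R c b j) := fun j => by rw [comm]; abel
  simp only [h, comm_zetabar_zbar, Finset.sum_add_distrib, Finset.sum_sub_distrib, if_true,
    one_smul]
  rw [Finset.sum_comm, add_sub_assoc]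
  congr 2
  · simp [Algebra.smul_def]
  · refine Finset.sum_congr rfl fun s hs => ?_
    have hs' : IsReflection (s : E ≃ₗᵢ[ℝ] E) := by simpa [reflections] using hs
    have h0 : ((‖R.root s‖ : ℝ) : ℂ) ≠ 0 := by
      exact_mod_cast norm_ne_zero_iff.2 (R.root_ne_zero s hs')
    rw [← Finset.sum_smul, ← Finset.mul_sum, sum_zbarCoord_mul_zCoord, weight]
    congr 1
    push_cast
    field_simp

theorem Fplus_mul_Fbarminus_add :
    Fplus G R c b * Fbarminus G R c b + Fbarminus G R c b * Fplus G R c b =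
      HH G R c b - ZZ G R c b := by
  have h := oddUp_mul_oddDown_add (zbar G R c b) (zetabar G R c b)
  have hcomm : ∀ j k, comm (zbar G R c b j) (zetabar G R c b k) =
      ∑ s ∈ reflections G, ((weight G R c s / 2 : ℂ) *
        (zbarCoord b (R.root s) j * zCoord b (R.root s) k)) • grp G R c s -
      (if j = k then 1 else 0 : ℂ) • (1 : RCA G R c) := by
    intro j k
    rw [comm_swap, comm_zetabar_zbar, neg_sub]
    simp only [eq_comm]
  simp only [hcomm, TensorProduct.sub_tmul, Finset.sum_sub_distrib, sum_smul_grp_tmul,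
    sum_ite_smul_one_tmul, sum_half_weight, sum_zetabar_mul_zbar] at h
  rw [Fplus_eq, Fbarminus_eq, smul_mul_assoc, mul_smul_comm, ← smul_add, h, HH_eq, ZZ_eq,
    TensorProduct.add_tmul, ← TensorProduct.smul_tmul', ← Algebra.TensorProduct.one_def]
  module

/-! ### The even operators -/

theorem comm_tmul_one_oddUp {A : Type*} [Ring A] [Algebra ℂ A] (h : A) (a : Fin n → A) :
    comm (h ⊗ₜ[ℂ] (1 : Cliff n)) (oddUp a) = oddUp fun j => comm h (a j) := by
  simp only [comm, oddUp, Finset.mul_sum, Finset.sum_mul, Algebra.TensorProduct.tmul_mul_tmul,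
    one_mul, mul_one, TensorProduct.sub_tmul, Finset.sum_sub_distrib]

theorem comm_tmul_one_oddDown {A : Type*} [Ring A] [Algebra ℂ A] (h : A) (a : Fin n → A) :
    comm (h ⊗ₜ[ℂ] (1 : Cliff n)) (oddDown a) = oddDown fun j => comm h (a j) := by
  simp only [comm, oddDown, Finset.mul_sum, Finset.sum_mul, Algebra.TensorProduct.tmul_mul_tmul,
    one_mul, mul_one, TensorProduct.sub_tmul, Finset.sum_sub_distrib]

theorem comm_Hop_combination (x y : Module.Dual ℝ E) (r : ℂ) :
    comm (Hop G R c b) (covec G R c x + r • covec G R c y) =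
      covec G R c x + r • covec G R c y := by
  rw [comm_add_right, comm_smul_right, comm_Hop_covec, comm_Hop_covec]

theorem comm_Hop_vec_combination (ξ η : E) (r : ℂ) :
    comm (Hop G R c b) (vec G R c ξ + r • vec G R c η) =
      -(vec G R c ξ + r • vec G R c η) := by
  rw [comm_add_right, comm_smul_right, comm_Hop_vec, comm_Hop_vec, smul_neg, neg_add]

theorem comm_HH_Fplus : comm (HH G R c b) (Fplus G R c b) = Fplus G R c b := by
  rw [HH, Fplus_eq, comm_tmul_one_oddUp]
  congr 1; funext j
  rw [zbar_eq, comm_Hop_combination]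

theorem comm_HH_Fbarplus : comm (HH G R c b) (Fbarplus G R c b) = Fbarplus G R c b := by
  rw [HH, Fbarplus_eq, comm_tmul_one_oddDown]
  congr 1; funext j
  rw [z, comm_Hop_combination]

theorem comm_HH_Fminus : comm (HH G R c b) (Fminus G R c b) = -Fminus G R c b := by
  rw [HH, Fminus_eq, comm_smul_right, comm_tmul_one_oddUp, ← smul_neg]
  congr 1
  rw [oddUp, oddUp, ← Finset.sum_neg_distrib]
  refine Finset.sum_congr rfl fun j _ => ?_
  rw [zeta_eq, comm_smul_right, comm_Hop_vec_combination, smul_neg, TensorProduct.neg_tmul]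

theorem comm_HH_Fbarminus : comm (HH G R c b) (Fbarminus G R c b) = -Fbarminus G R c b := by
  rw [HH, Fbarminus_eq, comm_smul_right, comm_tmul_one_oddDown, ← smul_neg]
  congr 1
  rw [oddDown, oddDown, ← Finset.sum_neg_distrib]
  refine Finset.sum_congr rfl fun j _ => ?_
  rw [zetabar, comm_smul_right, comm_Hop_vec_combination, smul_neg, TensorProduct.neg_tmul]

theorem comm_two_smul_Z₂_oddUp (a : Fin n → RCA G R c) :
    comm ((2 : ℂ) • Z₂ G R c n) (oddUp a) = (2 : ℂ) • oddUp a := by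
  have h1 : comm ((n : ℂ) • (1 : RCA G R c ⊗[ℂ] Cliff n)) (oddUp a) = 0 := by
    rw [comm_smul_left, comm, one_mul, mul_one, sub_self, smul_zero]
  rw [two_smul_Z₂, comm_sub_left, h1, sub_zero, comm_smul_left]
  congr 1
  conv_rhs => rw [oddUp]
  have h2 := comm_number_fd (n := n)
  generalize ∑ j : Fin n, fd n j * f n j = N at h2 ⊢
  simp only [comm] at h2
  simp only [comm, oddUp, Finset.mul_sum, Finset.sum_mul, Algebra.TensorProduct.tmul_mul_tmul,
    one_mul, mul_one]
  rw [← Finset.sum_sub_distrib]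
  refine Finset.sum_congr rfl fun k _ => ?_
  rw [← TensorProduct.tmul_sub, h2]

theorem comm_two_smul_Z₂_oddDown (a : Fin n → RCA G R c) :
    comm ((2 : ℂ) • Z₂ G R c n) (oddDown a) = -((2 : ℂ) • oddDown a) := by
  have h1 : comm ((n : ℂ) • (1 : RCA G R c ⊗[ℂ] Cliff n)) (oddDown a) = 0 := by
    rw [comm_smul_left, comm, one_mul, mul_one, sub_self, smul_zero]
  rw [two_smul_Z₂, comm_sub_left, h1, sub_zero, comm_smul_left, ← smul_neg]
  congr 1
  conv_rhs => rw [oddDown, ← Finset.sum_neg_distrib]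
  have h2 := comm_number_f (n := n)
  generalize ∑ j : Fin n, fd n j * f n j = N at h2 ⊢
  simp only [comm] at h2
  simp only [comm, oddDown, Finset.mul_sum, Finset.sum_mul, Algebra.TensorProduct.tmul_mul_tmul,
    one_mul, mul_one]
  rw [← Finset.sum_sub_distrib]
  refine Finset.sum_congr rfl fun k _ => ?_
  rw [← TensorProduct.tmul_sub, h2, TensorProduct.tmul_neg]

/-- An anticommutator `{x, y}` commutes with `x` if `x² = 0`. -/
theorem comm_anticomm_self {A : Type*} [Ring A] {x : A} (y : A) (h : x * x = 0) :
    comm (x * y + y * x) x = 0 := by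
  have : comm (x * y + y * x) x = y * (x * x) - (x * x) * y := by rw [comm]; noncomm_ring
  rw [this, h, mul_zero, zero_mul, sub_zero]

theorem Z₁_eq : Z₁ G R c b = (2 : ℂ) • Z₂ G R c n - ZZ G R c b := by
  rw [ZZ, sub_sub_cancel]

/-- As `F₊² = 0`, the anticommutator `H - Z` of `F₊` with `F̄₋` commutes with `F₊`, so `[Z, F₊] =
[H, F₊]`. The other three brackets arise in the same way. -/
theorem comm_ZZ_Fplus : comm (ZZ G R c b) (Fplus G R c b) = Fplus G R c b := by
  have h := comm_anticomm_self (Fbarminus G R c b) (Fplus_mul_self G R c b)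
  rw [Fplus_mul_Fbarminus_add, comm_sub_left, comm_HH_Fplus, sub_eq_zero] at h
  exact h.symm

theorem comm_ZZ_Fbarplus : comm (ZZ G R c b) (Fbarplus G R c b) = -Fbarplus G R c b := by
  have h := comm_anticomm_self (Fminus G R c b) (Fbarplus_mul_self G R c b)
  rw [add_comm, Fminus_mul_Fbarplus_add, comm_add_left, comm_HH_Fbarplus] at h
  exact eq_neg_of_add_eq_zero_right h

theorem comm_ZZ_Fminus : comm (ZZ G R c b) (Fminus G R c b) = Fminus G R c b := by
  have h := comm_anticomm_self (Fbarplus G R c b) (Fminus_mul_self G R c b)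
  rw [Fminus_mul_Fbarplus_add, comm_add_left, comm_HH_Fminus, neg_add_eq_zero] at h
  exact h.symm

theorem comm_ZZ_Fbarminus : comm (ZZ G R c b) (Fbarminus G R c b) = -Fbarminus G R c b := by
  have h := comm_anticomm_self (Fplus G R c b) (Fbarminus_mul_self G R c b)
  rw [add_comm, Fplus_mul_Fbarminus_add, comm_sub_left, comm_HH_Fbarminus, sub_eq_zero] at h
  exact h.symm

theorem comm_Z₁_Fplus : comm (Z₁ G R c b) (Fplus G R c b) = Fplus G R c b := by
  rw [Z₁_eq, comm_sub_left, comm_ZZ_Fplus, Fplus_eq, comm_two_smul_Z₂_oddUp, two_smul,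
    add_sub_cancel_right]

theorem comm_Z₁_Fminus : comm (Z₁ G R c b) (Fminus G R c b) = Fminus G R c b := by
  rw [Z₁_eq, comm_sub_left, comm_ZZ_Fminus, Fminus_eq, comm_smul_right, comm_two_smul_Z₂_oddUp]
  module

theorem comm_Z₁_Fbarplus : comm (Z₁ G R c b) (Fbarplus G R c b) = -Fbarplus G R c b := by
  rw [Z₁_eq, comm_sub_left, comm_ZZ_Fbarplus, Fbarplus_eq, comm_two_smul_Z₂_oddDown]
  module

theorem comm_Z₁_Fbarminus : comm (Z₁ G R c b) (Fbarminus G R c b) = -Fbarminus G R c b := by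
  rw [Z₁_eq, comm_sub_left, comm_ZZ_Fbarminus, Fbarminus_eq, comm_smul_right,
    comm_two_smul_Z₂_oddDown]
  module

end Superalgebra

/-! ### Schur's lemma for the sum of the reflections. -/

section Schur

variable {E : Type*} [NormedAddCommGroup E] [InnerProductSpace ℝ E]

open scoped InnerProductSpace

theorem IsReflection.conj {s : E ≃ₗᵢ[ℝ] E} (hs : IsReflection s) (g : E ≃ₗᵢ[ℝ] E) :
    IsReflection (g * s * g⁻¹) := by
  obtain ⟨α, hα, rfl⟩ := hs
  refine ⟨g α, by simpa using hα, LinearIsometryEquiv.ext fun v => ?_⟩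
  have h : ⟪α, g⁻¹ v⟫_ℝ = ⟪g α, v⟫_ℝ := by
    rw [← g.inner_map_map]
    congr 1
    exact g.apply_symm_apply v
  change g ((ℝ ∙ α)ᗮ.reflection (g⁻¹ v)) = _
  rw [Submodule.reflection_orthogonal_apply, Submodule.reflection_orthogonal_apply,
    Submodule.reflection_singleton_apply, Submodule.reflection_singleton_apply, h]
  simp

variable (G : Subgroup (E ≃ₗᵢ[ℝ] E)) [Fintype G] (c : G → ℝ)
  {V : Type*} [AddCommGroup V] [Module ℂ V] (τ : Representation ℂ G V)

omit [Fintype G] in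
theorem isReflection_conj_iff (g s : G) :
    IsReflection ((g * s * g⁻¹ : G) : E ≃ₗᵢ[ℝ] E) ↔ IsReflection (s : E ≃ₗᵢ[ℝ] E) := by
  refine ⟨fun h => ?_, fun h => h.conj g⟩
  have := h.conj (g⁻¹ : G)
  rw [← Subgroup.coe_inv, ← Subgroup.coe_mul, ← Subgroup.coe_mul] at this
  convert this using 2
  group

theorem reflection_sum_commute (hc : IsConjInvariant G c) (g : G) :
    τ g * ∑ s ∈ reflections G, (c s : ℂ) • τ s =
      (∑ s ∈ reflections G, (c s : ℂ) • τ s) * τ g := by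
  rw [Finset.mul_sum, Finset.sum_mul]
  refine Finset.sum_equiv (MulAut.conj g).toEquiv (fun s => ?_) fun s hs => ?_
  · simpa [reflections] using (isReflection_conj_iff G g s).symm
  · have hs' : IsReflection (s : E ≃ₗᵢ[ℝ] E) := by simpa [reflections] using hs
    have e : (MulAut.conj g).toEquiv s = g * s * g⁻¹ := rfl
    rw [e, hc s hs' g, mul_smul_comm, smul_mul_assoc, ← map_mul, ← map_mul, inv_mul_cancel_right]

omit [Fintype G] in
variable {G τ} in
theorem nontrivial_of_isIrreducible (hτ : τ.IsIrreducible) : Nontrivial V := by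
  by_contra h
  rw [not_nontrivial_iff_subsingleton] at h
  have : (⊥ : Subrepresentation τ) = ⊤ := by
    ext v
    simp [Subsingleton.elim v 0]
  exact bot_ne_top this

-- The finite orbit of a non-zero vector spans an invariant subspace, hence everything.
variable {G τ} in
theorem finiteDimensional_of_isIrreducible (hτ : τ.IsIrreducible) : FiniteDimensional ℂ V := by
  have := nontrivial_of_isIrreducible hτ
  obtain ⟨v, hv⟩ := exists_ne (0 : V)
  let W : Subrepresentation τ :=
    { toSubmodule := Submodule.span ℂ (Set.range fun g => τ g v)
      apply_mem_toSubmodule := by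
        intro g w hw
        induction hw using Submodule.span_induction with
        | mem w hw =>
          obtain ⟨h, rfl⟩ := hw
          exact Submodule.subset_span ⟨g * h, by simp⟩
        | zero => simp
        | add x y _ _ hx hy => rw [map_add]; exact Submodule.add_mem _ hx hy
        | smul r x _ hx => rw [map_smul]; exact Submodule.smul_mem _ _ hx }
  have hvW : v ∈ W.toSubmodule := Submodule.subset_span ⟨1, by simp⟩
  have hW : W = ⊤ := by
    rcases eq_bot_or_eq_top W with h | h
    · rw [h] at hvW
      exact absurd hvW hv
    · exact h
  have hW' : Submodule.span ℂ (Set.range fun g => τ g v) = ⊤ :=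
    congrArg Subrepresentation.toSubmodule hW
  exact ⟨hW' ▸ Submodule.fg_span (Set.finite_range _)⟩

/-- Conjugation permutes the reflections and preserves `c`, so the sum is an intertwiner and
therefore a scalar; its trace over the non-zero dimension identifies the scalar. -/
theorem reflection_sum_apply (hc : IsConjInvariant G c) (hτ : τ.IsIrreducible) (v : V) :
    ∑ s ∈ reflections G, (c s : ℂ) • τ s v = centralScalar G c τ • v := by
  have := finiteDimensional_of_isIrreducible hτ
  have := nontrivial_of_isIrreducible hτ
  set T := ∑ s ∈ reflections G, (c s : ℂ) • τ s with hT
  let f : Representation.IntertwiningMap τ τ :=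
    { toLinearMap := T
      isIntertwining' := fun g => (reflection_sum_commute G c τ hc g).symm }
  obtain ⟨r, hr⟩ :=
    (Representation.IsIrreducible.algebraMap_intertwiningMap_bijective_of_isAlgClosed).2 f
  have hTr : T = r • LinearMap.id := by
    have := congrArg Representation.IntertwiningMap.toLinearMap hr
    exact this.symm
  have hV : (Module.finrank ℂ V : ℂ) ≠ 0 :=
    Nat.cast_ne_zero.2 Module.finrank_pos.ne'
  have hcs : centralScalar G c τ = r := by
    rw [centralScalar, ← hT, hTr, map_smul, LinearMap.trace_id, smul_eq_mul,
      mul_div_cancel_right₀ _ hV]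
  rw [hcs]
  have := LinearMap.congr_fun hTr v
  simpa [hT] using this

end Schur

/-! ### The graded standard module, its spinors and their form. -/

section StandardModule

variable {E : Type*} [NormedAddCommGroup E] [InnerProductSpace ℝ E]
  (G : Subgroup (E ≃ₗᵢ[ℝ] E)) [Fintype G] (R : RootChoice G) (c : G → ℝ)
  {n : ℕ} (b : OrthonormalBasis (Fin n ⊕ Fin n) ℝ E)
  {V : Type*} [AddCommGroup V] [Module ℂ V] (τ : Representation ℂ G V)

theorem smul_lowest (h : RCA G R c) (v : V) :
    h • lowest G R c τ v = Submodule.Quotient.mk (h ⊗ₜ[ℂ] v) := by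
  rw [lowest, ← Submodule.Quotient.mk_smul, TensorProduct.smul_tmul', smul_eq_mul, mul_one]

theorem grp_smul_lowest (g : G) (v : V) :
    grp G R c g • lowest G R c τ v = lowest G R c τ (τ g v) := by
  rw [smul_lowest, lowest, Submodule.Quotient.eq]
  exact Submodule.subset_span (Or.inl ⟨g, v, rfl⟩)

theorem vec_smul_lowest (ξ : E) (v : V) : vec G R c ξ • lowest G R c τ v = 0 := by
  rw [smul_lowest, Submodule.Quotient.mk_eq_zero]
  exact Submodule.subset_span (Or.inr ⟨ξ, v, rfl⟩)

theorem lowest_smul (r : ℂ) (v : V) : lowest G R c τ (r • v) = r • lowest G R c τ v := by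
  rw [lowest, TensorProduct.tmul_smul, Submodule.Quotient.mk_smul, lowest]

theorem lowest_sum {ι : Type*} (S : Finset ι) (v : ι → V) :
    lowest G R c τ (∑ i ∈ S, v i) = ∑ i ∈ S, lowest G R c τ (v i) := by
  simp only [lowest, TensorProduct.tmul_sum]
  exact map_sum (Submodule.mkQ (standardRelations G R c τ)) _ _

/-- The element `x₁ ⋯ x_k ⊗ v` of the standard module. -/
def word (xs : List (Module.Dual ℝ E)) (v : V) : StandardModule G R c τ :=
  (xs.map (covec G R c)).prod • lowest G R c τ v

theorem word_nil (v : V) : word G R c τ [] v = lowest G R c τ v := by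
  rw [word, List.map_nil, List.prod_nil, one_smul]

theorem word_cons (x : Module.Dual ℝ E) (xs : List (Module.Dual ℝ E)) (v : V) :
    word G R c τ (x :: xs) v = covec G R c x • word G R c τ xs v := by
  rw [word, List.map_cons, List.prod_cons, mul_smul, word]

theorem word_mem (xs : List (Module.Dual ℝ E)) (v : V) :
    word G R c τ xs v ∈ degreePart G R c τ xs.length :=
  Submodule.subset_span ⟨xs, v, rfl, rfl⟩

theorem smul_mem_degreePart (h : RCA G R c) {k k' : ℤ}
    (hw : ∀ (xs : List (Module.Dual ℝ E)) (v : V), (xs.length : ℤ) = k →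
      h • word G R c τ xs v ∈ degreePart G R c τ k') {p : StandardModule G R c τ}
    (hp : p ∈ degreePart G R c τ k) : h • p ∈ degreePart G R c τ k' := by
  induction hp using Submodule.span_induction with
  | mem p hp =>
    obtain ⟨xs, v, hk, rfl⟩ := hp
    exact hw xs v hk
  | zero => rw [smul_zero]; exact Submodule.zero_mem _
  | add p q _ _ hp hq => rw [smul_add]; exact Submodule.add_mem _ hp hq
  | smul r p _ hp => rw [smul_comm]; exact Submodule.smul_mem _ _ hp

theorem covec_smul_mem (x : Module.Dual ℝ E) {k : ℤ} {p : StandardModule G R c τ}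
    (hp : p ∈ degreePart G R c τ k) : covec G R c x • p ∈ degreePart G R c τ (k + 1) := by
  refine smul_mem_degreePart G R c τ _ (fun xs v hk => ?_) hp
  rw [← word_cons]
  have := word_mem G R c τ (x :: xs) v
  rwa [List.length_cons, Nat.cast_succ, hk] at this

theorem grp_smul_mem (g : G) {k : ℤ} {p : StandardModule G R c τ}
    (hp : p ∈ degreePart G R c τ k) : grp G R c g • p ∈ degreePart G R c τ k := by
  refine smul_mem_degreePart G R c τ _ (fun xs v hk => ?_) hp
  clear hp
  subst hk
  induction xs with
  | nil =>
    rw [word_nil, grp_smul_lowest, ← word_nil]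
    exact word_mem G R c τ [] _
  | cons x xs ih =>
    rw [word_cons, ← mul_smul, grp_mul_covec, mul_smul, List.length_cons, Nat.cast_succ]
    exact covec_smul_mem G R c τ _ ih

/-- Moving `ξ` to the right through a word costs commutators made of scalars and group elements,
which preserve degree; at the end `ξ` kills the lowest vector. -/
theorem vec_smul_mem (ξ : E) {k : ℤ} {p : StandardModule G R c τ}
    (hp : p ∈ degreePart G R c τ k) : vec G R c ξ • p ∈ degreePart G R c τ (k - 1) := by
  refine smul_mem_degreePart G R c τ _ (fun xs v hk => ?_) hp
  clear hp
  subst hk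
  induction xs with
  | nil =>
    rw [word_nil, vec_smul_lowest]
    exact Submodule.zero_mem _
  | cons x xs ih =>
    have e : vec G R c ξ * covec G R c x = covec G R c x * vec G R c ξ +
        comm (vec G R c ξ) (covec G R c x) := by rw [comm]; abel
    rw [word_cons, ← mul_smul, e, comm_vec_covec, add_smul, sub_smul, mul_smul, Finset.sum_smul,
      List.length_cons, Nat.cast_succ, add_sub_cancel_right]
    have hx := covec_smul_mem G R c τ x ih
    rw [sub_add_cancel] at hx
    have hxs := word_mem G R c τ xs v
    refine Submodule.add_mem _ hx (Submodule.sub_mem _ ?_ (Submodule.sum_mem _ fun s _ => ?_))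
    · rw [algebraMap_smul]
      exact Submodule.smul_mem _ _ hxs
    · rw [smul_assoc]
      exact Submodule.smul_mem _ _ (grp_smul_mem G R c τ s hxs)

theorem Hop_smul_word (hc : IsConjInvariant G c) (hτ : τ.IsIrreducible)
    (xs : List (Module.Dual ℝ E)) (v : V) : Hop G R c b • word G R c τ xs v =
      ((xs.length : ℂ) + n - centralScalar G c τ) • word G R c τ xs v := by
  induction xs with
  | nil =>
    have h1 : (∑ i, covec G R c (b.toBasis.coord i) * vec G R c (b i)) • lowest G R c τ v = 0 := by
      rw [Finset.sum_smul]
      exact Finset.sum_eq_zero fun i _ => by rw [mul_smul, vec_smul_lowest, smul_zero]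
    have h2 : (∑ s ∈ reflections G, (c s : ℂ) • grp G R c s) • lowest G R c τ v =
        centralScalar G c τ • lowest G R c τ v := by
      rw [← lowest_smul, ← reflection_sum_apply G c τ hc hτ, lowest_sum, Finset.sum_smul]
      refine Finset.sum_congr rfl fun s _ => ?_
      rw [smul_assoc, grp_smul_lowest, lowest_smul]
    rw [word_nil, Hop_eq, sub_smul, add_smul, h1, h2, algebraMap_smul, zero_add, ← sub_smul]
    simp
  | cons x xs ih =>
    have e : Hop G R c b * covec G R c x = covec G R c x * Hop G R c b + covec G R c x := by
      rw [← sub_eq_iff_eq_add']; exact comm_Hop_covec G R c b x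
    rw [word_cons, ← mul_smul, e, add_smul, mul_smul, ih,
      smul_comm (covec G R c x) (_ : ℂ) (word G R c τ xs v), List.length_cons, Nat.cast_succ]
    generalize covec G R c x • word G R c τ xs v = w
    module

theorem Hop_smul (hc : IsConjInvariant G c) (hτ : τ.IsIrreducible) {k : ℤ}
    {p : StandardModule G R c τ} (hp : p ∈ degreePart G R c τ k) :
    Hop G R c b • p = ((k : ℂ) + n - centralScalar G c τ) • p := by
  induction hp using Submodule.span_induction with
  | mem p hp =>
    obtain ⟨xs, v, rfl, rfl⟩ := hp
    exact_mod_cast Hop_smul_word G R c b τ hc hτ xs v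
  | zero => rw [smul_zero, smul_zero]
  | add p q _ _ hp hq => rw [smul_add, smul_add, hp, hq]
  | smul r p _ hp => rw [smul_comm, hp, smul_comm]

theorem degreePart_of_neg {k : ℤ} (hk : k < 0) : degreePart G R c τ k = ⊥ := by
  rw [degreePart, Submodule.span_eq_bot]
  rintro _ ⟨xs, v, rfl, -⟩
  omega

theorem z_smul_mem (j : Fin n) {k : ℤ} {p : StandardModule G R c τ}
    (hp : p ∈ degreePart G R c τ k) : z G R c b j • p ∈ degreePart G R c τ (k + 1) := by
  rw [z, add_smul, smul_assoc]
  exact Submodule.add_mem _ (covec_smul_mem G R c τ _ hp)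
    (Submodule.smul_mem _ _ (covec_smul_mem G R c τ _ hp))

theorem zbar_smul_mem (j : Fin n) {k : ℤ} {p : StandardModule G R c τ}
    (hp : p ∈ degreePart G R c τ k) : zbar G R c b j • p ∈ degreePart G R c τ (k + 1) := by
  rw [zbar, sub_smul, smul_assoc]
  exact Submodule.sub_mem _ (covec_smul_mem G R c τ _ hp)
    (Submodule.smul_mem _ _ (covec_smul_mem G R c τ _ hp))

theorem zeta_smul_mem (j : Fin n) {k : ℤ} {p : StandardModule G R c τ}
    (hp : p ∈ degreePart G R c τ k) : zeta G R c b j • p ∈ degreePart G R c τ (k - 1) := by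
  rw [zeta, smul_assoc, sub_smul, smul_assoc]
  exact Submodule.smul_mem _ _ (Submodule.sub_mem _ (vec_smul_mem G R c τ _ hp)
    (Submodule.smul_mem _ _ (vec_smul_mem G R c τ _ hp)))

theorem zetabar_smul_mem (j : Fin n) {k : ℤ} {p : StandardModule G R c τ}
    (hp : p ∈ degreePart G R c τ k) : zetabar G R c b j • p ∈ degreePart G R c τ (k - 1) := by
  rw [zetabar, smul_assoc, add_smul, smul_assoc]
  exact Submodule.smul_mem _ _ (Submodule.add_mem _ (vec_smul_mem G R c τ _ hp)
    (Submodule.smul_mem _ _ (vec_smul_mem G R c τ _ hp)))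

/-- `M_c(τ)_k ⊗ 𝕊^l`. -/
def gradedPart (n : ℕ) (k l : ℤ) : Submodule ℂ (PolySpinor G R c τ n) :=
  LinearMap.range (TensorProduct.mapIncl (degreePart G R c τ k) (spinorDegree n l))

theorem act_tmul (h : RCA G R c) (g : Cliff n) (p : StandardModule G R c τ) (u : Spinor n) :
    act G R c τ n (h ⊗ₜ[ℂ] g) (p ⊗ₜ[ℂ] u) = (h • p) ⊗ₜ[ℂ] spinAction n g u := rfl

theorem gradedPart_induction {n : ℕ} {k l : ℤ} {P : PolySpinor G R c τ n → Prop}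
    (htmul : ∀ p ∈ degreePart G R c τ k, ∀ u ∈ spinorDegree n l, P (p ⊗ₜ[ℂ] u))
    (hadd : ∀ x y, P x → P y → P (x + y)) (h0 : P 0) {x : PolySpinor G R c τ n}
    (hx : x ∈ gradedPart G R c τ n k l) : P x := by
  obtain ⟨y, rfl⟩ := hx
  induction y using TensorProduct.induction_on with
  | zero => rwa [map_zero]
  | tmul p u => exact htmul p p.2 u u.2
  | add x y hx hy => rw [map_add]; exact hadd _ _ hx hy

theorem tmul_mem_gradedPart {k l : ℤ} {p : StandardModule G R c τ} {u : Spinor n}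
    (hp : p ∈ degreePart G R c τ k) (hu : u ∈ spinorDegree n l) :
    p ⊗ₜ[ℂ] u ∈ gradedPart G R c τ n k l := ⟨⟨p, hp⟩ ⊗ₜ ⟨u, hu⟩, rfl⟩

theorem act_oddUp_mem (a : Fin n → RCA G R c) {k k' l : ℤ}
    (ha : ∀ j, ∀ p ∈ degreePart G R c τ k, a j • p ∈ degreePart G R c τ k')
    {x : PolySpinor G R c τ n} (hx : x ∈ gradedPart G R c τ n k l) :
    act G R c τ n (oddUp a) x ∈ gradedPart G R c τ n k' (l + 1) := by
  refine gradedPart_induction G R c τ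
    (P := fun x => act G R c τ n (oddUp a) x ∈ gradedPart G R c τ n k' (l + 1))
    (fun p hp u hu => ?_) (fun x y hx hy => ?_) ?_ hx
  · rw [oddUp, map_sum, LinearMap.sum_apply]
    refine Submodule.sum_mem _ fun j _ => ?_
    rw [act_tmul, spinAction_fd]
    exact tmul_mem_gradedPart G R c τ (ha j p hp) (wedge_mem j hu)
  · rw [map_add]; exact Submodule.add_mem _ hx hy
  · rw [map_zero]; exact Submodule.zero_mem _

theorem act_oddDown_mem (a : Fin n → RCA G R c) {k k' l : ℤ}
    (ha : ∀ j, ∀ p ∈ degreePart G R c τ k, a j • p ∈ degreePart G R c τ k')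
    {x : PolySpinor G R c τ n} (hx : x ∈ gradedPart G R c τ n k l) :
    act G R c τ n (oddDown a) x ∈ gradedPart G R c τ n k' (l - 1) := by
  refine gradedPart_induction G R c τ
    (P := fun x => act G R c τ n (oddDown a) x ∈ gradedPart G R c τ n k' (l - 1))
    (fun p hp u hu => ?_) (fun x y hx hy => ?_) ?_ hx
  · rw [oddDown, map_sum, LinearMap.sum_apply]
    refine Submodule.sum_mem _ fun j _ => ?_
    rw [act_tmul, spinAction_f]
    exact tmul_mem_gradedPart G R c τ (ha j p hp) (contr_mem j hu)
  · rw [map_add]; exact Submodule.add_mem _ hx hy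
  · rw [map_zero]; exact Submodule.zero_mem _

theorem Fplus_mem {k l : ℤ} {x : PolySpinor G R c τ n} (hx : x ∈ gradedPart G R c τ n k l) :
    act G R c τ n (Fplus G R c b) x ∈ gradedPart G R c τ n (k + 1) (l + 1) :=
  act_oddUp_mem G R c τ _ (fun j _ hp => zbar_smul_mem G R c b τ j hp) hx

theorem Fbarplus_mem {k l : ℤ} {x : PolySpinor G R c τ n} (hx : x ∈ gradedPart G R c τ n k l) :
    act G R c τ n (Fbarplus G R c b) x ∈ gradedPart G R c τ n (k + 1) (l - 1) :=
  act_oddDown_mem G R c τ _ (fun j _ hp => z_smul_mem G R c b τ j hp) hx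

theorem Fminus_mem {k l : ℤ} {x : PolySpinor G R c τ n} (hx : x ∈ gradedPart G R c τ n k l) :
    act G R c τ n (Fminus G R c b) x ∈ gradedPart G R c τ n (k - 1) (l + 1) := by
  rw [Fminus_eq, map_smul]
  exact Submodule.smul_mem _ _
    (act_oddUp_mem G R c τ _ (fun j _ hp => zeta_smul_mem G R c b τ j hp) hx)

theorem Fbarminus_mem {k l : ℤ} {x : PolySpinor G R c τ n}
    (hx : x ∈ gradedPart G R c τ n k l) :
    act G R c τ n (Fbarminus G R c b) x ∈ gradedPart G R c τ n (k - 1) (l - 1) := by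
  rw [Fbarminus_eq, map_smul]
  exact Submodule.smul_mem _ _
    (act_oddDown_mem G R c τ _ (fun j _ hp => zetabar_smul_mem G R c b τ j hp) hx)

theorem act_HH (hc : IsConjInvariant G c) (hτ : τ.IsIrreducible) {k l : ℤ}
    {x : PolySpinor G R c τ n} (hx : x ∈ gradedPart G R c τ n k l) :
    act G R c τ n (HH G R c b) x = ((k : ℂ) + n - centralScalar G c τ) • x := by
  refine gradedPart_induction G R c τ
    (P := fun x => act G R c τ n (HH G R c b) x = ((k : ℂ) + n - centralScalar G c τ) • x)
    (fun p hp u _ => ?_) (fun x y hx hy => ?_) ?_ hx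
  · rw [HH, act_tmul, Hop_smul G R c b τ hc hτ hp, map_one, Module.End.one_apply,
      TensorProduct.smul_tmul']
  · rw [map_add, hx, hy, smul_add]
  · rw [map_zero, smul_zero]

theorem act_two_smul_Z₂ {k l : ℤ} {x : PolySpinor G R c τ n}
    (hx : x ∈ gradedPart G R c τ n k l) :
    act G R c τ n ((2 : ℂ) • Z₂ G R c n) x = (2 * (l : ℂ) - n) • x := by
  have hN : act G R c τ n ((1 : RCA G R c) ⊗ₜ[ℂ] ∑ j : Fin n, fd n j * f n j) x = (l : ℂ) • x := by
    refine gradedPart_induction G R c τ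
      (P := fun x => act G R c τ n ((1 : RCA G R c) ⊗ₜ[ℂ] ∑ j : Fin n, fd n j * f n j) x =
        (l : ℂ) • x)
      (fun p _ u hu => ?_) (fun x y hx hy => ?_) ?_ hx
    · have := number_apply_int hu
      rw [act_tmul, one_smul, map_sum, LinearMap.sum_apply]
      simp only [map_mul, spinAction_f, spinAction_fd, Module.End.mul_apply]
      rw [this, TensorProduct.tmul_smul]
    · rw [map_add, hx, hy, smul_add]
    · rw [map_zero, smul_zero]
  rw [two_smul_Z₂, map_sub, map_smul, map_smul, map_one, LinearMap.sub_apply,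
    LinearMap.smul_apply, LinearMap.smul_apply, hN, Module.End.one_apply, smul_smul, ← sub_smul]

theorem act_ZZ {k l : ℤ} {ν : ℂ} {x : PolySpinor G R c τ n} (hx : x ∈ gradedPart G R c τ n k l)
    (hν : act G R c τ n (Z₁ G R c b) x = ν • x) :
    act G R c τ n (ZZ G R c b) x = (2 * (l : ℂ) - n - ν) • x := by
  rw [ZZ, map_sub, LinearMap.sub_apply, act_two_smul_Z₂ G R c τ hx, hν]
  exact (sub_smul _ _ _).symm

/-- Flatness over a field, used twice: tensoring `Q ⊆ S` with `M` stays injective, so the kernel may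
be computed in `W ⊗ Q`, and tensoring with `Q` keeps the kernel sequence of `φ` on `W` exact. -/
theorem range_mapIncl_inf_ker {M S : Type*} [AddCommGroup M] [Module ℂ M] [AddCommGroup S]
    [Module ℂ S] (W : Submodule ℂ M) (Q : Submodule ℂ S) (φ : Module.End ℂ M) :
    LinearMap.range (TensorProduct.mapIncl (W ⊓ LinearMap.ker φ) Q) =
      LinearMap.range (TensorProduct.mapIncl W Q) ⊓
        LinearMap.ker (TensorProduct.map φ (LinearMap.id : S →ₗ[ℂ] S)) := by
  apply le_antisymm
  · rintro _ ⟨y, rfl⟩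
    induction y using TensorProduct.induction_on with
    | zero => rw [map_zero]; exact Submodule.zero_mem _
    | tmul p u =>
      refine ⟨⟨⟨p, p.2.1⟩ ⊗ₜ u, rfl⟩, ?_⟩
      have : φ p = 0 := p.2.2
      simp [TensorProduct.mapIncl, this]
    | add x y hx hy => rw [map_add]; exact Submodule.add_mem _ hx hy
  · rintro _ ⟨⟨y, rfl⟩, hy⟩
    rw [SetLike.mem_coe, LinearMap.mem_ker, TensorProduct.mapIncl, ← LinearMap.comp_apply,
      ← TensorProduct.map_comp, LinearMap.id_comp] at hy
    have hsplit : TensorProduct.map (φ ∘ₗ W.subtype) Q.subtype =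
        LinearMap.lTensor M Q.subtype ∘ₗ LinearMap.rTensor Q (φ ∘ₗ W.subtype) := by
      rw [LinearMap.lTensor_comp_rTensor]
    rw [hsplit, LinearMap.comp_apply] at hy
    have hinj := Module.Flat.lTensor_preserves_injective_linearMap (M := M) Q.subtype
      Q.injective_subtype
    have hy' := hinj (hy.trans (map_zero _).symm)
    have hex := Module.Flat.rTensor_exact Q (LinearMap.exact_subtype_ker_map (φ ∘ₗ W.subtype))
    obtain ⟨w, rfl⟩ := (hex y).1 hy'
    clear hex hy hy'
    induction w using TensorProduct.induction_on with
    | zero => rw [map_zero, map_zero]; exact Submodule.zero_mem _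
    | tmul p u => exact ⟨⟨p.1.1, p.1.2, p.2⟩ ⊗ₜ u, rfl⟩
    | add x y hx hy => rw [map_add, map_add]; exact Submodule.add_mem _ hx hy

theorem harmonicSpinors_eq (k l : ℤ) : harmonicSpinors G R c b τ k l =
    gradedPart G R c τ n k l ⊓
      LinearMap.ker (act G R c τ n (Fminus G R c b) * act G R c τ n (Fbarminus G R c b) +
        act G R c τ n (Fbarminus G R c b) * act G R c τ n (Fminus G R c b)) := by
  have h : TensorProduct.map
      (Algebra.lsmul ℂ ℂ (StandardModule G R c τ) (Eminus G R c b))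
      (LinearMap.id : Spinor n →ₗ[ℂ] Spinor n) =
      act G R c τ n (Eminus G R c b ⊗ₜ[ℂ] (1 : Cliff n)) := by
    refine TensorProduct.ext' fun p u => ?_
    rw [act_tmul, map_one]
    rfl
  rw [harmonicSpinors, harmonics, range_mapIncl_inf_ker, h, ← map_mul, ← map_mul, ← map_add,
    Fminus_mul_Fbarminus_add, map_smul, gradedPart]
  congr 1
  exact (LinearMap.ker_smul _ _ (by norm_num)).symm

theorem spinorProductForm_tmul (β : StandardModule G R c τ →ₗ⋆[ℂ] StandardModule G R c τ →ₗ[ℂ] ℂ)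
    (p q : StandardModule G R c τ) (u w : Spinor n) :
    spinorProductForm G R c τ n β (p ⊗ₜ u) (q ⊗ₜ w) = β p q * spinorForm n u w := rfl

variable {G R c τ} {β : StandardModule G R c τ →ₗ⋆[ℂ] StandardModule G R c τ →ₗ[ℂ] ℂ}
  (hβ : IsContravariantForm G R c τ β)

include hβ

theorem IsContravariantForm.conj_form (x y : PolySpinor G R c τ n) :
    spinorProductForm G R c τ n β y x = conj (spinorProductForm G R c τ n β x y) := by
  induction x using TensorProduct.induction_on with
  | zero => simp
  | add x x' hx hx' => rw [map_add, map_add, LinearMap.add_apply, map_add, hx, hx']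
  | tmul p u =>
    induction y using TensorProduct.induction_on with
    | zero => simp
    | add y y' hy hy' => rw [map_add, map_add, LinearMap.add_apply, map_add, hy, hy']
    | tmul q w =>
      rw [spinorProductForm_tmul, spinorProductForm_tmul, hβ.hermitian p q, spinorForm_conj u w,
        map_mul]

/-- Conjugate-linearity in the first slot turns `xⱼ + i yⱼ` into `ξⱼ - i ηⱼ`. This is where the
factor `2` in `F₋` and `F̄₋` comes from. -/
theorem IsContravariantForm.z_adjoint (j : Fin n) (p q : StandardModule G R c τ) :
    β (z G R c b j • p) q = β p (((2 : ℂ) • zeta G R c b j) • q) := by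
  have h : (2 : ℂ) • zeta G R c b j = vec G R c (b (Sum.inl j)) -
      Complex.I • vec G R c (b (Sum.inr j)) := by
    rw [zeta, smul_smul]; norm_num
  rw [h, z, coord_eq_innerₗ, coord_eq_innerₗ, add_smul, smul_assoc, sub_smul, smul_assoc, map_add,
    LinearMap.map_smulₛₗ, LinearMap.add_apply, LinearMap.smul_apply, hβ.covec_adjoint,
    hβ.covec_adjoint, map_sub, LinearMap.map_smul, Complex.conj_I, neg_smul, sub_eq_add_neg]

theorem IsContravariantForm.zbar_adjoint (j : Fin n) (p q : StandardModule G R c τ) :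
    β (zbar G R c b j • p) q = β p (((2 : ℂ) • zetabar G R c b j) • q) := by
  have h : (2 : ℂ) • zetabar G R c b j = vec G R c (b (Sum.inl j)) +
      Complex.I • vec G R c (b (Sum.inr j)) := by
    rw [zetabar, smul_smul]; norm_num
  rw [h, zbar, coord_eq_innerₗ, coord_eq_innerₗ, sub_smul, smul_assoc, add_smul, smul_assoc,
    map_sub, LinearMap.map_smulₛₗ, LinearMap.sub_apply, LinearMap.smul_apply, hβ.covec_adjoint,
    hβ.covec_adjoint, map_add, LinearMap.map_smul, Complex.conj_I, neg_smul, sub_neg_eq_add]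

omit hβ in
theorem spinorProductForm_adjoint {h h' : RCA G R c} {g g' : Cliff n}
    (hh : ∀ p q, β (h • p) q = β p (h' • q))
    (hg : ∀ u w, spinorForm n (spinAction n g u) w = spinorForm n u (spinAction n g' w))
    (x y : PolySpinor G R c τ n) :
    spinorProductForm G R c τ n β (act G R c τ n (h ⊗ₜ[ℂ] g) x) y =
      spinorProductForm G R c τ n β x (act G R c τ n (h' ⊗ₜ[ℂ] g') y) := by
  induction x using TensorProduct.induction_on with
  | zero => simp
  | add x x' hx hx' => rw [map_add, map_add, map_add, LinearMap.add_apply, LinearMap.add_apply,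
      hx, hx']
  | tmul p u =>
    induction y using TensorProduct.induction_on with
    | zero => simp
    | add y y' hy hy' => rw [map_add, map_add, map_add, hy, hy']
    | tmul q w =>
      rw [act_tmul, act_tmul, spinorProductForm_tmul, spinorProductForm_tmul, hh, hg]

theorem IsContravariantForm.Fplus_adjoint (x y : PolySpinor G R c τ n) :
    spinorProductForm G R c τ n β (act G R c τ n (Fplus G R c b) x) y =
      spinorProductForm G R c τ n β x (act G R c τ n (Fbarminus G R c b) y) := by
  rw [Fplus_eq, Fbarminus_eq, ← oddDown_smul, oddUp, oddDown, map_sum, map_sum,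
    LinearMap.sum_apply, LinearMap.sum_apply, map_sum, map_sum, LinearMap.sum_apply]
  refine Finset.sum_congr rfl fun j _ => ?_
  refine spinorProductForm_adjoint (fun p q => hβ.zbar_adjoint b j p q) (fun u w => ?_) x y
  rw [spinAction_fd, spinAction_f, spinorForm_wedge]

theorem IsContravariantForm.Fbarplus_adjoint (x y : PolySpinor G R c τ n) :
    spinorProductForm G R c τ n β (act G R c τ n (Fbarplus G R c b) x) y =
      spinorProductForm G R c τ n β x (act G R c τ n (Fminus G R c b) y) := by
  rw [Fbarplus_eq, Fminus_eq, ← oddUp_smul, oddUp, oddDown, map_sum, map_sum,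
    LinearMap.sum_apply, LinearMap.sum_apply, map_sum, map_sum, LinearMap.sum_apply]
  refine Finset.sum_congr rfl fun j _ => ?_
  refine spinorProductForm_adjoint (fun p q => hβ.z_adjoint b j p q) (fun u w => ?_) x y
  rw [spinAction_fd, spinAction_f, spinorForm_contr]

end StandardModule

/-! ### Transfer of the abstract decomposition to polynomial spinors. -/

section Decomposition

variable {E : Type*} [NormedAddCommGroup E] [InnerProductSpace ℝ E]
  (G : Subgroup (E ≃ₗᵢ[ℝ] E)) [Fintype G] (R : RootChoice G) (c : G → ℝ)
  {n : ℕ} (b : OrthonormalBasis (Fin n ⊕ Fin n) ℝ E)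
  {V : Type*} [AddCommGroup V] [Module ℂ V] (τ : Representation ℂ G V)

/-- The `ν`-eigenspace of `Z₁` in `M_c(τ)_k ⊗ 𝕊^l`. -/
def gradedEigenspace (k l : ℤ) (ν : ℂ) : Submodule ℂ (PolySpinor G R c τ n) :=
  gradedPart G R c τ n k l ⊓ Module.End.eigenspace (act G R c τ n (Z₁ G R c b)) ν

theorem mem_gradedEigenspace {k l : ℤ} {ν : ℂ} {x : PolySpinor G R c τ n} :
    x ∈ gradedEigenspace G R c b τ k l ν ↔
      x ∈ gradedPart G R c τ n k l ∧ act G R c τ n (Z₁ G R c b) x = ν • x := by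
  rw [gradedEigenspace, Submodule.mem_inf, Module.End.mem_eigenspace_iff]

theorem act_comm {X Y W : RCA G R c ⊗[ℂ] Cliff n} (h : comm X Y = W) {ν : ℂ}
    {x : PolySpinor G R c τ n} (hx : act G R c τ n X x = ν • x) :
    act G R c τ n X (act G R c τ n Y x) = ν • act G R c τ n Y x + act G R c τ n W x := by
  have e : X * Y = Y * X + W := by rw [← h, comm]; abel
  rw [← Module.End.mul_apply, ← map_mul, e, map_add, map_mul, LinearMap.add_apply,
    Module.End.mul_apply, hx, map_smul]

theorem act_add_eq_zero {X Y : RCA G R c ⊗[ℂ] Cliff n} (h : X * Y + Y * X = 0)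
    (x : PolySpinor G R c τ n) :
    act G R c τ n X (act G R c τ n Y x) = -act G R c τ n Y (act G R c τ n X x) := by
  rw [← Module.End.mul_apply, ← Module.End.mul_apply, ← map_mul, ← map_mul,
    eq_neg_of_add_eq_zero_left h, map_neg, LinearMap.neg_apply]

theorem act_mul_self_eq_zero {X : RCA G R c ⊗[ℂ] Cliff n} (h : X * X = 0)
    (x : PolySpinor G R c τ n) : act G R c τ n X (act G R c τ n X x) = 0 := by
  rw [← Module.End.mul_apply, ← map_mul, h, map_zero, LinearMap.zero_apply]

theorem act_anticomm {X Y W : RCA G R c ⊗[ℂ] Cliff n} (h : X * Y + Y * X = W)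
    (x : PolySpinor G R c τ n) :
    act G R c τ n X (act G R c τ n Y x) =
      act G R c τ n W x - act G R c τ n Y (act G R c τ n X x) := by
  rw [← h, map_add, map_mul, map_mul]
  exact (add_sub_cancel_right _ _).symm

/-- `H` acts by `k + n - N_c(τ)` and `Z` by `2l - n - ν`: the `n` cancels here and doubles in `H -
Z`, which accounts for the different constants `t` and `s` in `isOddQuadruple`. -/
theorem act_HH_add_ZZ (hc : IsConjInvariant G c) (hτ : τ.IsIrreducible) {k l : ℤ} {ν : ℂ}
    {x : PolySpinor G R c τ n} (hx : x ∈ gradedEigenspace G R c b τ k l ν) :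
    act G R c τ n (HH G R c b + ZZ G R c b) x =
      ((k : ℂ) - ν + 2 * l + -centralScalar G c τ) • x := by
  obtain ⟨h1, h2⟩ := (mem_gradedEigenspace G R c b τ).1 hx
  rw [map_add, LinearMap.add_apply, act_HH G R c b τ hc hτ h1, act_ZZ G R c b τ h1 h2]
  module

theorem act_HH_sub_ZZ (hc : IsConjInvariant G c) (hτ : τ.IsIrreducible) {k l : ℤ} {ν : ℂ}
    {x : PolySpinor G R c τ n} (hx : x ∈ gradedEigenspace G R c b τ k l ν) :
    act G R c τ n (HH G R c b - ZZ G R c b) x =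
      ((k : ℂ) + ν - 2 * l + (2 * n - centralScalar G c τ)) • x := by
  obtain ⟨h1, h2⟩ := (mem_gradedEigenspace G R c b τ).1 hx
  rw [map_sub, LinearMap.sub_apply, act_HH G R c b τ hc hτ h1, act_ZZ G R c b τ h1 h2]
  module

theorem isOddQuadruple (hc : IsConjInvariant G c) (hτ : τ.IsIrreducible)
    {β : StandardModule G R c τ →ₗ⋆[ℂ] StandardModule G R c τ →ₗ[ℂ] ℂ}
    (hβ : IsContravariantForm G R c τ β)
    (hpos : ∀ u : PolySpinor G R c τ n, u ≠ 0 → 0 < (spinorProductForm G R c τ n β u u).re) :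
    IsOddQuadruple (spinorProductForm G R c τ n β) (act G R c τ n (Fplus G R c b))
      (act G R c τ n (Fbarplus G R c b)) (act G R c τ n (Fminus G R c b))
      (act G R c τ n (Fbarminus G R c b)) (gradedEigenspace G R c b τ)
      (2 * n - centralScalar G c τ) (-centralScalar G c τ) where
  hermitian := hβ.conj_form
  pos := hpos
  adjoint_P := hβ.Fplus_adjoint b
  adjoint_Q := hβ.Fbarplus_adjoint b
  M_P := act_add_eq_zero G R c τ (Fminus_mul_Fplus_add G R c b)
  N_Q := act_add_eq_zero G R c τ (Fbarminus_mul_Fbarplus_add G R c b)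
  M_M := act_mul_self_eq_zero G R c τ (Fminus_mul_self G R c b)
  N_N := act_mul_self_eq_zero G R c τ (Fbarminus_mul_self G R c b)
  P_mem := by
    intro k l ν u hu
    obtain ⟨h1, h2⟩ := (mem_gradedEigenspace G R c b τ).1 hu
    refine (mem_gradedEigenspace G R c b τ).2 ⟨Fplus_mem G R c b τ h1, ?_⟩
    rw [act_comm G R c τ (comm_Z₁_Fplus G R c b) h2, add_smul, one_smul]
  Q_mem := by
    intro k l ν u hu
    obtain ⟨h1, h2⟩ := (mem_gradedEigenspace G R c b τ).1 hu
    refine (mem_gradedEigenspace G R c b τ).2 ⟨Fbarplus_mem G R c b τ h1, ?_⟩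
    rw [act_comm G R c τ (comm_Z₁_Fbarplus G R c b) h2, map_neg, LinearMap.neg_apply]
    module
  M_mem := by
    intro k l ν u hu
    obtain ⟨h1, h2⟩ := (mem_gradedEigenspace G R c b τ).1 hu
    refine (mem_gradedEigenspace G R c b τ).2 ⟨Fminus_mem G R c b τ h1, ?_⟩
    rw [act_comm G R c τ (comm_Z₁_Fminus G R c b) h2, add_smul, one_smul]
  N_mem := by
    intro k l ν u hu
    obtain ⟨h1, h2⟩ := (mem_gradedEigenspace G R c b τ).1 hu
    refine (mem_gradedEigenspace G R c b τ).2 ⟨Fbarminus_mem G R c b τ h1, ?_⟩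
    rw [act_comm G R c τ (comm_Z₁_Fbarminus G R c b) h2, map_neg, LinearMap.neg_apply]
    module
  N_P := by
    intro k l ν u hu
    have h := Fplus_mul_Fbarminus_add G R c b
    rw [add_comm] at h
    rw [act_anticomm G R c τ h, act_HH_sub_ZZ G R c b τ hc hτ hu]
  M_Q := by
    intro k l ν u hu
    rw [act_anticomm G R c τ (Fminus_mul_Fbarplus_add G R c b),
      act_HH_add_ZZ G R c b τ hc hτ hu]

theorem harmonicEigenspace_eq (k l : ℤ) (ν : ℂ) : harmonicEigenspace G R c b τ k l ν =
    IsOddQuadruple.harmonic (act G R c τ n (Fminus G R c b)) (act G R c τ n (Fbarminus G R c b))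
      (gradedEigenspace G R c b τ) k l ν := by
  rw [harmonicEigenspace, harmonicSpinors_eq, IsOddQuadruple.harmonic, gradedEigenspace,
    inf_right_comm]

theorem monogenics_eq (k l : ℤ) (ν : ℂ) : monogenics G R c b τ k l ν =
    IsOddQuadruple.monogenic (act G R c τ n (Fminus G R c b)) (act G R c τ n (Fbarminus G R c b))
      (gradedEigenspace G R c b τ) k l ν := by
  rw [monogenics, harmonicEigenspace_eq, IsOddQuadruple.monogenic]

theorem summand_eq (k l : ℤ) (ν : ℂ) : summand G R c b τ k l ν =
    IsOddQuadruple.pieces (act G R c τ n (Fplus G R c b)) (act G R c τ n (Fbarplus G R c b))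
      (act G R c τ n (Fminus G R c b)) (act G R c τ n (Fbarminus G R c b))
      (gradedEigenspace G R c b τ) (2 * n - centralScalar G c τ) (-centralScalar G c τ) k l ν := by
  have h1 : lam₁ G c τ n k l ν =
      (k : ℂ) - 2 + ν - 2 * l + (2 * n - centralScalar G c τ) := by rw [lam₁]; ring
  have h2 : lam₂ G c τ k l ν = (k : ℂ) - 2 - ν + 2 * l + -centralScalar G c τ := by
    rw [lam₂]; ring
  rw [summand, IsOddQuadruple.pieces, h1, h2, map_sub, map_smul, map_smul, map_mul, map_mul]
  simp only [monogenics_eq]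

theorem monogenics_le (k l : ℤ) (ν : ℂ) :
    monogenics G R c b τ k l ν ≤ gradedPart G R c τ n k l := by
  rw [monogenics_eq]
  intro x hx
  exact ((mem_gradedEigenspace G R c b τ).1 (IsOddQuadruple.mem_monogenic.1 hx).1).1

theorem gradedPart_of_degreePart {k l : ℤ} (h : degreePart G R c τ k = ⊥) :
    gradedPart G R c τ n k l = ⊥ := by
  rw [eq_bot_iff]
  intro x hx
  refine gradedPart_induction G R c τ (P := fun x => x ∈ ⊥) (fun p hp u _ => ?_)
    (fun x y hx hy => Submodule.add_mem _ hx hy) (Submodule.zero_mem _) hx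
  rw [h, Submodule.mem_bot] at hp
  rw [hp, TensorProduct.zero_tmul]
  exact Submodule.zero_mem _

theorem gradedPart_of_spinorDegree {k l : ℤ} (h : spinorDegree n l = ⊥) :
    gradedPart G R c τ n k l = ⊥ := by
  rw [eq_bot_iff]
  intro x hx
  refine gradedPart_induction G R c τ (P := fun x => x ∈ ⊥) (fun p _ u hu => ?_)
    (fun x y hx hy => Submodule.add_mem _ hx hy) (Submodule.zero_mem _) hx
  rw [h, Submodule.mem_bot] at hu
  rw [hu, TensorProduct.tmul_zero]
  exact Submodule.zero_mem _

theorem map_monogenics_of_gradedPart {k l : ℤ} (ν : ℂ) (h : gradedPart G R c τ n k l = ⊥)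
    (φ : Module.End ℂ (PolySpinor G R c τ n)) :
    (monogenics G R c b τ k l ν).map φ = ⊥ := by
  rw [eq_bot_iff.2 ((monogenics_le G R c b τ k l ν).trans h.le), Submodule.map_bot]

end Decomposition

end CherednikSpinor

end

/-! ### The proposition. -/

theorem propositionp
    {E : Type*} [NormedAddCommGroup E] [InnerProductSpace ℝ E]
    {n : ℕ} (b : OrthonormalBasis (Fin n ⊕ Fin n) ℝ E)
    (G : Subgroup (E ≃ₗᵢ[ℝ] E)) [Fintype G] (hG : CherednikSpinor.IsReflectionGroup G)
    (R : CherednikSpinor.RootChoice G)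
    (c : G → ℝ) (hc : CherednikSpinor.IsConjInvariant G c)
    {V : Type*} [AddCommGroup V] [Module ℂ V]
    (τ : Representation ℂ G V) (hτ : τ.IsIrreducible)
    (β : CherednikSpinor.StandardModule G R c τ →ₗ⋆[ℂ]
      CherednikSpinor.StandardModule G R c τ →ₗ[ℂ] ℂ)
    (hβ : CherednikSpinor.IsContravariantForm G R c τ β)
    (hpos : ∀ u : CherednikSpinor.PolySpinor G R c τ n, u ≠ 0 →
      0 < (CherednikSpinor.spinorProductForm G R c τ n β u u).re)
    (k l : ℕ) (ν : ℂ) :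
    -- orthogonal direct sum decomposition
    (CherednikSpinor.harmonicEigenspace G R c b τ k l ν =
        ⨆ i, CherednikSpinor.summand G R c b τ k l ν i) ∧
      iSupIndep (CherednikSpinor.summand G R c b τ k l ν) ∧
      (∀ i j, i ≠ j → ∀ u ∈ CherednikSpinor.summand G R c b τ k l ν i,
        ∀ w ∈ CherednikSpinor.summand G R c b τ k l ν j,
          CherednikSpinor.spinorProductForm G R c τ n β u w = 0) ∧
      -- the scalars are the eigenvalues of `H - Z - 2` and `H + Z - 2`
      (∀ u ∈ CherednikSpinor.harmonicEigenspace G R c b τ k l ν,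
        CherednikSpinor.act G R c τ n
            (CherednikSpinor.HH G R c b - CherednikSpinor.ZZ G R c b - 2) u =
          CherednikSpinor.lam₁ G c τ n k l ν • u) ∧
      (∀ u ∈ CherednikSpinor.harmonicEigenspace G R c b τ k l ν,
        CherednikSpinor.act G R c τ n
            (CherednikSpinor.HH G R c b + CherednikSpinor.ZZ G R c b - 2) u =
          CherednikSpinor.lam₂ G c τ k l ν • u) ∧
      -- vanishing of summands in the extreme degrees
      (k = 0 → ∀ i, i ≠ 0 → CherednikSpinor.summand G R c b τ k l ν i = ⊥) ∧
      (k = 1 → CherednikSpinor.summand G R c b τ k l ν 3 = ⊥) ∧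
      (l = 0 → CherednikSpinor.summand G R c b τ k l ν 1 = ⊥) ∧
      (l = n → CherednikSpinor.summand G R c b τ k l ν 2 = ⊥) := by
  have h := CherednikSpinor.isOddQuadruple G R c b τ hc hτ hβ hpos
  have h2 : ∀ u : CherednikSpinor.PolySpinor G R c τ n,
      CherednikSpinor.act G R c τ n 2 u = (2 : ℂ) • u := fun u => by
    rw [map_ofNat]
    exact (Module.End.ofNat_apply 2 u).trans (ofNat_smul_eq_nsmul ℂ 2 u).symm
  have hneg : ∀ {k' : ℤ}, k' < 0 → ∀ l' : ℤ,
      CherednikSpinor.gradedPart G R c τ n k' l' = ⊥ := fun hk _ =>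
    CherednikSpinor.gradedPart_of_degreePart G R c τ
      (CherednikSpinor.degreePart_of_neg G R c τ hk)
  refine ⟨?_, ?_, ?_, fun u hu => ?_, fun u hu => ?_, ?_, ?_, ?_, ?_⟩
  · rw [CherednikSpinor.harmonicEigenspace_eq, CherednikSpinor.summand_eq]
    exact h.harmonic_eq_iSup k l ν
  · rw [CherednikSpinor.summand_eq]
    exact h.iSupIndep_pieces k l ν
  · rw [CherednikSpinor.summand_eq]
    exact fun i j hij u hu w hw => h.orthogonal k l ν hij hu hw
  · rw [CherednikSpinor.harmonicEigenspace_eq] at hu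
    have hu' := (CherednikSpinor.IsOddQuadruple.mem_harmonic.1 hu).1
    rw [map_sub, LinearMap.sub_apply, h2, CherednikSpinor.act_HH_sub_ZZ G R c b τ hc hτ hu',
      CherednikSpinor.lam₁]
    module
  · rw [CherednikSpinor.harmonicEigenspace_eq] at hu
    have hu' := (CherednikSpinor.IsOddQuadruple.mem_harmonic.1 hu).1
    rw [map_sub, LinearMap.sub_apply, h2, CherednikSpinor.act_HH_add_ZZ G R c b τ hc hτ hu',
      CherednikSpinor.lam₂]
    module
  -- The last three summands come from degrees `-1`, `-1` and `-2`, where the standard module is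
  -- zero.
  · rintro rfl i hi
    fin_cases i
    · exact absurd rfl hi
    all_goals
      exact CherednikSpinor.map_monogenics_of_gradedPart G R c b τ _ (hneg (by norm_num) _) _
  · rintro rfl
    exact CherednikSpinor.map_monogenics_of_gradedPart G R c b τ _ (hneg (by norm_num) _) _
  · rintro rfl
    exact CherednikSpinor.map_monogenics_of_gradedPart G R c b τ _
      (CherednikSpinor.gradedPart_of_spinorDegree G R c τ
        (CherednikSpinor.spinorDegree_of_neg (by norm_num))) _
  -- The third summand comes from spinor degree `n + 1`, which is zero.
  · rintro rfl
    exact CherednikSpinor.map_monogenics_of_gradedPart G R c b τ _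
      (CherednikSpinor.gradedPart_of_spinorDegree G R c τ
        CherednikSpinor.spinorDegree_succ_top) _
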